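/- Let $\nu\ge 0$ be an integer (for $\nu\ge1$ this is the $\nu$-dimensional cubic lattice $\mathbb{Z}^\nu$), and let $\mathcal{F}(\mathcal H)=\bigoplus_k\bigwedge^k\mathcal H$ be the antisymmetric Fock space over a Hilbert space $\mathcal H$, with creation operators $c^*(x)$ and annihilation operators $c(x)=c^*(x)^*$, $x\in\mathcal H$. Let $\mathrm{CAR}(\mathcal H)$ be the norm closure of the $*$-algebra that they generate. A quasi-free state with symbol $Q\in\mathcal B(\mathcal H)$ is a positive normalized linear functional $\omega_Q$ on $\mathrm{CAR}(\mathcal H)$ such that $$\omega_Q\big(c(x_1)^*\cdots c(x_n)^*c(y_m)\cdots c(y_1)\big)=\delta_{mn}\det\{\langle y_i,Qx_j\rangle\}_{i,j}$$ for all $x_1,\dots,x_n,y_1,\dots,y_m\in\mathcal H$. Let $F:\ell^2(\mathbb{Z}^\nu)\to L^2([0,2\pi)^\nu)$, $F\mathbf 1_{\{k\}}=e^{i\langle k,\cdot\rangle}$, be the Fourier transformation, and let $M_a$ denote multiplication by the function $a$. For positive semidefinite operators $\rho,\sigma$ on a finite-dimensional Hilbert space and $\alpha>0$ let $$\psi(\alpha|\rho\|\sigma)=\log\operatorname{Tr}\rho^{\alpha}\sigma^{1-\alpha},\qquad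 \psi^{*}(\alpha|\rho\|\sigma)=\log\operatorname{Tr}\big(\rho^{\frac12}\sigma^{\frac{1-\alpha}{\alpha}}\rho^{\frac12}\big)^{\alpha},$$ with powers taken on supports, and let $D_1(\rho\|\sigma)=\frac{1}{\operatorname{Tr}\rho}\left[\operatorname{Tr}\rho\log\rho-\operatorname{Tr}\rho\log\sigma\right]$ if $\operatorname{supp}\rho\subseteq\operatorname{supp}\sigma$, with logarithms taken on supports, and $D_1(\rho\|\sigma)=+\infty$ otherwise. **Theorem.** Let $q,r:[0,2\pi)^\nu\to\mathbb{R}$ be measurable, and suppose that for some $c\in(0,1/2)$ we have $c\le q\le 1-c$ and $c\le r\le 1-c$ almost everywhere. Let $\omega_Q,\omega_R$ be quasi-free states on $\mathrm{CAR}(\ell^2(\mathbb{Z}^\nu))$ with symbols $Q=F^{-1}M_qF$ and $R=F^{-1}M_rF$. Let $P_n$ be the projection of $\ell^2(\mathbb Z^\nu)$ onto the functions supported on $\{0,\dots,n-1\}^\nu$, and let $\omega_{Q_n},\omega_{R_n}$ be the density operators on $\mathcal F(\operatorname{ran}P_n)$ of the restrictions of $\omega_Q,\omega_R$ to $\mathrm{CAR}(\operatorname{ran}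 P_n)$. Then $\omega_{Q_n}$ and $\omega_{R_n}$ are the density operators of the quasi-free states with symbols $Q_n=P_nQP_n$ and $R_n=P_nRP_n$. Put $$\overline\psi(\alpha):=\limsup_{n\to\infty}\frac1{n^\nu}\psi^*(\alpha|\omega_{Q_n}\|\omega_{R_n}).$$ Then for every $\alpha>0$ $$\overline\psi(\alpha)=\lim_{n\to\infty}\frac{1}{n^{\nu}}\psi(\alpha|\omega_{Q_n}\|\omega_{R_n})=\lim_{n\to\infty}\frac{1}{n^{\nu}}\psi^{*}(\alpha|\omega_{Q_n}\|\omega_{R_n}) =\frac{1}{(2\pi)^{\nu}}\int_{[0,2\pi)^{\nu}}\log\left[q(x)^{\alpha}r(x)^{1-\alpha}+(1-q(x))^{\alpha}(1-r(x))^{1-\alpha}\right]dx .$$ Moreover, $\overline\psi$ is differentiable on $(0,+\infty)$, and $$\overline\psi'(1)=\frac{1}{(2\pi)^{\nu}}\int_{[0,2\pi)^{\nu}}\left[q(x)\log\frac{q(x)}{r(x)}+(1-q(x))\log\frac{1-q(x)}{1-r(x)}\right]dx=\lim_{n\to\infty}\frac{1}{n^{\nu}}D_1(\omega_{Q_n}\|\omega_{R_n}),$$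 where all the integrands are integrable. -/

import Mathlib

open Filter Topology MeasureTheory
open scoped Matrix ENNReal ComplexOrder

noncomputable section

namespace Fermion

/-! ### Fermionic Fock space over a linearly ordered set of modes -/

/-- The one-particle space `ℓ²(X)`. -/
abbrev OneParticle (X : Type*) := lp (fun _ : X => ℂ) 2

/-- The antisymmetric Fock space over `ℓ²(X)` in the occupation number representation: the finite
set `S = {s₁ < ⋯ < s_k}` labels the orthonormal basis vector `e_{s₁} ∧ ⋯ ∧ e_{s_k}`. -/
abbrev Fock (X : Type*) := lp (fun _ : Finset X => ℂ) 2

section Modes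

variable {X : Type*} [LinearOrder X]

/-- For `k ∈ S`, the sign in `e_k ∧ e_{S \ {k}} = ± e_S`. -/
def modeSign (k : X) (S : Finset X) : ℂ := (-1) ^ (S.filter (· < k)).card

/-- Creation in the mode `k` in coordinates: `e_S ↦ e_k ∧ e_S`. -/
def createFun (k : X) (f : Finset X → ℂ) (S : Finset X) : ℂ :=
  if k ∈ S then modeSign k S * f (S.erase k) else 0

theorem createFun_sum_le (k : X) (f : Fock X) (s : Finset (Finset X)) :
    ∑ S ∈ s, ‖createFun k f S‖ ^ (2 : ℝ≥0∞).toReal ≤ ‖f‖ ^ (2 : ℝ≥0∞).toReal := by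
  have h1 : ∑ S ∈ s, ‖createFun k f S‖ ^ (2 : ℝ≥0∞).toReal =
      ∑ S ∈ s.filter (k ∈ ·), ‖f (S.erase k)‖ ^ (2 : ℝ≥0∞).toReal := by
    rw [Finset.sum_filter]
    refine Finset.sum_congr rfl fun S _ => ?_
    by_cases h : k ∈ S <;> simp [createFun, h, modeSign]
  have h2 : Set.InjOn (fun S : Finset X => S.erase k)
      (s.filter (k ∈ ·) : Finset (Finset X)) := by
    intro S hS T hT h
    simp only [Finset.coe_filter, Set.mem_ofPred_eq] at hS hT
    have h' : S.erase k = T.erase k := h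
    rw [← Finset.insert_erase hS.2, ← Finset.insert_erase hT.2, h']
  rw [h1, ← Finset.sum_image (f := fun T => ‖f T‖ ^ (2 : ℝ≥0∞).toReal) h2]
  exact lp.sum_rpow_le_norm_rpow (by norm_num) f _

/-- The creation operator `c*(e_k)` of the mode `k`. -/
def modeCreate (k : X) : Fock X →L[ℂ] Fock X :=
  LinearMap.mkContinuous
    { toFun := fun f => ⟨createFun k f, memℓp_gen' (createFun_sum_le k f)⟩
      map_add' := fun f g => by
        ext S
        change createFun k (f + g) S = createFun k f S + createFun k g S
        by_cases h : k ∈ S <;> simp [createFun, h, mul_add]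
      map_smul' := fun a f => by
        ext S
        change createFun k (a • f) S = a * createFun k f S
        by_cases h : k ∈ S <;> simp [createFun, h, mul_left_comm] }
    1 (fun f => by
      rw [one_mul]
      exact lp.norm_le_of_forall_sum_le (by norm_num) (norm_nonneg f) (createFun_sum_le k f))

/-- The creation operator `c*(x) = ∑_k x_k c*(e_k)`, `x ∈ ℓ²(X)`; the series converges
unconditionally in operator norm because of the anticommutation relations. -/
def create (x : OneParticle X) : Fock X →L[ℂ] Fock X := ∑' k, x k • modeCreate k

/-- The annihilation operator `c(x) = c*(x)*`. -/
def annihilate (x : OneParticle X) : Fock X →L[ℂ] Fock X := star (create x)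

end Modes

/-- The CAR algebra over `ℓ²(X)`: the norm-closed *-algebra generated by the creation and
annihilation operators on Fock space. -/
abbrev CAR (X : Type*) [LinearOrder X] : StarSubalgebra ℂ (Fock X →L[ℂ] Fock X) :=
  (StarAlgebra.adjoin ℂ (Set.range (annihilate (X := X)))).topologicalClosure

/-- `c(x)` as an element of the CAR algebra. -/
def carC {X : Type*} [LinearOrder X] (x : OneParticle X) : CAR X :=
  ⟨annihilate x, StarSubalgebra.le_topologicalClosure _
    (StarAlgebra.subset_adjoin ℂ _ ⟨x, rfl⟩)⟩

/-- `ω` is a gauge-invariant quasi-free state on the CAR algebra over `ℓ²(X)` with symbol `Q`: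
it is linear, positive, normalized, and
`ω(c(x₁)* ⋯ c(x_n)* c(y_m) ⋯ c(y₁)) = δ_{mn} det (⟨y_i, Q x_j⟩)`. -/
structure IsQuasiFreeState {X : Type*} [LinearOrder X]
    (Q : OneParticle X →L[ℂ] OneParticle X) (ω : CAR X →ₗ[ℂ] ℂ) : Prop where
  nonneg : ∀ A : CAR X, 0 ≤ ω (star A * A)
  map_one : ω 1 = 1
  correlation : ∀ (n : ℕ) (x y : Fin n → OneParticle X),
    ω ((List.ofFn fun i => star (carC (x i))).prod * (List.ofFn fun i => carC (y i)).reverse.prod)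
      = Matrix.det (Matrix.of fun i j => inner ℂ (y i) (Q (x j)))
  correlation_ne : ∀ (n m : ℕ) (x : Fin n → OneParticle X) (y : Fin m → OneParticle X), n ≠ m →
    ω ((List.ofFn fun i => star (carC (x i))).prod * (List.ofFn fun i => carC (y i)).reverse.prod)
      = 0

/-! ### Finitely many modes: operators on Fock space as matrices -/

section Finite

variable {X : Type*} [LinearOrder X] [Fintype X]

/-- The creation operator `c*(x)`, `x ∈ ℂ^X`, for finitely many modes, as a matrix in the
occupation number basis of the Fock space over `ℂ^X`. -/
def createMat (x : X → ℂ) : Matrix (Finset X) (Finset X) ℂ :=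
  ∑ k, x k • Matrix.of fun S T => if k ∈ S ∧ T = S.erase k then modeSign k S else 0

/-- The annihilation operator `c(x) = c*(x)*` for finitely many modes. -/
def annihilateMat (x : X → ℂ) : Matrix (Finset X) (Finset X) ℂ := (createMat x)ᴴ

/-- `ρ` is the density operator, on the Fock space over `ℂ^X`, of the gauge-invariant quasi-free
state with symbol `T`. -/
structure IsQuasiFreeDensity (T : Matrix X X ℂ) (ρ : Matrix (Finset X) (Finset X) ℂ) : Prop where
  posSemidef : ρ.PosSemidef
  trace_eq_one : ρ.trace = 1
  correlation : ∀ (n : ℕ) (x y : Fin n → X → ℂ),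
    (ρ * ((List.ofFn fun i => createMat (x i)).prod *
      (List.ofFn fun i => annihilateMat (y i)).reverse.prod)).trace
      = Matrix.det (Matrix.of fun i j => star (y i) ⬝ᵥ (T *ᵥ x j))
  correlation_ne : ∀ (n m : ℕ) (x : Fin n → X → ℂ) (y : Fin m → X → ℂ), n ≠ m →
    (ρ * ((List.ofFn fun i => createMat (x i)).prod *
      (List.ofFn fun i => annihilateMat (y i)).reverse.prod)).trace = 0

end Finite

/-! ### Restriction to finitely many modes -/

section Restriction

variable {X : Type*} [LinearOrder X]

/-- The inclusion `ℂ^Λ → ℓ²(X)`. -/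
def extendVec (Λ : Finset X) (x : Λ → ℂ) : OneParticle X := ∑ k : Λ, x k • lp.single 2 (k : X) (1 : ℂ)

/-- The matrix of `P Q P` on `ran P = ℓ²(Λ)`, where `P` is the orthogonal projection of `ℓ²(X)`
onto the span of `e_k`, `k ∈ Λ`. -/
def compress (Q : OneParticle X →L[ℂ] OneParticle X) (Λ : Finset X) : Matrix Λ Λ ℂ :=
  Matrix.of fun k l => inner ℂ (lp.single 2 (k : X) (1 : ℂ) : OneParticle X)
    (Q (lp.single 2 (l : X) (1 : ℂ)))

/-- `ρ` is the density operator, on the Fock space over `ℂ^Λ`, of the restriction of `ω` to the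
modes in `Λ`: all operators on that Fock space are identified with elements of the CAR algebra
through the *-homomorphism that maps `c(x)` to `c(x)` for `x ∈ ℂ^Λ ⊆ ℓ²(X)`. -/
structure IsReducedDensity (ω : CAR X →ₗ[ℂ] ℂ) (Λ : Finset X)
    (ρ : Matrix (Finset Λ) (Finset Λ) ℂ) : Prop where
  posSemidef : ρ.PosSemidef
  trace_eq_one : ρ.trace = 1
  trace_mul : ∃ φ : Matrix (Finset Λ) (Finset Λ) ℂ →⋆ₐ[ℂ] CAR X,
    (∀ x : Λ → ℂ, φ (annihilateMat x) = carC (extendVec Λ x)) ∧ ∀ A, (ρ * A).trace = ω (φ A)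

end Restriction

/-! ### The lattice `ℤ^ν` and translation-invariant symbols -/

/-- The lattice `ℤ^ν`; the lexicographic order only serves to enumerate the modes. -/
abbrev IntLattice (ν : ℕ) := Lex (Fin ν → ℤ)

/-- The hypercube `{0, …, n-1}^ν`. -/
def box (ν n : ℕ) : Finset (IntLattice ν) :=
  (Fintype.piFinset fun _ : Fin ν => Finset.Ico (0 : ℤ) n).map toLex.toEmbedding

/-- The cube `[0, 2π)^ν`. -/
def cube (ν : ℕ) : Set (Fin ν → ℝ) := Set.univ.pi fun _ => Set.Ico 0 (2 * Real.pi)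

/-- Lebesgue measure on `[0, 2π)^ν`. -/
def cubeMeasure (ν : ℕ) : Measure (Fin ν → ℝ) := volume.restrict (cube ν)

/-- `φ_k(t) = exp(i ⟨k, t⟩)`. -/
def planeWave {ν : ℕ} (k : IntLattice ν) (t : Fin ν → ℝ) : ℂ :=
  Complex.exp (Complex.I * ∑ i, (ofLex k i : ℂ) * (t i : ℂ))

theorem memLp_planeWave {ν : ℕ} (k : IntLattice ν) : MemLp (planeWave k) 2 (cubeMeasure ν) := by
  have : IsFiniteMeasure (cubeMeasure ν) := by
    refine ⟨?_⟩
    rw [cubeMeasure, Measure.restrict_apply_univ, cube, Real.volume_pi_Ico]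
    exact ENNReal.prod_lt_top fun _ _ => ENNReal.ofReal_lt_top
  refine MemLp.of_bound (C := 1) ?_ (Eventually.of_forall fun t => ?_)
  · have : Continuous (planeWave k) := by unfold planeWave; fun_prop
    exact this.aestronglyMeasurable
  · have h : Complex.I * ∑ i, (ofLex k i : ℂ) * (t i : ℂ) =
        ((∑ i, (ofLex k i : ℝ) * t i : ℝ) : ℂ) * Complex.I := by push_cast; ring
    rw [planeWave, h, Complex.norm_exp_ofReal_mul_I]

/-- The Fourier transformation `F : ℓ²(ℤ^ν) → L²([0, 2π)^ν)`, `F x = ∑_k x_k φ_k`; the series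
converges unconditionally in `L²` because the `φ_k` are orthogonal and have equal norms. -/
def fourierL2 {ν : ℕ} (x : OneParticle (IntLattice ν)) : Lp ℂ 2 (cubeMeasure ν) :=
  ∑' k, x k • (memLp_planeWave k).toLp (planeWave k)

/-- `Q = F⁻¹ M_q F`, that is `F Q = M_q F`, where `M_q` is multiplication by `q`. -/
def HasFourierSymbol {ν : ℕ} (q : (Fin ν → ℝ) → ℝ)
    (Q : OneParticle (IntLattice ν) →L[ℂ] OneParticle (IntLattice ν)) : Prop :=
  ∀ x, (fourierL2 (Q x) : (Fin ν → ℝ) → ℂ) =ᵐ[cubeMeasure ν] fun t => (q t : ℂ) * fourierL2 x t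

/-! ### Rényi quantities -/

section Renyi

variable {m : Type*} [Fintype m] [DecidableEq m]

/-- The power `A ^ t` of a positive semidefinite operator, taken on its support only. -/
def suppPow (A : Matrix m m ℂ) (t : ℝ) : Matrix m m ℂ :=
  cfc (fun x : ℝ => if x = 0 then 0 else x ^ t) A

/-- The logarithm of a positive semidefinite operator, `0` off its support (`Real.log 0 = 0`). -/
def suppLog (A : Matrix m m ℂ) : Matrix m m ℂ := cfc Real.log A

/-- The Petz version `ψ(α|ρ‖σ) = log Tr ρ^α σ^(1-α)`. -/
def psiPetz (α : ℝ) (ρ σ : Matrix m m ℂ) : ℝ :=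
  Real.log (suppPow ρ α * suppPow σ (1 - α)).trace.re

/-- The sandwiched version `ψ*(α|ρ‖σ) = log Tr (ρ^(1/2) σ^((1-α)/α) ρ^(1/2))^α`. -/
def psiSandwiched (α : ℝ) (ρ σ : Matrix m m ℂ) : ℝ :=
  Real.log (suppPow (suppPow ρ (1 / 2) * suppPow σ ((1 - α) / α) * suppPow ρ (1 / 2)) α).trace.re

open Classical in
/-- The relative entropy `D₁(ρ‖σ) = (Tr ρ)⁻¹ (Tr ρ log ρ - Tr ρ log σ)` if `supp ρ ⊆ supp σ`
(that is, `ker σ ⊆ ker ρ`), and `+∞` otherwise. -/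
def relEntropy (ρ σ : Matrix m m ℂ) : EReal :=
  if ∀ v : m → ℂ, σ *ᵥ v = 0 → ρ *ᵥ v = 0 then
    (((ρ * suppLog ρ).trace.re - (ρ * suppLog σ).trace.re) / ρ.trace.re : ℝ)
  else ⊤

end Renyi

/-- `limsup_n n^(-ν) ψ*(α|ρ_n‖σ_n)` for states `ρ_n`, `σ_n` on the hypercubes of side `n`. -/
def psiBar {ν : ℕ} (ρ σ : ∀ n, Matrix (Finset (box ν n)) (Finset (box ν n)) ℂ) (α : ℝ) : ℝ :=
  limsup (fun n : ℕ => psiSandwiched α (ρ n) (σ n) / (n : ℝ) ^ ν) atTop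

/-- `q^α r^(1-α) + (1-q)^α (1-r)^(1-α)`, under the logarithm. -/
def logIntegrand (α q r : ℝ) : ℝ :=
  Real.log (q ^ α * r ^ (1 - α) + (1 - q) ^ α * (1 - r) ^ (1 - α))

/-- `q log (q/r) + (1-q) log ((1-q)/(1-r))`. -/
def entropyIntegrand (q r : ℝ) : ℝ :=
  q * Real.log (q / r) + (1 - q) * Real.log ((1 - q) / (1 - r))

end Fermion

end

/-! The proof joins an exact formula on finitely many modes to a Szegő-type limit theorem.

The algebraic half: a quasi-free density whose symbol Q has spectrum strictly inside (0,1) equals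
exp(Tr log(1-Q)) Γ(Q/(1-Q)), where Γ is second quantization. This is seen by diagonalizing Q and
comparing normal ordered moments (`IsQuasiFreeDensity.eq_conj_diagonal`,
`IsQuasiFreeDensity.suppPow_eq`). Since Γ is multiplicative and Tr Γ(H) = det(1+H), quantities on
the 2^N-dimensional Fock space collapse to traces over the N-dimensional one-particle space, even
though the symbols Q and R need not commute: `psiPetz_eq`, `psiSandwiched_eq`, `relEntropy_eq`.

The analytic half: the compressions of multiplication operators to a box are Toeplitz matrices. The
product of two compressions differs from the compression of the product by a matrix of squared
Hilbert–Schmidt norm o(n^ν) (`tendsto_hsNorm_compr_mul`), because each column of the error is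
controlled by the mass that a plane wave at site l, multiplied by the function, sends out of the
box, and this mass is small on average over l. Hence sequences with a symbol (`HasSymbol`) are
stable under sums, products and, by Weierstrass approximation, continuous functional calculus
(`HasSymbol.cfc`), while normalized traces converge to the mean of the symbol
(`HasSymbol.tendsto_trace`). In the limit the noncommuting matrices are thus replaced by scalar
functions, for which the Petz and sandwiched expressions coincide.

The limit function is differentiated under the integral; the derivative of the integrand is bounded
uniformly in α (`abs_logIntegrandDeriv_le`). The limit of the relative entropies comes directly from
the trace asymptotics, so no limit is interchanged with a derivative in α. -/

noncomputable section

namespace Fermion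

/-! ### Anticommutation relations and second quantization for finitely many modes. -/

section FiniteFock

variable {X : Type*} [LinearOrder X]

theorem modeSign_mul_self (k : X) (S : Finset X) : modeSign k S * modeSign k S = 1 := by
  rw [modeSign, ← mul_pow]; norm_num

theorem star_modeSign (k : X) (S : Finset X) : star (modeSign k S) = modeSign k S := by
  simp [modeSign]

theorem norm_modeSign (k : X) (S : Finset X) : ‖modeSign k S‖ = 1 := by
  simp [modeSign]

theorem modeSign_insert (k l : X) (S : Finset X) (h : l ∉ S) :
    modeSign k (insert l S) = if l < k then -modeSign k S else modeSign k S := by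
  unfold modeSign
  rw [Finset.filter_insert]
  split_ifs with hl
  · rw [Finset.card_insert_of_notMem (by simp [h]), pow_succ]; ring
  · rfl

theorem modeSign_erase (k l : X) (S : Finset X) (h : l ∈ S) :
    modeSign k (S.erase l) = if l < k then -modeSign k S else modeSign k S := by
  have := modeSign_insert k l (S.erase l) (by simp)
  rw [Finset.insert_erase h] at this
  rw [this]
  split_ifs <;> simp

variable [Fintype X]

/-- The creation matrix of a single mode. -/
def modeMat (k : X) : Matrix (Finset X) (Finset X) ℂ :=
  Matrix.of fun S T => if k ∈ S ∧ T = S.erase k then modeSign k S else 0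

theorem createMat_eq_sum (x : X → ℂ) : createMat x = ∑ k, x k • modeMat k := rfl

theorem modeMat_mulVec (k : X) (f : Finset X → ℂ) (S : Finset X) :
    (modeMat k *ᵥ f) S = if k ∈ S then modeSign k S * f (S.erase k) else 0 := by
  simp only [Matrix.mulVec, dotProduct, modeMat, Matrix.of_apply]
  by_cases h : k ∈ S <;> simp [h]

theorem modeMat_conjTranspose_mulVec (k : X) (f : Finset X → ℂ) (S : Finset X) :
    ((modeMat k)ᴴ *ᵥ f) S = if k ∈ S then 0 else modeSign k S * f (insert k S) := by
  simp only [Matrix.mulVec, dotProduct, modeMat, Matrix.conjTranspose_apply, Matrix.of_apply]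
  by_cases h : k ∈ S
  · simp only [h, if_true]
    refine Finset.sum_eq_zero fun T _ => ?_
    rw [if_neg, star_zero, zero_mul]
    rintro ⟨_, rfl⟩
    simp at h
  · simp only [h, if_false]
    rw [Finset.sum_eq_single (insert k S)]
    · rw [if_pos (by simp [h]), star_modeSign, modeSign_insert _ _ _ h, if_neg (lt_irrefl _)]
    · intro T _ hT
      rw [if_neg, star_zero, zero_mul]
      rintro ⟨hk, rfl⟩
      exact hT (Finset.insert_erase hk).symm
    · simp

/-- Removing the smaller of the two modes flips the sign attached to the larger one, but not
conversely; so the two orders differ by exactly one sign. -/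
theorem modeMat_anticomm (k l : X) : modeMat k * modeMat l = -(modeMat l * modeMat k) := by
  refine Matrix.ext_of_mulVec_single fun T => ?_
  generalize (Pi.single T (1 : ℂ) : Finset X → ℂ) = f
  funext S
  rw [Matrix.neg_mulVec, Pi.neg_apply, ← Matrix.mulVec_mulVec, ← Matrix.mulVec_mulVec,
    modeMat_mulVec, modeMat_mulVec]
  simp only [modeMat_mulVec]
  by_cases hk : k ∈ S <;> by_cases hl : l ∈ S <;> simp only [hk, hl, if_true, if_false,
    Finset.mem_erase, and_true, and_false, mul_zero, neg_zero]
  by_cases hkl : k = l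
  · simp [hkl]
  · rw [if_pos (Ne.symm hkl), if_pos hkl, Finset.erase_right_comm, modeSign_erase _ _ _ hk,
      modeSign_erase _ _ _ hl]
    rcases lt_or_gt_of_ne hkl with h | h
    · simp only [h, h.not_gt, if_true, if_false]; ring
    · simp only [h, h.not_gt, if_true, if_false]; ring

theorem modeMat_conjTranspose_anticomm (k l : X) :
    (modeMat k)ᴴ * modeMat l + modeMat l * (modeMat k)ᴴ = if k = l then 1 else 0 := by
  refine Matrix.ext_of_mulVec_single fun T => ?_
  generalize (Pi.single T (1 : ℂ) : Finset X → ℂ) = f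
  funext S
  rw [Matrix.add_mulVec, Pi.add_apply, ← Matrix.mulVec_mulVec, ← Matrix.mulVec_mulVec,
    modeMat_mulVec, modeMat_conjTranspose_mulVec]
  simp only [modeMat_mulVec, modeMat_conjTranspose_mulVec]
  by_cases hkl : k = l
  · subst hkl
    by_cases hk : k ∈ S
    · simp only [hk, if_true, Finset.mem_erase, ne_eq, not_true_eq_false, false_and, if_false,
        Finset.insert_erase hk, modeSign_erase _ _ _ hk, lt_irrefl, ← mul_assoc,
        modeSign_mul_self, Matrix.one_mulVec]
      ring
    · simp only [hk, if_true, if_false, Finset.mem_insert_self, Finset.erase_insert hk,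
        modeSign_insert _ _ _ hk, lt_irrefl, ← mul_assoc, modeSign_mul_self, Matrix.one_mulVec]
      ring
  · simp only [hkl, if_false, Finset.mem_insert, Finset.mem_erase, Ne.symm hkl, false_or, ne_eq,
      not_false_eq_true, true_and, Matrix.zero_mulVec, Pi.zero_apply]
    by_cases hk : k ∈ S <;> by_cases hl : l ∈ S <;> simp only [hk, hl, if_true, if_false, mul_zero,
      add_zero]
    rw [modeSign_erase _ _ _ hl, modeSign_insert _ _ _ hk, Finset.erase_insert_of_ne hkl]
    rcases lt_or_gt_of_ne hkl with h | h
    · simp only [h, h.not_gt, if_true, if_false]; ring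
    · simp only [h, h.not_gt, if_true, if_false]; ring

theorem createMat_anticomm (x y : X → ℂ) :
    createMat x * createMat y = -(createMat y * createMat x) := by
  simp only [createMat_eq_sum, Finset.sum_mul, Finset.mul_sum, Matrix.smul_mul, Matrix.mul_smul]
  rw [Finset.sum_comm, ← Finset.sum_neg_distrib]
  refine Finset.sum_congr rfl fun l _ => ?_
  rw [← Finset.sum_neg_distrib]
  refine Finset.sum_congr rfl fun k _ => ?_
  rw [modeMat_anticomm, smul_neg, smul_neg, smul_comm]

theorem createMat_mul_self (x : X → ℂ) : createMat x * createMat x = 0 := by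
  have h := createMat_anticomm x x
  rw [eq_neg_iff_add_eq_zero, ← two_smul ℂ] at h
  exact (smul_eq_zero.mp h).resolve_left two_ne_zero

theorem annihilateMat_eq_sum (y : X → ℂ) : annihilateMat y = ∑ k, star (y k) • (modeMat k)ᴴ := by
  rw [annihilateMat, createMat_eq_sum, Matrix.conjTranspose_sum]
  simp only [Matrix.conjTranspose_smul]

theorem annihilateMat_createMat (y x : X → ℂ) :
    annihilateMat y * createMat x = (star y ⬝ᵥ x) • 1 - createMat x * annihilateMat y := by
  rw [eq_sub_iff_add_eq, annihilateMat_eq_sum, createMat_eq_sum]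
  simp only [Finset.sum_mul, Finset.mul_sum, Matrix.smul_mul, Matrix.mul_smul]
  rw [Finset.sum_comm (γ := X), ← Finset.sum_add_distrib, dotProduct, Finset.sum_smul]
  refine Finset.sum_congr rfl fun k _ => ?_
  have h : ∀ l, x l • star (y k) • ((modeMat k)ᴴ * modeMat l) +
      star (y k) • x l • (modeMat l * (modeMat k)ᴴ) = if k = l then (star y k * x k) •
        (1 : Matrix (Finset X) (Finset X) ℂ) else 0 := fun l => by
    rw [smul_comm, ← smul_add, ← smul_add, modeMat_conjTranspose_anticomm]
    split_ifs with hkl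
    · subst hkl; rw [smul_smul]; rfl
    · simp
  rw [← Finset.sum_add_distrib]
  rw [Finset.sum_congr rfl fun l _ => h l]
  simp

/-- The vacuum vector. -/
def vacuum : Finset X → ℂ := Pi.single ∅ 1

theorem annihilateMat_vacuum (y : X → ℂ) : annihilateMat y *ᵥ vacuum = 0 := by
  funext S
  rw [annihilateMat_eq_sum, Matrix.sum_mulVec, Finset.sum_apply]
  refine Finset.sum_eq_zero fun k _ => ?_
  rw [Matrix.smul_mulVec, Pi.smul_apply, modeMat_conjTranspose_mulVec]
  split_ifs <;> simp [vacuum]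

theorem createMat_single (k : X) : createMat (Pi.single k (1 : ℂ)) = modeMat k := by
  rw [createMat_eq_sum, Finset.sum_eq_single k]
  · simp
  · intro l _ hl; simp [hl]
  · simp

theorem modeMat_mulVec_single (k : X) (T : Finset X) :
    modeMat k *ᵥ Pi.single T (1 : ℂ) =
      if k ∈ T then 0 else modeSign k T • Pi.single (insert k T) (1 : ℂ) := by
  funext S
  rw [modeMat_mulVec]
  by_cases hk : k ∈ T
  · simp only [hk, if_true, Pi.zero_apply]
    split_ifs with h
    · rw [Pi.single_eq_of_ne, mul_zero]
      rintro rfl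
      simp at hk
    · rfl
  · simp only [hk, if_false, Pi.smul_apply, smul_eq_mul]
    by_cases hS : S = insert k T
    · subst hS
      simp [hk, modeSign_insert]
    · rw [Pi.single_eq_of_ne hS, mul_zero]
      split_ifs with h
      · rw [Pi.single_eq_of_ne, mul_zero]
        rintro rfl
        exact hS (Finset.insert_erase h).symm
      · rfl

/-- The ordered product of creation operators maps the vacuum to a basis vector. -/
theorem prod_modeMat_vacuum (l : List X) (hl : l.SortedLT) :
    (l.map modeMat).prod *ᵥ vacuum = Pi.single l.toFinset (1 : ℂ) := by
  induction l with
  | nil => rw [List.map_nil, List.prod_nil, Matrix.one_mulVec]; rfl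
  | cons k l ih =>
    have hl' := List.pairwise_cons.mp hl.pairwise
    rw [List.map_cons, List.prod_cons, ← Matrix.mulVec_mulVec, ih hl'.2.sortedLT,
      modeMat_mulVec_single, if_neg, List.toFinset_cons]
    · have : l.toFinset.filter (· < k) = ∅ := by
        ext j
        simp only [Finset.mem_filter, List.mem_toFinset, Finset.notMem_empty, iff_false, not_and,
          not_lt]
        exact fun hj => (hl'.1 j hj).le
      rw [modeSign, this]
      simp
    · intro h
      exact lt_irrefl _ (hl'.1 k (List.mem_toFinset.mp h))

theorem prod_modeMat_sort_vacuum (T : Finset X) :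
    ((T.sort (· ≤ ·)).map modeMat).prod *ᵥ vacuum = Pi.single T (1 : ℂ) := by
  rw [prod_modeMat_vacuum _ (Finset.sortedLT_sort T), Finset.sort_toFinset]

/-- `M` is the second quantization `Γ(A) = ⨁_k ⋀^k A`: it fixes the vacuum and intertwines
`c*(x)` with `c*(A x)`. -/
structure IsSecondQuant (A : Matrix X X ℂ) (M : Matrix (Finset X) (Finset X) ℂ) : Prop where
  vac : M *ᵥ vacuum = vacuum
  intertwine : ∀ x, M * createMat x = createMat (A *ᵥ x) * M

/-- Sorted products of creators already reach every basis vector from the vacuum. Arbitrary lists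
are allowed in the hypothesis so that it can be proved by induction on the list. -/
theorem matrix_ext_of_list {M N : Matrix (Finset X) (Finset X) ℂ}
    (h : ∀ l : List X, M *ᵥ ((l.map modeMat).prod *ᵥ vacuum) =
      N *ᵥ ((l.map modeMat).prod *ᵥ vacuum)) : M = N := by
  refine Matrix.ext_of_mulVec_single fun T => ?_
  rw [← prod_modeMat_sort_vacuum, h]

namespace IsSecondQuant

/-- The two defining properties determine the matrix on all vectors created from the vacuum. Later
identities between Fock space matrices are obtained by checking that both sides second-quantize the
same one-particle matrix. -/
theorem unique {A : Matrix X X ℂ} {M N : Matrix (Finset X) (Finset X) ℂ}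
    (hM : IsSecondQuant A M) (hN : IsSecondQuant A N) : M = N := by
  refine matrix_ext_of_list fun l => ?_
  induction l with
  | nil => simp [hM.vac, hN.vac]
  | cons k l ih =>
    rw [List.map_cons, List.prod_cons, ← Matrix.mulVec_mulVec, ← createMat_single,
      Matrix.mulVec_mulVec _ M, Matrix.mulVec_mulVec _ N, hM.intertwine, hN.intertwine,
      ← Matrix.mulVec_mulVec, ← Matrix.mulVec_mulVec, ih]

theorem mul {A B : Matrix X X ℂ} {M N : Matrix (Finset X) (Finset X) ℂ}
    (hM : IsSecondQuant A M) (hN : IsSecondQuant B N) : IsSecondQuant (A * B) (M * N) where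
  vac := by rw [← Matrix.mulVec_mulVec, hN.vac, hM.vac]
  intertwine x := by
    rw [Matrix.mul_assoc, hN.intertwine, ← Matrix.mul_assoc, hM.intertwine, Matrix.mul_assoc,
      Matrix.mulVec_mulVec]

theorem one : IsSecondQuant (1 : Matrix X X ℂ) 1 := ⟨by simp, by simp⟩

/-- On the vacuum both sides vanish. Pushing the annihilator past one creator produces the scalars
⟨y, Ax⟩ and ⟨Aᴴy, x⟩, which agree, and a remainder covered by the induction hypothesis. -/
theorem annihilateMat_mul {A : Matrix X X ℂ} {M : Matrix (Finset X) (Finset X) ℂ}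
    (hM : IsSecondQuant A M) (y : X → ℂ) :
    annihilateMat y * M = M * annihilateMat (Aᴴ *ᵥ y) := by
  refine matrix_ext_of_list fun l => ?_
  induction l with
  | nil =>
    simp only [List.map_nil, List.prod_nil, Matrix.one_mulVec]
    rw [← Matrix.mulVec_mulVec, ← Matrix.mulVec_mulVec, hM.vac, annihilateMat_vacuum,
      annihilateMat_vacuum, Matrix.mulVec_zero]
  | cons k l ih =>
    rw [List.map_cons, List.prod_cons, ← Matrix.mulVec_mulVec _ (modeMat k),
      ← createMat_single]
    generalize (l.map modeMat).prod *ᵥ vacuum = v at ih ⊢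
    generalize (Pi.single k 1 : X → ℂ) = x
    rw [Matrix.mulVec_mulVec, Matrix.mulVec_mulVec, Matrix.mul_assoc,
      hM.intertwine, ← Matrix.mul_assoc, annihilateMat_createMat, Matrix.mul_assoc,
      annihilateMat_createMat, Matrix.sub_mul, Matrix.mul_sub, Matrix.sub_mulVec,
      Matrix.sub_mulVec, Matrix.mul_assoc, ← Matrix.mulVec_mulVec _ (createMat (A *ᵥ x)), ih, Matrix.mulVec_mulVec,
      ← Matrix.mul_assoc M, hM.intertwine, ← Matrix.mul_assoc]
    congr 2
    have : star y ⬝ᵥ A *ᵥ x = star (Aᴴ *ᵥ y) ⬝ᵥ x := by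
      rw [Matrix.star_mulVec, Matrix.conjTranspose_conjTranspose, ← Matrix.dotProduct_mulVec]
    rw [this]
    simp

/-- The intertwining relation is the adjoint of `annihilateMat_mul`. Invariance of the vacuum is the
substantial point: it concerns the vacuum row of M, whereas the hypothesis concerns the vacuum
column. -/
theorem conjTranspose {A : Matrix X X ℂ} {M : Matrix (Finset X) (Finset X) ℂ}
    (hM : IsSecondQuant A M) : IsSecondQuant Aᴴ Mᴴ where
  vac := by
    have h0 : ∀ f : Finset X → ℂ, (M *ᵥ f) ∅ = f ∅ := fun f => by
      -- For nonempty T the image of the basis vector has a creator in front, so its vacuum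
      -- component is zero.
      have h1 : ∀ T, M ∅ T = if T = ∅ then 1 else 0 := fun T => by
        have h2 : M ∅ T = (M *ᵥ Pi.single T 1) ∅ := by simp
        rw [h2, ← prod_modeMat_sort_vacuum]
        rcases hl : T.sort (· ≤ ·) with _ | ⟨k, l⟩
        · have hT : T = ∅ := by rw [← Finset.sort_toFinset T (· ≤ ·), hl]; rfl
          rw [List.map_nil, List.prod_nil, Matrix.one_mulVec, hM.vac, if_pos hT]; simp [vacuum]
        · have hT : T ≠ ∅ := by
            rintro rfl
            simp at hl
          rw [List.map_cons, List.prod_cons, ← Matrix.mulVec_mulVec, ← createMat_single,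
            Matrix.mulVec_mulVec _ M, hM.intertwine, ← Matrix.mulVec_mulVec, createMat_eq_sum,
            Matrix.sum_mulVec, Finset.sum_apply, if_neg hT]
          refine Finset.sum_eq_zero fun j _ => ?_
          rw [Matrix.smul_mulVec, Pi.smul_apply, modeMat_mulVec]
          simp
      simp [Matrix.mulVec, dotProduct, h1]
    funext S
    have := h0 (Pi.single S 1)
    simp only [vacuum, Matrix.mulVec_single_one, Matrix.col_apply] at this ⊢
    rw [Matrix.conjTranspose_apply, this, Pi.single_apply, Pi.single_apply]
    by_cases h : S = ∅ <;> simp [h, eq_comm]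
  intertwine x := by
    have := congrArg Matrix.conjTranspose (hM.annihilateMat_mul x)
    simpa [annihilateMat, Matrix.conjTranspose_mul] using this

/-- Creating the mode k multiplies the product over the occupied set by d k. -/
theorem diagonal (d : X → ℂ) : IsSecondQuant (Matrix.diagonal d)
    (Matrix.diagonal fun S : Finset X => ∏ k ∈ S, d k) where
  vac := by
    funext S
    rw [Matrix.mulVec_diagonal, vacuum, Pi.single_apply]
    split_ifs with h <;> simp [h]
  intertwine x := by
    refine Matrix.ext_of_mulVec_single fun T => ?_
    generalize (Pi.single T (1 : ℂ) : Finset X → ℂ) = f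
    funext S
    rw [← Matrix.mulVec_mulVec, ← Matrix.mulVec_mulVec, Matrix.mulVec_diagonal, createMat_eq_sum,
      createMat_eq_sum, Matrix.sum_mulVec, Matrix.sum_mulVec, Finset.sum_apply, Finset.sum_apply,
      Finset.mul_sum]
    refine Finset.sum_congr rfl fun k _ => ?_
    rw [Matrix.smul_mulVec, Matrix.smul_mulVec, Pi.smul_apply, Pi.smul_apply, modeMat_mulVec,
      modeMat_mulVec, Matrix.mulVec_diagonal, Matrix.mulVec_diagonal]
    split_ifs with h
    · rw [← Finset.mul_prod_erase _ _ h]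
      simp only [smul_eq_mul]; ring
    · simp

end IsSecondQuant

section Existence

variable {R : Type*} [Ring R]

-- On its way to its sorted position a k passes exactly the factors below k, each contributing a
-- sign. An arbitrary anticommuting family is needed, since the result is applied to the operators
-- c*(A e_k).
omit [Fintype X] in
theorem mul_prod_map_of_anticomm (a : X → R) (h : ∀ k l, a k * a l = -(a l * a k)) (k : X)
    (l : List X) (hl : l.SortedLT) (hk : k ∉ l) :
    a k * (l.map a).prod =
      (-1) ^ (l.toFinset.filter (· < k)).card * ((l.orderedInsert (· ≤ ·) k).map a).prod := by
  induction l with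
  | nil => simp
  | cons j l ih =>
    have hl' := List.pairwise_cons.mp hl.pairwise
    have hj : j ∉ l := fun hj => lt_irrefl _ (hl'.1 j hj)
    simp only [List.mem_cons, not_or] at hk
    rw [List.orderedInsert_cons]
    split_ifs with hkj
    · have : (j :: l).toFinset.filter (· < k) = ∅ := by
        ext i
        simp only [Finset.mem_filter, List.mem_toFinset, List.mem_cons, Finset.notMem_empty,
          iff_false, not_and, not_lt]
        rintro (rfl | hi)
        · exact hkj
        · exact hkj.trans (hl'.1 i hi).le
      rw [this]
      simp
    · have hjk : j < k := not_le.mp hkj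
      rw [List.map_cons, List.prod_cons, ← mul_assoc, h k j, neg_mul, mul_assoc,
        ih hl'.2.sortedLT hk.2, List.map_cons, List.prod_cons, List.toFinset_cons,
        Finset.filter_insert, if_pos hjk, Finset.card_insert_of_notMem (by simp [hj]), pow_succ]
      have hc : ∀ n : ℕ, a j * ((-1) ^ n * ((l.orderedInsert (· ≤ ·) k).map a).prod) =
          (-1) ^ n * (a j * ((l.orderedInsert (· ≤ ·) k).map a).prod) := fun n => by
        rw [← mul_assoc, ← mul_assoc]
        congr 1
        exact ((Commute.neg_one_right (a j)).pow_right n).eq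
      rw [hc]
      simp

-- The squares are assumed to vanish separately because in a general ring anticommutation only gives
-- 2a² = 0.
omit [LinearOrder X] [Fintype X] in
theorem mul_prod_map_eq_zero (a : X → R) (h : ∀ k l, a k * a l = -(a l * a k))
    (h0 : ∀ k, a k * a k = 0) (k : X) (l : List X) (hk : k ∈ l) : a k * (l.map a).prod = 0 := by
  induction l with
  | nil => simp at hk
  | cons j l ih =>
    rw [List.map_cons, List.prod_cons, ← mul_assoc]
    rcases List.mem_cons.mp hk with rfl | hk
    · rw [h0, zero_mul]
    · rw [h, neg_mul, mul_assoc, ih hk, mul_zero, neg_zero]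

omit [Fintype X] in
theorem sort_insert_eq_orderedInsert (k : X) (T : Finset X) (hk : k ∉ T) :
    (insert k T).sort (· ≤ ·) = (T.sort (· ≤ ·)).orderedInsert (· ≤ ·) k := by
  refine List.Perm.eq_of_pairwise (le := (· ≤ ·)) (fun a b _ _ h1 h2 => le_antisymm h1 h2)
    ((insert k T).pairwise_sort (· ≤ ·)) ?_ ?_
  · exact (T.pairwise_sort (· ≤ ·)).orderedInsert _ _
  · refine (List.perm_ext_iff_of_nodup ((insert k T).sort_nodup _) ?_).mpr ?_
    · refine (List.perm_orderedInsert _ _ _).nodup_iff.mpr ?_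
      simp [hk]
    · simp

theorem exists_isSecondQuant (A : Matrix X X ℂ) : ∃ M, IsSecondQuant A M := by
  let a : X → Matrix (Finset X) (Finset X) ℂ := fun t => createMat (A *ᵥ Pi.single t 1)
  have h : ∀ k l, a k * a l = -(a l * a k) := fun k l => createMat_anticomm _ _
  have h0 : ∀ k, a k * a k = 0 := fun k => createMat_mul_self _
  -- Column T is the wedge product of the vectors A e_t, t ∈ T, written as creators acting on the
  -- vacuum.
  let M : Matrix (Finset X) (Finset X) ℂ :=
    Matrix.of fun S T => (((T.sort (· ≤ ·)).map a).prod *ᵥ vacuum) S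
  have hM : ∀ T, M *ᵥ Pi.single T 1 = ((T.sort (· ≤ ·)).map a).prod *ᵥ vacuum := fun T => by
    funext S; simp [M]
  have hmode : ∀ k, M * modeMat k = a k * M := fun k => by
    refine Matrix.ext_of_mulVec_single fun T => ?_
    rw [← Matrix.mulVec_mulVec, ← Matrix.mulVec_mulVec, modeMat_mulVec_single, hM]
    split_ifs with hk
    · rw [Matrix.mulVec_mulVec, mul_prod_map_eq_zero a h h0 k _ (by simpa using hk)]
      simp
    · rw [Matrix.mulVec_smul, hM, Matrix.mulVec_mulVec,
        mul_prod_map_of_anticomm a h k _ (Finset.sortedLT_sort T) (by simpa using hk),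
        Finset.sort_toFinset, sort_insert_eq_orderedInsert k T hk, modeSign]
      rcases Nat.even_or_odd (T.filter (· < k)).card with he | he
      · simp only [he.neg_one_pow, one_smul, one_mul]
      · simp only [he.neg_one_pow, neg_smul, one_smul, neg_mul, one_mul, Matrix.neg_mulVec]
  refine ⟨M, ?_, fun x => ?_⟩
  · rw [vacuum, hM, Finset.sort_empty, List.map_nil, List.prod_nil, Matrix.one_mulVec]; rfl
  · have hx : createMat (A *ᵥ x) = ∑ k, x k • a k := by
      have h1 : A *ᵥ x = ∑ k, x k • (A *ᵥ Pi.single k 1) := by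
        funext i; simp [Matrix.mulVec, dotProduct, mul_comm]
      rw [h1]
      simp only [a, createMat_eq_sum, Finset.sum_apply, Finset.sum_smul, Finset.smul_sum,
        Pi.smul_apply, smul_eq_mul, smul_smul]
      rw [Finset.sum_comm]
    rw [hx, createMat_eq_sum, Finset.mul_sum, Finset.sum_mul]
    refine Finset.sum_congr rfl fun k _ => ?_
    rw [Matrix.mul_smul, Matrix.smul_mul, hmode]

end Existence

end FiniteFock

/-! ### Quasi-free densities as product measures on occupation numbers. -/

section Density

variable {X : Type*} [LinearOrder X] [Fintype X]

theorem prod_modeMat_apply_cons (k : X) (l : List X) (V W : Finset X) :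
    ((k :: l).map modeMat).prod V W =
      if k ∈ V then modeSign k V * (l.map modeMat).prod (V.erase k) W else 0 := by
  have h := modeMat_mulVec k ((l.map modeMat).prod *ᵥ Pi.single W 1) V
  rw [Matrix.mulVec_mulVec, ← List.prod_cons, ← List.map_cons] at h
  simpa using h

theorem prod_modeMat_apply_ne_zero (l : List X) : ∀ {V W : Finset X},
    (l.map modeMat).prod V W ≠ 0 → V = l.toFinset ∪ W ∧ Disjoint l.toFinset W := by
  induction l with
  | nil =>
    intro V W h
    have : V = W := by
      by_contra hVW
      simp [hVW] at h
    simp [this]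
  | cons k l ih =>
    intro V W h
    rw [prod_modeMat_apply_cons] at h
    split_ifs at h with hk
    · obtain ⟨h1, h2⟩ := ih (right_ne_zero_of_mul h)
      refine ⟨?_, ?_⟩
      · rw [List.toFinset_cons, Finset.insert_union, ← h1, Finset.insert_erase hk]
      · rw [List.toFinset_cons, Finset.disjoint_insert_left]
        refine ⟨fun hW => ?_, h2⟩
        have : k ∈ V.erase k := by rw [h1]; exact Finset.mem_union_right _ hW
        simp at this
    · exact absurd rfl h

theorem norm_prod_modeMat_apply (l : List X) (hl : l.Nodup) (W : Finset X)
    (hW : Disjoint l.toFinset W) : ‖(l.map modeMat).prod (l.toFinset ∪ W) W‖ = 1 := by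
  induction l with
  | nil => simp
  | cons k l ih =>
    rw [List.nodup_cons] at hl
    rw [List.toFinset_cons, Finset.disjoint_insert_left] at hW
    rw [prod_modeMat_apply_cons, List.toFinset_cons, Finset.insert_union,
      if_pos (Finset.mem_insert_self _ _), norm_mul, norm_modeSign, one_mul, Finset.erase_insert,
      ih hl.2 hW.2]
    simp [hl.1, hW.1]

/-- The ordered product of the creation operators of the modes in `S`. -/
def createSet (S : Finset X) : Matrix (Finset X) (Finset X) ℂ :=
  ((S.sort (· ≤ ·)).map modeMat).prod

theorem createSet_apply_ne_zero {S V W : Finset X} (h : createSet S V W ≠ 0) :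
    V = S ∪ W ∧ Disjoint S W := by
  simpa using prod_modeMat_apply_ne_zero _ h

theorem norm_createSet_apply {S W : Finset X} (h : Disjoint S W) :
    ‖createSet S (S ∪ W) W‖ = 1 := by
  simpa [createSet] using norm_prod_modeMat_apply _ (S.sort_nodup (· ≤ ·)) W (by simpa using h)

theorem createSet_mulVec_vacuum (S : Finset X) : createSet S *ᵥ vacuum = Pi.single S 1 :=
  prod_modeMat_sort_vacuum S

/-- Normal ordered products of creation and annihilation operators separate matrices. -/
theorem eq_zero_of_trace_createSet (D : Matrix (Finset X) (Finset X) ℂ)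
    (hD : ∀ S T, (D * (createSet S * (createSet T)ᴴ)).trace = 0) : D = 0 := by
  -- Induction on the number of modes missing from S. The trace against c*_S c_T is the entry D T S
  -- plus entries D V (S ∪ W) with W nonempty and disjoint from S, and those vanish by induction.
  have key : ∀ m : ℕ, ∀ S T : Finset X, Fintype.card X - S.card = m → D T S = 0 := by
    intro m
    induction m using Nat.strong_induction_on with
    | _ m ih =>
      intro S T hm
      have h1 := hD S T
      rw [← Matrix.mul_assoc, Matrix.trace_mul_comm, Matrix.trace,
        Finset.sum_eq_single (∅ : Finset X)] at h1
      · have h2 : ∀ M : Matrix (Finset X) (Finset X) ℂ, M.diag ∅ =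
            vacuum ⬝ᵥ (M *ᵥ vacuum) := fun M => by simp [vacuum]
        have h3 : vacuum ᵥ* (createSet T)ᴴ = Pi.single T (1 : ℂ) := by
          have := congrArg star (createSet_mulVec_vacuum T)
          rw [Matrix.star_mulVec] at this
          simpa [vacuum] using this
        rw [h2, ← Matrix.mulVec_mulVec, Matrix.dotProduct_mulVec, h3, ← Matrix.mulVec_mulVec,
          createSet_mulVec_vacuum] at h1
        simpa using h1
      · intro W _ hW
        rw [Matrix.diag_apply, Matrix.mul_apply]
        refine Finset.sum_eq_zero fun V _ => ?_
        rw [Matrix.mul_apply, Finset.sum_eq_zero, mul_zero]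
        intro U _
        by_cases hU : createSet S U W = 0
        · rw [hU, mul_zero]
        · obtain ⟨rfl, hdisj⟩ := createSet_apply_ne_zero hU
          have hc := Finset.card_union_of_disjoint hdisj
          have hW' := Finset.card_pos.mpr (Finset.nonempty_iff_ne_empty.mpr hW)
          have hle := Finset.card_le_univ (S ∪ W)
          rw [ih _ _ (S ∪ W) V rfl, zero_mul]
          omega
      · simp
  ext T S
  exact key _ S T rfl

/-- The probability that exactly the modes in `S` are occupied, when the modes are independent
with occupation probabilities `d`. -/
def occWeight (d : X → ℝ) (S : Finset X) : ℝ := (∏ k ∈ S, d k) * ∏ k ∈ Sᶜ, (1 - d k)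

/-- Independence of the modes: expand ∏ (d_k + e_k), where e_k is 0 on S and 1 - d_k off S. The
factors off S are 1, and the terms not containing S drop out. -/
theorem sum_occWeight (d : X → ℝ) (S : Finset X) :
    ∑ V, (if S ⊆ V then occWeight d V else 0) = ∏ k ∈ S, d k := by
  have h := Finset.prod_add d (fun k => if k ∈ S then 0 else 1 - d k) (Finset.univ : Finset X)
  have h1 : ∏ k, (d k + if k ∈ S then 0 else 1 - d k) = ∏ k ∈ S, d k := by
    rw [← Finset.prod_subset (Finset.subset_univ S)]
    · exact Finset.prod_congr rfl fun k hk => by simp [hk]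
    · intro k _ hk; simp [hk]
  rw [← h1, h, Finset.powerset_univ]
  refine Finset.sum_congr rfl fun V _ => ?_
  rw [← Finset.compl_eq_univ_sdiff]
  split_ifs with hV
  · rw [occWeight]
    congr 1
    refine Finset.prod_congr rfl fun k hk => ?_
    rw [if_neg fun hS => (Finset.mem_compl.mp hk) (hV hS)]
  · obtain ⟨k, hkS, hkV⟩ := Finset.not_subset.mp hV
    rw [Finset.prod_eq_zero (i := k) (s := Vᶜ) (Finset.mem_compl.mpr hkV) (by simp [hkS]),
      mul_zero]

/-- The diagonal of c*_S c_T is zero for S ≠ T; for S = T it is the indicator of the configurations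
containing S, because the squared signs are 1. -/
theorem trace_occWeight_createSet (d : X → ℝ) (S T : Finset X) :
    (Matrix.diagonal (fun V => (occWeight d V : ℂ)) * (createSet S * (createSet T)ᴴ)).trace =
      if S = T then ((∏ k ∈ S, d k : ℝ) : ℂ) else 0 := by
  have h : ∀ V, (createSet S * (createSet T)ᴴ) V V = if S = T ∧ S ⊆ V then 1 else 0 := by
    intro V
    rw [Matrix.mul_apply]
    split_ifs with hST
    · obtain ⟨rfl, hV⟩ := hST
      rw [Finset.sum_eq_single (V \ S)]
      · have := norm_createSet_apply (S := S) (W := V \ S) Finset.disjoint_sdiff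
        rw [Finset.union_sdiff_of_subset hV] at this
        rw [Matrix.conjTranspose_apply, Complex.star_def, Complex.mul_conj,
          Complex.normSq_eq_norm_sq, this]
        simp
      · intro W _ hW
        refine mul_eq_zero_of_left ?_ _
        by_contra hne
        obtain ⟨rfl, hd⟩ := createSet_apply_ne_zero hne
        exact hW (Finset.union_sdiff_cancel_left hd).symm
      · simp
    · refine Finset.sum_eq_zero fun W _ => ?_
      by_contra hne
      obtain ⟨hV, hd⟩ := createSet_apply_ne_zero (left_ne_zero_of_mul hne)
      obtain ⟨hV', hd'⟩ := createSet_apply_ne_zero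
        (star_ne_zero.mp (right_ne_zero_of_mul hne))
      refine hST ⟨?_, hV ▸ Finset.subset_union_left⟩
      rw [← Finset.union_sdiff_cancel_right hd, ← Finset.union_sdiff_cancel_right hd', ← hV, ← hV']
  rw [Matrix.trace]
  simp only [Matrix.diag_apply, Matrix.diagonal_mul, h]
  split_ifs with hST
  · rw [← sum_occWeight, Complex.ofReal_sum]
    refine Finset.sum_congr rfl fun V _ => ?_
    simp only [hST, true_and]
    split_ifs <;> simp
  · simp [hST]

omit [Fintype X] in
theorem ofFn_orderEmbOfFin {β : Type*} (S : Finset X) {n : ℕ} (h : S.card = n) (f : X → β) :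
    (List.ofFn fun i => f (S.orderEmbOfFin h i)) = (S.sort (· ≤ ·)).map f := by
  refine List.ext_getElem (by simp [h]) fun i _ _ => ?_
  simp [Finset.orderEmbOfFin_apply]

/-- In the eigenmodes U e_k the two-point function is diagonal. The determinant is then a product of
eigenvalues if S = T and has a zero row if S ≠ T have equal size; for unequal sizes gauge invariance
gives zero. -/
theorem trace_occupation_eq {U Q : Matrix X X ℂ} {d : X → ℝ}
    (hU : Uᴴ * U = 1) (hQ : Q = U * Matrix.diagonal (fun k => (d k : ℂ)) * Uᴴ)
    {ρ : Matrix (Finset X) (Finset X) ℂ} (hρ : IsQuasiFreeDensity Q ρ) (S T : Finset X) :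
    (ρ * (((S.sort (· ≤ ·)).map fun k => createMat (U *ᵥ Pi.single k 1)).prod *
      (((T.sort (· ≤ ·)).map fun k => createMat (U *ᵥ Pi.single k 1)).prod)ᴴ)).trace =
      if S = T then ((∏ k ∈ S, d k : ℝ) : ℂ) else 0 := by
  have hct : ∀ {n : ℕ} (h : T.card = n),
      (((T.sort (· ≤ ·)).map fun k => createMat (U *ᵥ Pi.single k 1)).prod)ᴴ =
      (List.ofFn fun i => annihilateMat (U *ᵥ Pi.single (T.orderEmbOfFin h i) 1)).reverse.prod := by
    intro n h
    rw [Matrix.conjTranspose_list_prod, List.map_map, ofFn_orderEmbOfFin T h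
      (fun k => annihilateMat (U *ᵥ Pi.single k 1))]
    rfl
  have hentry : ∀ k l : X, star (U *ᵥ Pi.single k (1 : ℂ)) ⬝ᵥ (Q *ᵥ (U *ᵥ Pi.single l 1)) =
      if k = l then (d l : ℂ) else 0 := by
    intro k l
    rw [Matrix.star_mulVec, ← Matrix.dotProduct_mulVec, Matrix.mulVec_mulVec, Matrix.mulVec_mulVec,
      hQ, Matrix.mul_assoc, Matrix.mul_assoc, hU, Matrix.mul_one, ← Matrix.mul_assoc, hU,
      Matrix.one_mul]
    by_cases h : k = l
    · subst h; simp
    · simp [h]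
  by_cases hc : S.card = T.card
  · rw [hct hc.symm, ← ofFn_orderEmbOfFin S rfl (fun k => createMat (U *ᵥ Pi.single k 1)),
      hρ.correlation]
    simp only [hentry]
    split_ifs with hST
    · subst hST
      have : (Matrix.of fun i j : Fin S.card => if S.orderEmbOfFin rfl i = S.orderEmbOfFin rfl j
          then (d (S.orderEmbOfFin rfl j) : ℂ) else 0) =
          Matrix.diagonal fun i => (d (S.orderEmbOfFin rfl i) : ℂ) := by
        ext i j
        by_cases h : i = j
        · subst h; simp
        · simp [h]
      rw [this, Matrix.det_diagonal, Complex.ofReal_prod]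
      conv_rhs => rw [← Finset.map_orderEmbOfFin_univ S rfl]
      rw [Finset.prod_map]
      rfl
    · have : ¬ T ⊆ S := fun h => hST (Finset.eq_of_subset_of_card_le h hc.le).symm
      obtain ⟨t, htT, htS⟩ := Finset.not_subset.mp this
      obtain ⟨i, hi⟩ : ∃ i, T.orderEmbOfFin hc.symm i = t := by
        have := Finset.range_orderEmbOfFin T hc.symm
        have ht : t ∈ Set.range (T.orderEmbOfFin hc.symm) := by rw [this]; exact htT
        exact ht
      refine Matrix.det_eq_zero_of_row_eq_zero i fun j => ?_
      rw [Matrix.of_apply, hi, if_neg]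
      rintro rfl
      exact htS (Finset.orderEmbOfFin_mem _ _ _)
  · rw [hct rfl, ← ofFn_orderEmbOfFin S rfl (fun k => createMat (U *ᵥ Pi.single k 1)),
      hρ.correlation_ne _ _ _ _ hc, if_neg (fun h => hc (by rw [h]))]

theorem IsSecondQuant.mul_list_prod {A : Matrix X X ℂ} {G : Matrix (Finset X) (Finset X) ℂ}
    (hG : IsSecondQuant A G) (l : List X) : G * (l.map modeMat).prod =
      (l.map fun k => createMat (A *ᵥ Pi.single k 1)).prod * G := by
  induction l with
  | nil => simp
  | cons k l ih =>
    simp only [List.map_cons, List.prod_cons]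
    rw [← Matrix.mul_assoc, ← createMat_single, hG.intertwine, Matrix.mul_assoc, ih,
      ← Matrix.mul_assoc]

theorem IsSecondQuant.unitary {U : Matrix X X ℂ} (hU : Uᴴ * U = 1)
    {G : Matrix (Finset X) (Finset X) ℂ} (hG : IsSecondQuant U G) : Gᴴ * G = 1 := by
  have := hG.conjTranspose.mul hG
  rw [hU] at this
  exact this.unique IsSecondQuant.one

/-- The density of a quasi-free state is diagonal in the occupation basis of the eigenvectors of
its symbol. -/
theorem IsQuasiFreeDensity.eq_conj_diagonal {U Q : Matrix X X ℂ} {d : X → ℝ}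
    (hU : Uᴴ * U = 1) (hQ : Q = U * Matrix.diagonal (fun k => (d k : ℂ)) * Uᴴ)
    {ρ G : Matrix (Finset X) (Finset X) ℂ} (hρ : IsQuasiFreeDensity Q ρ)
    (hG : IsSecondQuant U G) :
    ρ = G * Matrix.diagonal (fun S => (occWeight d S : ℂ)) * Gᴴ := by
  have hGG := hG.unitary hU
  have hGG' : G * Gᴴ = 1 := mul_eq_one_comm.mp hGG
  -- After rotation to the eigenmodes, ρ and the product measure have equal normal ordered moments,
  -- and these moments separate matrices.
  have h : Gᴴ * ρ * G - Matrix.diagonal (fun S => (occWeight d S : ℂ)) = 0 := by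
    refine eq_zero_of_trace_createSet _ fun S T => ?_
    rw [Matrix.sub_mul, Matrix.trace_sub, trace_occWeight_createSet,
      ← trace_occupation_eq hU hQ hρ, sub_eq_zero]
    have h1 : ∀ S, G * createSet S = ((S.sort (· ≤ ·)).map fun k =>
        createMat (U *ᵥ Pi.single k 1)).prod * G := fun S => hG.mul_list_prod _
    have h2 : ∀ S, ((S.sort (· ≤ ·)).map fun k => createMat (U *ᵥ Pi.single k 1)).prod =
        G * createSet S * Gᴴ := fun S => by
      rw [h1, Matrix.mul_assoc, hGG', Matrix.mul_one]
    rw [h2, h2]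
    simp only [Matrix.conjTranspose_mul, Matrix.conjTranspose_conjTranspose]
    have h3 : G * createSet S * Gᴴ * (G * ((createSet T)ᴴ * Gᴴ)) =
        G * (createSet S * (createSet T)ᴴ) * Gᴴ := by
      rw [Matrix.mul_assoc (G * createSet S), ← Matrix.mul_assoc Gᴴ, hGG, Matrix.one_mul]
      simp only [Matrix.mul_assoc]
    rw [h3, Matrix.mul_assoc, Matrix.mul_assoc, Matrix.trace_mul_comm, ← Matrix.mul_assoc ρ,
      ← Matrix.mul_assoc]
    simp only [Matrix.mul_assoc]
  rw [sub_eq_zero] at h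
  rw [← h, Matrix.mul_assoc, Matrix.mul_assoc, Matrix.mul_assoc, hGG', Matrix.mul_one,
    ← Matrix.mul_assoc, hGG', Matrix.one_mul]

end Density

/-! ### Functional calculus in an arbitrary unitary diagonalization. -/

section FunctionalCalculus

variable {m : Type*} [Fintype m] [DecidableEq m]

/-- The Hermitian matrix with eigenvalues `d` and eigenvectors the columns of `U`. -/
def conjDiag (U : Matrix m m ℂ) (d : m → ℝ) : Matrix m m ℂ :=
  U * Matrix.diagonal (fun k => (d k : ℂ)) * Uᴴ

theorem conjDiag_isHermitian (U : Matrix m m ℂ) (d : m → ℝ) : (conjDiag U d).IsHermitian := by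
  rw [Matrix.IsHermitian, conjDiag, Matrix.conjTranspose_mul, Matrix.conjTranspose_mul,
    Matrix.conjTranspose_conjTranspose, Matrix.diagonal_conjTranspose, Matrix.mul_assoc]
  congr 3
  ext i
  simp

theorem conjDiag_mul {U : Matrix m m ℂ} (hU : Uᴴ * U = 1) (d e : m → ℝ) :
    conjDiag U d * conjDiag U e = conjDiag U (d * e) := by
  have : conjDiag U d * conjDiag U e =
      U * (Matrix.diagonal (fun k => (d k : ℂ)) * (Uᴴ * U) *
        Matrix.diagonal (fun k => (e k : ℂ))) * Uᴴ := by
    simp only [conjDiag, Matrix.mul_assoc]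
  rw [this, hU, Matrix.mul_one, Matrix.diagonal_mul_diagonal, conjDiag]
  simp

theorem conjDiag_const {U : Matrix m m ℂ} (hU : Uᴴ * U = 1) (x : ℝ) :
    conjDiag U (fun _ => x) = (x : ℂ) • 1 := by
  rw [conjDiag, ← Matrix.smul_one_eq_diagonal, Matrix.mul_smul, Matrix.mul_one, Matrix.smul_mul,
    mul_eq_one_comm.mp hU]

theorem conjDiag_add (U : Matrix m m ℂ) (d e : m → ℝ) :
    conjDiag U (d + e) = conjDiag U d + conjDiag U e := by
  rw [conjDiag, conjDiag, conjDiag, ← Matrix.add_mul, ← Matrix.mul_add, Matrix.diagonal_add]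
  simp

theorem conjDiag_smul (U : Matrix m m ℂ) (x : ℝ) (d : m → ℝ) :
    conjDiag U (x • d) = (x : ℂ) • conjDiag U d := by
  rw [conjDiag, conjDiag, ← Matrix.smul_mul, ← Matrix.mul_smul, ← Matrix.diagonal_smul]
  congr 3
  ext i
  simp

theorem trace_conjDiag {U : Matrix m m ℂ} (hU : Uᴴ * U = 1) (d : m → ℝ) :
    (conjDiag U d).trace = ((∑ k, d k : ℝ) : ℂ) := by
  rw [conjDiag, Matrix.mul_assoc, Matrix.trace_mul_comm, Matrix.mul_assoc, hU, Matrix.mul_one,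
    Matrix.trace_diagonal]
  simp

theorem conjDiag_posDef {U : Matrix m m ℂ} (hU : Uᴴ * U = 1) {d : m → ℝ} (hd : ∀ k, 0 < d k) :
    (conjDiag U d).PosDef := by
  have hinj : Function.Injective U.vecMul := by
    intro x y hxy
    have h := congrArg (fun v => v ᵥ* Uᴴ) hxy
    simpa [Matrix.vecMul_vecMul, mul_eq_one_comm.mp hU] using h
  exact (Matrix.PosDef.diagonal fun k => by exact_mod_cast hd k).mul_mul_conjTranspose_same hinj

theorem exists_conjDiag {A : Matrix m m ℂ} (hA : A.IsHermitian) :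
    ∃ U : Matrix m m ℂ, Uᴴ * U = 1 ∧ A = conjDiag U hA.eigenvalues := by
  refine ⟨hA.eigenvectorUnitary, Unitary.coe_star_mul_self hA.eigenvectorUnitary, ?_⟩
  conv_lhs => rw [hA.spectral_theorem]
  rfl

theorem aeval_conjDiag {U : Matrix m m ℂ} (hU : Uᴴ * U = 1) (d : m → ℝ) (p : Polynomial ℝ) :
    Polynomial.aeval (conjDiag U d) p = conjDiag U (fun k => p.eval (d k)) := by
  induction p using Polynomial.induction_on with
  | C a =>
    simp only [Polynomial.aeval_C, Polynomial.eval_C, conjDiag_const hU]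
    rw [Algebra.algebraMap_eq_smul_one, ← Complex.coe_smul]
  | add p q hp hq =>
    simp only [map_add, hp, hq, Polynomial.eval_add]
    rw [← conjDiag_add]
    rfl
  | monomial n a ih =>
    rw [pow_succ, ← mul_assoc, map_mul, ih, Polynomial.aeval_X, conjDiag_mul hU]
    congr 1
    ext k
    simp

theorem spectrum_conjDiag_subset {U : Matrix m m ℂ} (hU : Uᴴ * U = 1) (d : m → ℝ) :
    spectrum ℝ (conjDiag U d) ⊆ Set.range d := by
  intro x hx
  by_contra hxd
  refine hx ?_
  have h1 : algebraMap ℝ (Matrix m m ℂ) x - conjDiag U d = conjDiag U (fun k => x - d k) := by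
    rw [Algebra.algebraMap_eq_smul_one, ← Complex.coe_smul, ← conjDiag_const hU, sub_eq_iff_eq_add,
      ← conjDiag_add]
    congr 1
    ext k
    simp
  have h2 : conjDiag U (fun k => x - d k) * conjDiag U (fun k => (x - d k)⁻¹) = 1 := by
    have h3 : (fun k => x - d k) * (fun k => (x - d k)⁻¹) = fun _ => 1 := by
      ext k
      exact mul_inv_cancel₀ (sub_ne_zero.mpr fun h => hxd ⟨k, h.symm⟩)
    rw [conjDiag_mul hU, h3, conjDiag_const hU]
    simp
  change IsUnit _
  rw [h1]
  exact IsUnit.of_mul_eq_one _ h2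

/-- On the finitely many values of d the function agrees with an interpolation polynomial, and for
polynomials the formula is algebra. Any diagonalization is admitted, in particular the second
quantized ones on Fock space. -/
theorem cfc_conjDiag {U : Matrix m m ℂ} (hU : Uᴴ * U = 1) (d : m → ℝ) (f : ℝ → ℝ) :
    cfc f (conjDiag U d) = conjDiag U (fun k => f (d k)) := by
  have hA : IsSelfAdjoint (conjDiag U d) := conjDiag_isHermitian U d
  let p := Lagrange.interpolate (Finset.univ.image d) id f
  have hp : ∀ k, p.eval (d k) = f (d k) := fun k =>
    Lagrange.eval_interpolate_at_node f (Function.injective_id.injOn)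
      (Finset.mem_image_of_mem d (Finset.mem_univ k))
  rw [cfc_congr (g := p.eval), cfc_polynomial p _ hA, aeval_conjDiag hU]
  · simp only [hp]
  · intro x hx
    obtain ⟨k, rfl⟩ := spectrum_conjDiag_subset hU d hx
    exact (hp k).symm

end FunctionalCalculus

/-! ### Reduction of the Rényi quantities and the relative entropy to one-particle traces. -/

section QuasiFree

variable {X : Type*} [LinearOrder X] [Fintype X]

/-- `Tr log (1 - Q)`, the logarithm of the weight of the vacuum. -/
def logVacuum (Q : Matrix X X ℂ) : ℝ := (cfc (fun x : ℝ => Real.log (1 - x)) Q).trace.re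

/-- The powers of the odds `x / (1 - x)`. -/
def oddsPow (t x : ℝ) : ℝ := (x / (1 - x)) ^ t

theorem oddsPow_pos {t x : ℝ} (hx : x ∈ Set.Ioo (0 : ℝ) 1) : 0 < oddsPow t x :=
  Real.rpow_pos_of_pos (div_pos hx.1 (sub_pos.mpr hx.2)) _

theorem IsSecondQuant.conjDiag {U : Matrix X X ℂ} {G : Matrix (Finset X) (Finset X) ℂ}
    (hG : IsSecondQuant U G) (d : X → ℝ) :
    IsSecondQuant (conjDiag U d) (conjDiag G fun S => ∏ k ∈ S, d k) := by
  have := (hG.mul (IsSecondQuant.diagonal fun k => (d k : ℂ))).mul hG.conjTranspose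
  simpa [Fermion.conjDiag] using this

/-- Dividing by the weight of the vacuum leaves the product of the odds over the occupied modes,
which is a diagonal entry of a second quantization. -/
theorem occWeight_eq {d : X → ℝ} (hd : ∀ k, d k ∈ Set.Ioo (0 : ℝ) 1) (S : Finset X) :
    occWeight d S = Real.exp (∑ k, Real.log (1 - d k)) * ∏ k ∈ S, d k / (1 - d k) := by
  have h1 : ∀ k, 0 < 1 - d k := fun k => sub_pos.mpr (hd k).2
  rw [Real.exp_sum, occWeight, Finset.prod_congr rfl fun k _ => Real.exp_log (h1 k),
    ← Finset.prod_mul_prod_compl S, Finset.prod_div_distrib]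
  have := Finset.prod_ne_zero_iff.mpr fun k (_ : k ∈ S) => (h1 k).ne'
  field_simp

theorem occWeight_pos {d : X → ℝ} (hd : ∀ k, d k ∈ Set.Ioo (0 : ℝ) 1) (S : Finset X) :
    0 < occWeight d S :=
  mul_pos (Finset.prod_pos fun k _ => (hd k).1)
    (Finset.prod_pos fun k _ => sub_pos.mpr (hd k).2)

/-- Powers act separately on the vacuum weight and on the odds of each mode. All occupation weights
are positive, so the convention for powers on the support plays no role. -/
theorem IsQuasiFreeDensity.suppPow_eq {U : Matrix X X ℂ} {d : X → ℝ}
    (hU : Uᴴ * U = 1) (hd : ∀ k, d k ∈ Set.Ioo (0 : ℝ) 1)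
    {ρ : Matrix (Finset X) (Finset X) ℂ} (hρ : IsQuasiFreeDensity (conjDiag U d) ρ) (t : ℝ) :
    ∃ M, IsSecondQuant (cfc (oddsPow t) (conjDiag U d)) M ∧
      suppPow ρ t = (Real.exp (t * logVacuum (conjDiag U d)) : ℂ) • M := by
  obtain ⟨G, hG⟩ := exists_isSecondQuant U
  refine ⟨_, by rw [cfc_conjDiag hU]; exact hG.conjDiag _, ?_⟩
  have hρ' : ρ = conjDiag G (occWeight d) := hρ.eq_conj_diagonal hU rfl hG
  rw [hρ', suppPow, cfc_conjDiag (hG.unitary hU), ← conjDiag_smul]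
  congr 1
  ext S
  rw [if_neg (occWeight_pos hd S).ne', occWeight_eq hd, Pi.smul_apply, smul_eq_mul,
    Real.mul_rpow (Real.exp_pos _).le (Finset.prod_nonneg fun k _ =>
      div_nonneg (hd k).1.le (sub_pos.mpr (hd k).2).le), ← Real.exp_mul,
    ← Real.finsetProd_rpow _ _ fun k _ => div_nonneg (hd k).1.le (sub_pos.mpr (hd k).2).le,
    logVacuum, cfc_conjDiag hU, trace_conjDiag hU, Complex.ofReal_re, mul_comm t]
  rfl

/-- `log Tr (z Γ(H))^t` for positive definite `H`. -/
theorem IsSecondQuant.log_trace_suppPow {H : Matrix X X ℂ} (hH : H.PosDef)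
    {M : Matrix (Finset X) (Finset X) ℂ} (hM : IsSecondQuant H M) (z t : ℝ) :
    Real.log (suppPow ((Real.exp z : ℂ) • M) t).trace.re =
      t * z + (cfc (fun x : ℝ => Real.log (1 + x ^ t)) H).trace.re := by
  obtain ⟨U, hU, hHU⟩ := exists_conjDiag hH.isHermitian
  have hd : ∀ k, 0 < hH.isHermitian.eigenvalues k := fun k => hH.eigenvalues_pos k
  generalize hH.isHermitian.eigenvalues = d at hHU hd
  subst hHU
  obtain ⟨G, hG⟩ := exists_isSecondQuant U
  have h1 := hM.unique (hG.conjDiag d)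
  rw [h1, ← conjDiag_smul, suppPow, cfc_conjDiag (hG.unitary hU), trace_conjDiag (hG.unitary hU),
    cfc_conjDiag hU, trace_conjDiag hU, Complex.ofReal_re, Complex.ofReal_re]
  have hpos : ∀ k, 0 < 1 + d k ^ t := fun k => by
    have := Real.rpow_pos_of_pos (hd k) t
    linarith
  have h2 : ∀ S : Finset X, (if (Real.exp z • fun S => ∏ k ∈ S, d k) S = 0 then 0 else
      ((Real.exp z • fun S => ∏ k ∈ S, d k) S) ^ t) = Real.exp (t * z) * ∏ k ∈ S, d k ^ t := by
    intro S
    have hp : 0 < ∏ k ∈ S, d k := Finset.prod_pos fun k _ => hd k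
    rw [Pi.smul_apply, smul_eq_mul, if_neg (mul_pos (Real.exp_pos z) hp).ne',
      Real.mul_rpow (Real.exp_pos z).le hp.le, ← Real.exp_mul, mul_comm z,
      Real.finsetProd_rpow _ _ fun k _ => (hd k).le]
  rw [Finset.sum_congr rfl fun S _ => h2 S, ← Finset.mul_sum]
  -- This is Tr Γ(H^t) = det(1 + H^t) in eigenvalues.
  have h3 : ∑ S : Finset X, ∏ k ∈ S, d k ^ t = ∏ k, (1 + d k ^ t) := by
    rw [Finset.prod_one_add, Finset.powerset_univ]
  rw [h3, Real.log_mul (Real.exp_pos _).ne' (Finset.prod_pos fun k _ => hpos k).ne', Real.log_exp,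
    Real.log_prod fun k _ => (hpos k).ne']

theorem IsSecondQuant.log_trace {H : Matrix X X ℂ} (hH : H.PosDef)
    {M : Matrix (Finset X) (Finset X) ℂ} (hM : IsSecondQuant H M) (z : ℝ) :
    Real.log ((Real.exp z : ℂ) • M).trace.re =
      z + (cfc (fun x : ℝ => Real.log (1 + x)) H).trace.re := by
  have h := hM.log_trace_suppPow hH z 1
  have h1 : suppPow ((Real.exp z : ℂ) • M) 1 = (Real.exp z : ℂ) • M := by
    obtain ⟨U, hU, hHU⟩ := exists_conjDiag hH.isHermitian
    generalize hH.isHermitian.eigenvalues = d at hHU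
    subst hHU
    obtain ⟨G, hG⟩ := exists_isSecondQuant U
    rw [hM.unique (hG.conjDiag d), ← conjDiag_smul, suppPow, cfc_conjDiag (hG.unitary hU)]
    congr 1
    ext S
    rw [Real.rpow_one]
    split_ifs with h0
    · exact h0.symm
    · rfl
  rw [h1, one_mul] at h
  simpa only [Real.rpow_one] using h

theorem posDef_mul_mul {A B : Matrix X X ℂ} (hA : A.PosDef) (hB : B.PosDef) :
    (B * A * B).PosDef := by
  have hinj : Function.Injective B.vecMul := Matrix.vecMul_injective_of_isUnit hB.isUnit
  have := hA.mul_mul_conjTranspose_same hinj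
  rwa [hB.isHermitian.eq] at this

/-- A Hermitian matrix with eigenvalues strictly between `0` and `1`. -/
def IsStrictSymbol (Q : Matrix X X ℂ) : Prop :=
  ∃ (U : Matrix X X ℂ) (d : X → ℝ), Uᴴ * U = 1 ∧ (∀ k, d k ∈ Set.Ioo (0 : ℝ) 1) ∧ Q = conjDiag U d

theorem IsStrictSymbol.posDef_oddsPow {Q : Matrix X X ℂ} (hQ : IsStrictSymbol Q) (t : ℝ) :
    (cfc (oddsPow t) Q).PosDef := by
  obtain ⟨U, d, hU, hd, rfl⟩ := hQ
  rw [cfc_conjDiag hU]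
  exact conjDiag_posDef hU fun k => oddsPow_pos (hd k)

theorem IsStrictSymbol.oddsPow_mul {Q : Matrix X X ℂ} (hQ : IsStrictSymbol Q) (s t : ℝ) :
    cfc (oddsPow s) Q * cfc (oddsPow t) Q = cfc (oddsPow (s + t)) Q := by
  obtain ⟨U, d, hU, hd, rfl⟩ := hQ
  rw [cfc_conjDiag hU, cfc_conjDiag hU, cfc_conjDiag hU, conjDiag_mul hU]
  congr 1
  ext k
  exact (Real.rpow_add (div_pos (hd k).1 (sub_pos.mpr (hd k).2)) s t).symm

/-- The Petz quantity of two quasi-free densities in terms of their symbols. -/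
theorem psiPetz_eq {Q R : Matrix X X ℂ} (hQ : IsStrictSymbol Q) (hR : IsStrictSymbol R)
    {ρ σ : Matrix (Finset X) (Finset X) ℂ} (hρ : IsQuasiFreeDensity Q ρ)
    (hσ : IsQuasiFreeDensity R σ) (α : ℝ) :
    psiPetz α ρ σ = α * logVacuum Q + (1 - α) * logVacuum R +
      (cfc (fun x : ℝ => Real.log (1 + x)) (cfc (oddsPow ((1 - α) / 2)) R *
        cfc (oddsPow α) Q * cfc (oddsPow ((1 - α) / 2)) R)).trace.re := by
  obtain ⟨M, hM, hMρ⟩ : ∃ M, IsSecondQuant (cfc (oddsPow α) Q) M ∧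
      suppPow ρ α = (Real.exp (α * logVacuum Q) : ℂ) • M := by
    obtain ⟨U, d, hU, hd, rfl⟩ := hQ
    exact hρ.suppPow_eq hU hd α
  obtain ⟨N, hN, hNσ⟩ : ∃ M, IsSecondQuant (cfc (oddsPow (1 - α)) R) M ∧
      suppPow σ (1 - α) = (Real.exp ((1 - α) * logVacuum R) : ℂ) • M := by
    obtain ⟨U, d, hU, hd, rfl⟩ := hR
    exact hσ.suppPow_eq hU hd (1 - α)
  -- The power of the second density is split into two halves, so that cyclicity of the trace gives
  -- Γ of a positive definite matrix, as `log_trace` requires.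
  obtain ⟨L, hL⟩ := exists_isSecondQuant (cfc (oddsPow ((1 - α) / 2)) R)
  have hLN : N = L * L := by
    have := hL.mul hL
    rw [hR.oddsPow_mul, add_halves] at this
    exact hN.unique this
  rw [← ((hL.mul hM).mul hL).log_trace
    (posDef_mul_mul (hQ.posDef_oddsPow _) (hR.posDef_oddsPow _)), psiPetz, hMρ, hNσ,
    Matrix.smul_mul, Matrix.mul_smul, smul_smul, Matrix.trace_smul, Matrix.trace_smul, hLN,
    ← Matrix.mul_assoc, Matrix.trace_mul_comm, ← Matrix.mul_assoc, ← Complex.ofReal_mul,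
    ← Real.exp_add]

/-- The sandwiched quantity of two quasi-free densities in terms of their symbols. -/
theorem psiSandwiched_eq {Q R : Matrix X X ℂ} (hQ : IsStrictSymbol Q) (hR : IsStrictSymbol R)
    {ρ σ : Matrix (Finset X) (Finset X) ℂ} (hρ : IsQuasiFreeDensity Q ρ)
    (hσ : IsQuasiFreeDensity R σ) {α : ℝ} (hα : 0 < α) :
    psiSandwiched α ρ σ = α * logVacuum Q + (1 - α) * logVacuum R +
      (cfc (fun x : ℝ => Real.log (1 + x ^ α)) (cfc (oddsPow (1 / 2)) Q *
        cfc (oddsPow ((1 - α) / α)) R * cfc (oddsPow (1 / 2)) Q)).trace.re := by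
  obtain ⟨M, hM, hMρ⟩ : ∃ M, IsSecondQuant (cfc (oddsPow (1 / 2)) Q) M ∧
      suppPow ρ (1 / 2) = (Real.exp (1 / 2 * logVacuum Q) : ℂ) • M := by
    obtain ⟨U, d, hU, hd, rfl⟩ := hQ
    exact hρ.suppPow_eq hU hd _
  obtain ⟨N, hN, hNσ⟩ : ∃ M, IsSecondQuant (cfc (oddsPow ((1 - α) / α)) R) M ∧
      suppPow σ ((1 - α) / α) = (Real.exp ((1 - α) / α * logVacuum R) : ℂ) • M := by
    obtain ⟨U, d, hU, hd, rfl⟩ := hR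
    exact hσ.suppPow_eq hU hd _
  have h := ((hM.mul hN).mul hM).log_trace_suppPow
    (posDef_mul_mul (hR.posDef_oddsPow _) (hQ.posDef_oddsPow _))
    (logVacuum Q + (1 - α) / α * logVacuum R) α
  have hz : Real.exp (logVacuum Q + (1 - α) / α * logVacuum R) =
      Real.exp (1 / 2 * logVacuum Q) * (Real.exp (1 / 2 * logVacuum Q) *
        Real.exp ((1 - α) / α * logVacuum R)) := by
    rw [← Real.exp_add, ← Real.exp_add]
    congr 1
    ring
  have hz' : α * (logVacuum Q + (1 - α) / α * logVacuum R) =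
      α * logVacuum Q + (1 - α) * logVacuum R := by
    field_simp
  rw [hz'] at h
  have hs : ∀ a b : ℂ, (a • M) * (b • N) * (a • M) = (a * (a * b)) • (M * N * M) := fun a b => by
    simp only [Matrix.smul_mul, Matrix.mul_smul, smul_smul]
    congr 1
    ring
  rw [← h, psiSandwiched, hMρ, hNσ, hs, hz, Complex.ofReal_mul, Complex.ofReal_mul]

theorem modeMat_mul_conjTranspose (k : X) : modeMat k * (modeMat k)ᴴ =
    Matrix.diagonal fun S => if k ∈ S then (1 : ℂ) else 0 := by
  refine Matrix.ext_of_mulVec_single fun T => ?_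
  generalize (Pi.single T (1 : ℂ) : Finset X → ℂ) = f
  funext S
  rw [← Matrix.mulVec_mulVec, modeMat_mulVec, Matrix.mulVec_diagonal]
  split_ifs with h
  · rw [modeMat_conjTranspose_mulVec, if_neg (Finset.notMem_erase k S), ← mul_assoc,
      modeSign_erase _ _ _ h, if_neg (lt_irrefl k), modeSign_mul_self, Finset.insert_erase h]
  · simp

/-- The logarithm of σ is a constant plus the log-odds times the number operators of the eigenmodes
of R. Their expectations in ρ are two-point functions ⟨u, Qu⟩, so commutation of Q and R is not
needed. -/
theorem IsQuasiFreeDensity.trace_mul_suppLog {Q R : Matrix X X ℂ} (hR : IsStrictSymbol R)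
    {ρ σ : Matrix (Finset X) (Finset X) ℂ} (hρ : IsQuasiFreeDensity Q ρ)
    (hσ : IsQuasiFreeDensity R σ) :
    (ρ * suppLog σ).trace.re =
      logVacuum R + (Q * cfc (fun x : ℝ => Real.log (x / (1 - x))) R).trace.re := by
  obtain ⟨U, d, hU, hd, rfl⟩ := hR
  obtain ⟨G, hG⟩ := exists_isSecondQuant U
  have hGG := hG.unitary hU
  have hσ' : σ = Fermion.conjDiag G (occWeight d) := hσ.eq_conj_diagonal hU rfl hG
  set c : X → ℝ := fun k => Real.log (d k / (1 - d k)) with hc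
  have hpos : ∀ k, 0 < d k / (1 - d k) := fun k => div_pos (hd k).1 (sub_pos.mpr (hd k).2)
  have h1 : suppLog σ = (logVacuum (conjDiag U d) : ℂ) • 1 +
      ∑ k, (c k : ℂ) • (createMat (U *ᵥ Pi.single k 1) * annihilateMat (U *ᵥ Pi.single k 1)) := by
    have h2 : ∀ k, createMat (U *ᵥ Pi.single k 1) * annihilateMat (U *ᵥ Pi.single k 1) =
        G * (Matrix.diagonal fun S => if k ∈ S then (1 : ℂ) else 0) * Gᴴ := by
      intro k
      have h3 : createMat (U *ᵥ Pi.single k 1) = G * modeMat k * Gᴴ := by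
        rw [← createMat_single, hG.intertwine, Matrix.mul_assoc, mul_eq_one_comm.mp hGG,
          Matrix.mul_one]
      rw [annihilateMat, h3, ← modeMat_mul_conjTranspose]
      simp only [Matrix.conjTranspose_mul, Matrix.conjTranspose_conjTranspose]
      have : G * modeMat k * Gᴴ * (G * ((modeMat k)ᴴ * Gᴴ)) =
          G * (modeMat k * (Gᴴ * G) * (modeMat k)ᴴ) * Gᴴ := by simp only [Matrix.mul_assoc]
      rw [this, hGG, Matrix.mul_one]
    rw [hσ', suppLog, cfc_conjDiag hGG, ← conjDiag_const hGG]
    have h8 : ∀ D : X → Matrix (Finset X) (Finset X) ℂ, ∑ k, (c k : ℂ) • (G * D k * Gᴴ) =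
        G * (∑ k, (c k : ℂ) • D k) * Gᴴ := fun D => by
      rw [Finset.mul_sum, Finset.sum_mul]
      simp only [Matrix.mul_smul, Matrix.smul_mul]
    simp only [h2]
    rw [h8]
    have h4 : ∑ k, (c k : ℂ) • (Matrix.diagonal fun S : Finset X => if k ∈ S then (1 : ℂ) else 0) =
        Matrix.diagonal fun S => ((∑ k ∈ S, c k : ℝ) : ℂ) := by
      ext S T
      by_cases hST : S = T
      · subst hST
        simp [Matrix.sum_apply, Finset.sum_ite_mem]
      · simp [Matrix.sum_apply, hST]
    rw [h4]
    change _ = _ + Fermion.conjDiag G _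
    rw [← conjDiag_add]
    congr 1
    ext S
    rw [occWeight_eq hd, Real.log_mul (Real.exp_pos _).ne' (Finset.prod_pos fun k _ => hpos k).ne',
      Real.log_exp, Real.log_prod fun k _ => (hpos k).ne', Pi.add_apply, logVacuum,
      cfc_conjDiag hU, trace_conjDiag hU, Complex.ofReal_re]
  have h5 : ∀ x : X → ℂ, (ρ * (createMat x * annihilateMat x)).trace = star x ⬝ᵥ (Q *ᵥ x) := by
    intro x
    have := hρ.correlation 1 (fun _ => x) (fun _ => x)
    simpa using this
  have h6 : Q * conjDiag U c = ∑ k, (c k : ℂ) • (Q * Matrix.vecMulVec (U *ᵥ Pi.single k 1)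
      (star (U *ᵥ Pi.single k 1))) := by
    have h7 : conjDiag U c = ∑ k, (c k : ℂ) • Matrix.vecMulVec (U *ᵥ Pi.single k 1)
        (star (U *ᵥ Pi.single k 1)) := by
      ext i j
      simp [conjDiag, Matrix.mul_apply, Matrix.sum_apply, Matrix.vecMulVec_apply,
        Matrix.diagonal_apply]
      refine Finset.sum_congr rfl fun k _ => ?_
      ring
    rw [h7, Finset.mul_sum]
    simp only [Matrix.mul_smul]
  rw [h1, cfc_conjDiag hU, h6, Matrix.mul_add, Matrix.trace_add, Matrix.mul_smul, Matrix.mul_one,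
    Matrix.trace_smul, hρ.trace_eq_one, Finset.mul_sum, Matrix.trace_sum, Matrix.trace_sum]
  simp only [Matrix.mul_smul, Matrix.trace_smul, h5, Matrix.mul_vecMulVec, Matrix.trace_vecMulVec]
  rw [Complex.add_re]
  congr 1
  · simp
  · congr 1
    refine Finset.sum_congr rfl fun k _ => ?_
    rw [dotProduct_comm]

theorem IsQuasiFreeDensity.posDef {Q : Matrix X X ℂ} (hQ : IsStrictSymbol Q)
    {ρ : Matrix (Finset X) (Finset X) ℂ} (hρ : IsQuasiFreeDensity Q ρ) : ρ.PosDef := by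
  obtain ⟨U, d, hU, hd, rfl⟩ := hQ
  obtain ⟨G, hG⟩ := exists_isSecondQuant U
  have h : ρ = Fermion.conjDiag G (occWeight d) := hρ.eq_conj_diagonal hU rfl hG
  rw [h]
  exact conjDiag_posDef (hG.unitary hU) (occWeight_pos hd)

/-- The relative entropy of two quasi-free densities in terms of their symbols. -/
theorem relEntropy_eq {Q R : Matrix X X ℂ} (hQ : IsStrictSymbol Q) (hR : IsStrictSymbol R)
    {ρ σ : Matrix (Finset X) (Finset X) ℂ} (hρ : IsQuasiFreeDensity Q ρ)
    (hσ : IsQuasiFreeDensity R σ) :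
    relEntropy ρ σ =
      ((logVacuum Q + (Q * cfc (fun x : ℝ => Real.log (x / (1 - x))) Q).trace.re -
        (logVacuum R + (Q * cfc (fun x : ℝ => Real.log (x / (1 - x))) R).trace.re) : ℝ) :
        EReal) := by
  rw [relEntropy, if_pos, hρ.trace_mul_suppLog hQ hρ, hρ.trace_mul_suppLog hR hσ,
    hρ.trace_eq_one, Complex.one_re, div_one]
  intro v hv
  have : v = 0 := by
    by_contra hne
    have := (hσ.posDef hR).dotProduct_mulVec_pos hne
    rw [hv, dotProduct_zero] at this
    exact lt_irrefl _ this
  rw [this, Matrix.mulVec_zero]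

end QuasiFree

/-! ### Restrictions of quasi-free states are quasi-free. -/

section Reduced

variable {X : Type*} [LinearOrder X]

theorem inner_extendVec (Q : OneParticle X →L[ℂ] OneParticle X) (Λ : Finset X) (x y : Λ → ℂ) :
    inner ℂ (extendVec Λ y) (Q (extendVec Λ x)) = star y ⬝ᵥ (compress Q Λ *ᵥ x) := by
  simp only [extendVec, map_sum, map_smul, sum_inner, inner_sum, inner_smul_left,
    inner_smul_right, dotProduct, Matrix.mulVec, compress, Matrix.of_apply, Finset.mul_sum]
  rw [Finset.sum_comm]
  refine Finset.sum_congr rfl fun k _ => Finset.sum_congr rfl fun l _ => ?_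
  simp only [Pi.star_apply, Complex.star_def]
  ring

/-- The *-homomorphism carries normal ordered products to normal ordered products, and on vectors
supported in Λ the form ⟨y, Qx⟩ only sees the compression of Q. -/
theorem IsReducedDensity.isQuasiFreeDensity {Q : OneParticle X →L[ℂ] OneParticle X}
    {ω : CAR X →ₗ[ℂ] ℂ} (hω : IsQuasiFreeState Q ω) {Λ : Finset X}
    {ρ : Matrix (Finset Λ) (Finset Λ) ℂ} (hρ : IsReducedDensity ω Λ ρ) :
    IsQuasiFreeDensity (compress Q Λ) ρ := by
  obtain ⟨φ, hφ, htr⟩ := hρ.trace_mul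
  have hcr : ∀ x, φ (createMat x) = star (carC (extendVec Λ x)) := fun x => by
    rw [← hφ, ← map_star]
    congr 1
    exact (Matrix.conjTranspose_conjTranspose _).symm
  have hprod : ∀ (n m : ℕ) (x : Fin n → Λ → ℂ) (y : Fin m → Λ → ℂ),
      (ρ * ((List.ofFn fun i => createMat (x i)).prod *
        (List.ofFn fun i => annihilateMat (y i)).reverse.prod)).trace =
      ω ((List.ofFn fun i => star (carC (extendVec Λ (x i)))).prod *
        (List.ofFn fun i => carC (extendVec Λ (y i))).reverse.prod) := by
    intro n m x y
    have h1 : φ (List.ofFn fun i => createMat (x i)).prod =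
        (List.ofFn fun i => star (carC (extendVec Λ (x i)))).prod := by
      refine (map_list_prod φ _).trans (congrArg List.prod ?_)
      rw [List.map_ofFn]
      exact congrArg List.ofFn (funext fun i => hcr (x i))
    have h2 : φ (List.ofFn fun i => annihilateMat (y i)).reverse.prod =
        (List.ofFn fun i => carC (extendVec Λ (y i))).reverse.prod := by
      refine (map_list_prod φ _).trans (congrArg List.prod ?_)
      rw [List.map_reverse, List.map_ofFn]
      exact congrArg _ (congrArg List.ofFn (funext fun i => hφ (y i)))
    have h3 := htr ((List.ofFn fun i => createMat (x i)).prod *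
        (List.ofFn fun i => annihilateMat (y i)).reverse.prod)
    rw [map_mul φ, h1, h2] at h3
    exact h3
  refine ⟨hρ.posSemidef, hρ.trace_eq_one, fun n x y => ?_, fun n m x y hnm => ?_⟩
  · refine (Eq.trans ?_ (hprod n n x y)).trans ?_
    · congr!
    · rw [hω.correlation]
      simp only [inner_extendVec]
  · refine (Eq.trans ?_ (hprod n m x y)).trans ?_
    · congr!
    · rw [hω.correlation_ne _ _ _ _ hnm]

end Reduced

/-! ### Plane waves as a Hilbert basis of L² of the cube. -/

section CubeBasis

variable {ν : ℕ}

/-- The Haar probability measure on the torus `(ℝ/ℤ)^ν`. -/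
def torusMeasure (ν : ℕ) : Measure (UnitAddTorus (Fin ν)) :=
  Measure.pi fun _ => AddCircle.haarAddCircle

/-- The Hilbert space `L²([0, 2π)^ν)`. -/
abbrev CubeL2 (ν : ℕ) := Lp ℂ 2 (cubeMeasure ν)

instance isFiniteMeasure_cubeMeasure : IsFiniteMeasure (cubeMeasure ν) := by
  refine ⟨?_⟩
  rw [cubeMeasure, Measure.restrict_apply_univ, cube, Real.volume_pi_Ico]
  exact ENNReal.prod_lt_top fun _ _ => ENNReal.ofReal_lt_top

/-- The parametrization of the cube `[0, 2π)^ν` by the torus. -/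
def torusToCube (ν : ℕ) (x : UnitAddTorus (Fin ν)) : Fin ν → ℝ :=
  fun i => 2 * Real.pi * (AddCircle.equivIoc 1 0 (x i)).1

/-- Each coordinate is a representative in (0, 1] scaled by 2π. This transports Fourier theory on
the torus to the cube. -/
theorem measurePreserving_torusToCube :
    MeasurePreserving (torusToCube ν) (torusMeasure ν)
      (ENNReal.ofReal ((2 * Real.pi) ^ ν)⁻¹ • cubeMeasure ν) := by
  have h1 : ∀ _ : Fin ν, MeasurePreserving
      (fun x : UnitAddCircle => 2 * Real.pi * (AddCircle.equivIoc 1 0 x).1)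
      AddCircle.haarAddCircle
      (ENNReal.ofReal (2 * Real.pi)⁻¹ • volume.restrict (Set.Ico 0 (2 * Real.pi))) := by
    intro _
    have h2 : MeasurePreserving (fun x : UnitAddCircle => (AddCircle.equivIoc 1 0 x).1)
        AddCircle.haarAddCircle (volume.restrict (Set.Ioc (0 : ℝ) (0 + 1))) := by
      have h := (measurePreserving_subtype_coe (μa := (volume : Measure ℝ))
        (measurableSet_Ioc (a := (0 : ℝ)) (b := 0 + 1))).comp
        (AddCircle.measurePreserving_equivIoc (1 : ℝ) (a := 0))
      rw [AddCircle.volume_eq_smul_haarAddCircle] at h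
      simp only [ENNReal.ofReal_one, one_smul] at h
      exact h
    have h3 : MeasurePreserving (fun x : ℝ => 2 * Real.pi * x)
        (volume.restrict (Set.Ioc (0 : ℝ) (0 + 1)))
        (ENNReal.ofReal (2 * Real.pi)⁻¹ • volume.restrict (Set.Ico 0 (2 * Real.pi))) := by
      refine ⟨by fun_prop, ?_⟩
      have hp : (0 : ℝ) < 2 * Real.pi := by positivity
      have h4 := Real.map_volume_mul_left (a := 2 * Real.pi) hp.ne'
      have h5 : Set.Ioc (0 : ℝ) (0 + 1) =
          (fun x : ℝ => 2 * Real.pi * x) ⁻¹' Set.Ioc 0 (2 * Real.pi) := by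
        ext x
        simp only [Set.mem_Ioc, Set.mem_preimage, zero_add]
        constructor
        · rintro ⟨ha, hb⟩
          exact ⟨by positivity, by nlinarith⟩
        · rintro ⟨ha, hb⟩
          exact ⟨by nlinarith, by nlinarith⟩
      -- The representatives fill (0, 2π] while the cube uses [0, 2π); the difference is a null set.
      rw [h5, ← Measure.restrict_map (by fun_prop) measurableSet_Ioc, h4,
        abs_of_pos (by positivity), Measure.restrict_smul,
        Measure.restrict_congr_set (Ico_ae_eq_Ioc (μ := volume)).symm]
    exact h3.comp h2
  have : IsFiniteMeasure
      (ENNReal.ofReal (2 * Real.pi)⁻¹ • volume.restrict (Set.Ico 0 (2 * Real.pi))) := by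
    have h : IsFiniteMeasure (volume.restrict (Set.Ico 0 (2 * Real.pi))) := inferInstance
    exact Measure.smul_finite _ ENNReal.ofReal_ne_top
  have h := measurePreserving_pi (fun _ : Fin ν => AddCircle.haarAddCircle (T := 1)) _ h1
  have h6 : (Measure.pi fun _ : Fin ν => ENNReal.ofReal (2 * Real.pi)⁻¹ •
      volume.restrict (Set.Ico (0 : ℝ) (2 * Real.pi))) =
      ENNReal.ofReal ((2 * Real.pi) ^ ν)⁻¹ • cubeMeasure ν := by
    refine Measure.pi_eq fun s hs => ?_
    rw [Measure.smul_apply, cubeMeasure, cube, volume_pi, Measure.restrict_pi_pi, Measure.pi_pi]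
    simp only [Measure.smul_apply, smul_eq_mul, Finset.prod_mul_distrib, Finset.prod_const,
      Finset.card_univ, Fintype.card_fin]
    rw [← inv_pow, ENNReal.ofReal_pow (by positivity)]
  rw [h6] at h
  exact h

theorem integral_torusToCube (f : (Fin ν → ℝ) → ℂ) (hf : AEStronglyMeasurable f (cubeMeasure ν)) :
    ∫ x, f (torusToCube ν x) ∂torusMeasure ν =
      (((2 * Real.pi) ^ ν)⁻¹ : ℝ) • ∫ t, f t ∂cubeMeasure ν := by
  have h := measurePreserving_torusToCube (ν := ν)
  rw [← integral_map h.measurable.aemeasurable, h.map_eq, integral_smul_measure,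
    ENNReal.toReal_ofReal (by positivity)]
  rw [h.map_eq]
  exact hf.smul_measure _

theorem planeWave_torusToCube (k : IntLattice ν) (x : UnitAddTorus (Fin ν)) :
    planeWave k (torusToCube ν x) = UnitAddTorus.mFourier (ofLex k) x := by
  rw [planeWave, Finset.mul_sum, Complex.exp_sum]
  change _ = ∏ i, fourier (ofLex k i) (x i)
  refine Finset.prod_congr rfl fun i _ => ?_
  have hx : x i = ((AddCircle.equivIoc 1 0 (x i)).1 : UnitAddCircle) :=
    ((AddCircle.equivIoc 1 0).symm_apply_apply (x i)).symm
  conv_rhs => rw [hx]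
  rw [fourier_coe_apply, torusToCube]
  congr 1
  push_cast
  ring

theorem continuous_planeWave (k : IntLattice ν) : Continuous (planeWave k) := by
  unfold planeWave; fun_prop

theorem planeWave_add (k l : IntLattice ν) (t : Fin ν → ℝ) :
    planeWave (k + l) t = planeWave k t * planeWave l t := by
  rw [planeWave, planeWave, planeWave, ← Complex.exp_add, ← mul_add, ← Finset.sum_add_distrib]
  congr 2
  refine Finset.sum_congr rfl fun i _ => ?_
  have : ofLex (k + l) i = ofLex k i + ofLex l i := rfl
  rw [this, Int.cast_add, add_mul]

theorem conj_planeWave (k : IntLattice ν) (t : Fin ν → ℝ) :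
    (starRingEnd ℂ) (planeWave k t) = planeWave (-k) t := by
  rw [planeWave, planeWave, ← Complex.exp_conj]
  congr 1
  have : ∀ i, ofLex (-k) i = -ofLex k i := fun i => rfl
  simp [this, -Pi.ofLex_apply]

/-- The normalization `(2π)^(-ν/2)` of the plane waves. -/
def waveNorm (ν : ℕ) : ℝ := √(((2 * Real.pi) ^ ν)⁻¹)

theorem waveNorm_mul_self : waveNorm ν * waveNorm ν = ((2 * Real.pi) ^ ν)⁻¹ :=
  Real.mul_self_sqrt (by positivity)

/-- The normalized plane wave as an element of `L²([0, 2π)^ν)`. -/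
def wave (k : IntLattice ν) : CubeL2 ν :=
  (waveNorm ν : ℂ) • (memLp_planeWave k).toLp (planeWave k)

theorem coeFn_wave (k : IntLattice ν) :
    (wave k : (Fin ν → ℝ) → ℂ) =ᵐ[cubeMeasure ν] fun t => waveNorm ν * planeWave k t := by
  filter_upwards [Lp.coeFn_smul (waveNorm ν : ℂ) ((memLp_planeWave k).toLp (planeWave k)),
    (memLp_planeWave k).coeFn_toLp] with t h1 h2
  rw [wave, h1, Pi.smul_apply, h2, smul_eq_mul]

theorem inner_wave (k : IntLattice ν) (x : CubeL2 ν) :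
    inner ℂ (wave k) x = waveNorm ν * ∫ t, planeWave (-k) t * x t ∂cubeMeasure ν := by
  rw [L2.inner_def, ← integral_const_mul]
  refine integral_congr_ae ?_
  filter_upwards [coeFn_wave k] with t ht
  rw [ht, RCLike.inner_apply, map_mul, conj_planeWave, Complex.conj_ofReal]
  ring

theorem integral_mFourier (k : Fin ν → ℤ) :
    ∫ x, UnitAddTorus.mFourier k x ∂torusMeasure ν = if k = 0 then 1 else 0 := by
  have h : ∀ x, UnitAddTorus.mFourier k x = ∏ i, fourier (k i) (x i) := fun x => rfl
  simp only [h, torusMeasure]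
  rw [integral_fintype_prod_eq_prod (fun i (y : UnitAddCircle) => (fourier (k i) y : ℂ))]
  have h1 : ∀ j : ℤ, ∫ y : UnitAddCircle, (fourier j y : ℂ) ∂AddCircle.haarAddCircle =
      if j = 0 then 1 else 0 := by
    intro j
    split_ifs with hj
    · simp [hj]
    · exact integral_eq_zero_of_add_right_eq_neg (μ := AddCircle.haarAddCircle)
        (fourier_add_half_inv_index hj one_pos)
  simp only [h1]
  split_ifs with h0
  · simp [h0]
  · obtain ⟨i, hi⟩ := Function.ne_iff.mp h0
    exact Finset.prod_eq_zero (Finset.mem_univ i) (by simpa using hi)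

theorem orthonormal_wave : Orthonormal ℂ (wave (ν := ν)) := by
  rw [orthonormal_iff_ite]
  intro k l
  rw [inner_wave]
  have h1 : ∫ t, planeWave (-k) t * wave l t ∂cubeMeasure ν =
      waveNorm ν * ∫ t, planeWave (l - k) t ∂cubeMeasure ν := by
    rw [← integral_const_mul]
    refine integral_congr_ae ?_
    filter_upwards [coeFn_wave l] with t ht
    rw [ht, sub_eq_add_neg, planeWave_add]
    ring
  have h2 := integral_torusToCube (planeWave (l - k)) (continuous_planeWave _).aestronglyMeasurable
  simp only [planeWave_torusToCube] at h2
  rw [integral_mFourier] at h2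
  rw [h1, ← mul_assoc, ← Complex.ofReal_mul, waveNorm_mul_self, ← Complex.real_smul, ← h2]
  have : ofLex (l - k) = 0 ↔ k = l := by
    rw [ofLex_eq_zero, sub_eq_zero, eq_comm]
  simp only [this]

theorem mFourierCoeff_torusToCube (f : CubeL2 ν) (k : IntLattice ν) :
    ∫ x, UnitAddTorus.mFourier (-ofLex k) x * f (torusToCube ν x) ∂torusMeasure ν =
      waveNorm ν * inner ℂ (wave k) f := by
  have h := integral_torusToCube (fun t => planeWave (-k) t * f t)
    ((continuous_planeWave _).aestronglyMeasurable.mul (Lp.aestronglyMeasurable f))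
  simp only [planeWave_torusToCube, ofLex_neg] at h
  rw [h, inner_wave, ← mul_assoc, ← Complex.ofReal_mul, waveNorm_mul_self, Complex.real_smul]

/-- Pulled back to the torus, f has vanishing Fourier coefficients, so Parseval there gives it zero
norm. -/
theorem eq_zero_of_inner_wave (f : CubeL2 ν) (hf : ∀ k, inner ℂ (wave k) f = 0) : f = 0 := by
  have hmp := measurePreserving_torusToCube (ν := ν)
  have hg : MemLp (fun x => f (torusToCube ν x)) 2 (torusMeasure ν) :=
    ((Lp.memLp f).smul_measure ENNReal.ofReal_ne_top).comp_measurePreserving hmp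
  have h1 := UnitAddTorus.hasSum_sq_mFourierCoeff (d := Fin ν) (hg.toLp _)
  have h2 : ∀ k : Fin ν → ℤ, UnitAddTorus.mFourierCoeff (hg.toLp _) k = 0 := by
    intro k
    have h3 := mFourierCoeff_torusToCube f (toLex k)
    rw [hf, mul_zero] at h3
    rw [← h3]
    refine integral_congr_ae ?_
    filter_upwards [hg.coeFn_toLp] with x hx
    rw [smul_eq_mul]
    exact congrArg _ hx
  have h5 : ∫ x, ‖hg.toLp _ x‖ ^ 2 ∂torusMeasure ν = 0 := by
    refine h1.unique ?_
    convert hasSum_zero (L := .unconditional (Fin ν → ℤ)) with k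
    exact (congrArg (fun z : ℂ => ‖z‖ ^ 2) (h2 k)).trans (by simp)
  have h4 : ∫ x, ‖f (torusToCube ν x)‖ ^ 2 ∂torusMeasure ν = 0 := by
    rw [← h5]
    refine integral_congr_ae ?_
    filter_upwards [hg.coeFn_toLp] with x hx
    rw [hx]
  have h6 : AEStronglyMeasurable (fun t => ‖f t‖ ^ 2) (cubeMeasure ν) :=
    (Lp.aestronglyMeasurable f).norm.pow 2
  have h7 : ∫ t, ‖f t‖ ^ 2 ∂cubeMeasure ν = 0 := by
    have h8 := integral_map (f := fun t => ‖f t‖ ^ 2) hmp.measurable.aemeasurable (by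
      rw [hmp.map_eq]; exact h6.smul_measure _)
    rw [h4, hmp.map_eq, integral_smul_measure, ENNReal.toReal_ofReal (by positivity)] at h8
    exact (smul_eq_zero.mp h8).resolve_left (by positivity)
  have h9 : inner ℂ f f = 0 := by
    rw [L2.inner_def]
    have : ∀ t, inner ℂ (f t) (f t) = ((‖f t‖ ^ 2 : ℝ) : ℂ) := fun t => by
      rw [inner_self_eq_norm_sq_to_K]; push_cast; rfl
    simp only [this]
    rw [integral_complex_ofReal, h7, Complex.ofReal_zero]
  exact inner_self_eq_zero.mp h9

/-- The plane waves form a Hilbert basis of `L²([0, 2π)^ν)`. -/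
def waveBasis (ν : ℕ) : HilbertBasis (IntLattice ν) ℂ (CubeL2 ν) :=
  HilbertBasis.mkOfOrthogonalEqBot (v := wave) orthonormal_wave (by
    rw [Submodule.eq_bot_iff]
    intro f hf
    refine eq_zero_of_inner_wave f fun k => ?_
    exact (Submodule.mem_orthogonal _ _).mp hf _ (Submodule.subset_span ⟨k, rfl⟩))

theorem waveBasis_apply (k : IntLattice ν) : waveBasis ν k = wave k := by
  rw [waveBasis, HilbertBasis.coe_mkOfOrthogonalEqBot]

/-- The transformation F is unitary only after this rescaling. The scalar is harmless, as it cancels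
in F⁻¹ M_q F. -/
theorem fourierL2_eq (x : OneParticle (IntLattice ν)) :
    (waveNorm ν : ℂ) • fourierL2 x = (waveBasis ν).repr.symm x := by
  rw [← ((waveBasis ν).hasSum_repr_symm x).tsum_eq, fourierL2, ← tsum_const_smul'']
  refine tsum_congr fun k => ?_
  rw [waveBasis_apply, wave, smul_comm]

/-- `A` is the operator of multiplication by the function `a`. -/
def IsMulOp (a : (Fin ν → ℝ) → ℝ) (A : CubeL2 ν →L[ℂ] CubeL2 ν) : Prop :=
  ∀ x, (A x : (Fin ν → ℝ) → ℂ) =ᵐ[cubeMeasure ν] fun t => (a t : ℂ) * x t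

theorem exists_isMulOp {a : (Fin ν → ℝ) → ℝ} (ha : AEMeasurable a (cubeMeasure ν)) {C : ℝ}
    (hC : 0 ≤ C) (haC : ∀ᵐ t ∂cubeMeasure ν, |a t| ≤ C) : ∃ A, IsMulOp a A ∧ ‖A‖ ≤ C := by
  have hbd : ∀ x : CubeL2 ν, ∀ᵐ t ∂cubeMeasure ν, ‖(a t : ℂ) * x t‖ ≤ C * ‖x t‖ := fun x => by
    filter_upwards [haC] with t ht
    rw [norm_mul, Complex.norm_real, Real.norm_eq_abs]
    exact mul_le_mul_of_nonneg_right ht (norm_nonneg _)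
  have hmem : ∀ x : CubeL2 ν, MemLp (fun t => (a t : ℂ) * x t) 2 (cubeMeasure ν) := fun x =>
    (Lp.memLp x).of_le_mul ((Complex.measurable_ofReal.comp_aemeasurable
      ha).aestronglyMeasurable.mul (Lp.aestronglyMeasurable x)) (hbd x)
  let L : CubeL2 ν →ₗ[ℂ] CubeL2 ν :=
    { toFun := fun x => (hmem x).toLp _
      map_add' := fun x y => by
        refine Lp.ext ?_
        filter_upwards [(hmem (x + y)).coeFn_toLp, (hmem x).coeFn_toLp, (hmem y).coeFn_toLp,
          Lp.coeFn_add x y, Lp.coeFn_add ((hmem x).toLp _) ((hmem y).toLp _)] with t h1 h2 h3 h4 h5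
        rw [h1, h5, Pi.add_apply, h2, h3, h4, Pi.add_apply, mul_add]
      map_smul' := fun z x => by
        refine Lp.ext ?_
        filter_upwards [(hmem (z • x)).coeFn_toLp, (hmem x).coeFn_toLp, Lp.coeFn_smul z x,
          Lp.coeFn_smul z ((hmem x).toLp _)] with t h1 h2 h3 h4
        rw [h1, RingHom.id_apply, h4, Pi.smul_apply, h2, h3, Pi.smul_apply, smul_eq_mul,
          smul_eq_mul]
        ring }
  have hL : ∀ x, (L x : (Fin ν → ℝ) → ℂ) =ᵐ[cubeMeasure ν] fun t => (a t : ℂ) * x t :=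
    fun x => (hmem x).coeFn_toLp
  have hLn : ∀ x, ‖L x‖ ≤ C * ‖x‖ := fun x => by
    refine Lp.norm_le_mul_norm_of_ae_le_mul ?_
    filter_upwards [hL x, hbd x] with t h1 h2
    rw [h1]
    exact h2
  exact ⟨L.mkContinuous C hLn, hL, L.mkContinuous_norm_le hC hLn⟩

end CubeBasis

/-! ### Hilbert–Schmidt estimates. -/

section HilbertSchmidt

open scoped Matrix.Norms.L2Operator

variable {m : Type*} [Fintype m] [DecidableEq m]

/-- The Hilbert–Schmidt norm. -/
def hsNorm (M : Matrix m m ℂ) : ℝ :=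
  ‖(WithLp.toLp 2 fun p : m × m => M p.1 p.2 : EuclideanSpace ℂ (m × m))‖

omit [DecidableEq m] in
theorem hsNorm_nonneg (M : Matrix m m ℂ) : 0 ≤ hsNorm M := norm_nonneg _

omit [DecidableEq m] in
theorem hsNorm_add_le (M N : Matrix m m ℂ) : hsNorm (M + N) ≤ hsNorm M + hsNorm N :=
  norm_add_le (WithLp.toLp 2 fun p : m × m => M p.1 p.2 : EuclideanSpace ℂ (m × m))
    (WithLp.toLp 2 fun p : m × m => N p.1 p.2)

omit [DecidableEq m] in
theorem hsNorm_smul (z : ℂ) (M : Matrix m m ℂ) : hsNorm (z • M) = ‖z‖ * hsNorm M :=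
  norm_smul z (WithLp.toLp 2 fun p : m × m => M p.1 p.2 : EuclideanSpace ℂ (m × m))

omit [DecidableEq m] in
theorem hsNorm_zero : hsNorm (0 : Matrix m m ℂ) = 0 := by
  simpa using hsNorm_smul 0 (0 : Matrix m m ℂ)

omit [DecidableEq m] in
theorem hsNorm_sq (M : Matrix m m ℂ) : hsNorm M ^ 2 = ∑ l, ∑ k, ‖M k l‖ ^ 2 := by
  rw [hsNorm, EuclideanSpace.norm_sq_eq, Fintype.sum_prod_type, Finset.sum_comm]

omit [DecidableEq m] in
theorem hsNorm_conjTranspose (M : Matrix m m ℂ) : hsNorm Mᴴ = hsNorm M := by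
  refine (sq_eq_sq₀ (hsNorm_nonneg _) (hsNorm_nonneg _)).mp ?_
  rw [hsNorm_sq, hsNorm_sq, Finset.sum_comm]
  simp

/-- Each column of MN is M applied to a column of N. -/
theorem hsNorm_mul_le (M N : Matrix m m ℂ) : hsNorm (M * N) ≤ ‖M‖ * hsNorm N := by
  refine abs_le_of_sq_le_sq' ?_ (mul_nonneg (norm_nonneg _) (hsNorm_nonneg _)) |>.2
  rw [mul_pow, hsNorm_sq, hsNorm_sq, Finset.mul_sum]
  refine Finset.sum_le_sum fun l _ => ?_
  have h := Matrix.l2_opNorm_mulVec M (WithLp.toLp 2 fun k => N k l)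
  have h2 := pow_le_pow_left₀ (norm_nonneg _) h 2
  rw [mul_pow, EuclideanSpace.norm_sq_eq, EuclideanSpace.norm_sq_eq] at h2
  exact h2

theorem hsNorm_mul_le' (M N : Matrix m m ℂ) : hsNorm (M * N) ≤ hsNorm M * ‖N‖ := by
  have h := hsNorm_mul_le Nᴴ Mᴴ
  rw [← Matrix.conjTranspose_mul, hsNorm_conjTranspose, hsNorm_conjTranspose,
    Matrix.l2_opNorm_conjTranspose] at h
  linarith

/-- Apply the ideal property to M·1. An error small in operator norm is therefore small in
Hilbert–Schmidt norm divided by the root of the dimension. -/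
theorem hsNorm_le (M : Matrix m m ℂ) : hsNorm M ≤ ‖M‖ * √(Fintype.card m) := by
  have h := hsNorm_mul_le M 1
  have h1 : hsNorm (1 : Matrix m m ℂ) = √(Fintype.card m) := by
    rw [← Real.sqrt_sq (hsNorm_nonneg _), hsNorm_sq]
    congr 1
    have : ∀ l : m, ∑ k, ‖(1 : Matrix m m ℂ) k l‖ ^ 2 = 1 := fun l => by
      rw [Finset.sum_eq_single l]
      · simp
      · intro k _ hk; simp [hk]
      · simp
    simp [this]
  rwa [Matrix.mul_one, h1] at h

-- Cauchy–Schwarz on the diagonal. After division by the dimension, traces are controlled by the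
-- normalized Hilbert–Schmidt norm.
omit [DecidableEq m] in
theorem norm_trace_le (M : Matrix m m ℂ) : ‖M.trace‖ ≤ √(Fintype.card m) * hsNorm M := by
  have h1 : ‖M.trace‖ ≤ ∑ k, ‖M k k‖ := norm_sum_le _ _
  refine h1.trans (abs_le_of_sq_le_sq' ?_ (mul_nonneg (Real.sqrt_nonneg _) (hsNorm_nonneg _))).2
  rw [mul_pow, Real.sq_sqrt (Nat.cast_nonneg _), hsNorm_sq]
  refine (sq_sum_le_card_mul_sum_sq (s := Finset.univ) (f := fun k => ‖M k k‖)).trans ?_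
  rw [Finset.card_univ]
  refine mul_le_mul_of_nonneg_left (Finset.sum_le_sum fun l _ => ?_) (Nat.cast_nonneg _)
  exact Finset.single_le_sum (f := fun k => ‖M k l‖ ^ 2) (fun k _ => by positivity)
    (Finset.mem_univ l)

theorem norm_conjDiag_le {U : Matrix m m ℂ} (hU : Uᴴ * U = 1) {d : m → ℝ} {C : ℝ} (hC : 0 ≤ C)
    (hd : ∀ k, |d k| ≤ C) : ‖conjDiag U d‖ ≤ C := by
  have hU1 : ‖U‖ ≤ 1 := by
    have h := Matrix.l2_opNorm_conjTranspose_mul_self U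
    have h1 : ‖(1 : Matrix m m ℂ)‖ ≤ 1 := by
      rw [← Matrix.diagonal_one, Matrix.l2_opNorm_diagonal, pi_norm_le_iff_of_nonneg zero_le_one]
      simp
    rw [hU] at h
    nlinarith [norm_nonneg U]
  have hD : ‖Matrix.diagonal (fun k => (d k : ℂ))‖ ≤ C := by
    rw [Matrix.l2_opNorm_diagonal, pi_norm_le_iff_of_nonneg hC]
    intro k
    rw [Complex.norm_real]
    exact hd k
  calc ‖conjDiag U d‖ ≤ ‖U‖ * ‖Matrix.diagonal (fun k => (d k : ℂ))‖ * ‖Uᴴ‖ :=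
        (norm_mul_le _ _).trans (mul_le_mul_of_nonneg_right (norm_mul_le _ _) (norm_nonneg _))
    _ ≤ 1 * C * 1 := by
        rw [Matrix.l2_opNorm_conjTranspose]
        gcongr
    _ = C := by ring

end HilbertSchmidt

/-! ### Compressions to finitely many basis vectors. -/

section Compression

open scoped Matrix.Norms.L2Operator

variable {H ι : Type*} [NormedAddCommGroup H] [InnerProductSpace ℂ H] [CompleteSpace H]
  (b : HilbertBasis ι ℂ H)

/-- The matrix of the compression of `A` to the span of `b k`, `k ∈ Λ`. -/
def compr (A : H →L[ℂ] H) (Λ : Finset ι) : Matrix Λ Λ ℂ :=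
  Matrix.of fun k l => inner ℂ (b k) (A (b l))

omit [CompleteSpace H] in
theorem compr_add (A B : H →L[ℂ] H) (Λ : Finset ι) :
    compr b (A + B) Λ = compr b A Λ + compr b B Λ := by
  ext k l; simp [compr]

omit [CompleteSpace H] in
theorem compr_smul (z : ℂ) (A : H →L[ℂ] H) (Λ : Finset ι) :
    compr b (z • A) Λ = z • compr b A Λ := by
  ext k l; simp [compr]

omit [CompleteSpace H] in
theorem compr_one [DecidableEq ι] (Λ : Finset ι) : compr b 1 Λ = 1 := by
  ext k l
  rw [compr, Matrix.of_apply, one_apply_eq_self,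
    orthonormal_iff_ite.mp b.orthonormal, Matrix.one_apply]
  simp only [Subtype.ext_iff]

/-- The vector of `H` with coordinates `v`. -/
def spread {Λ : Finset ι} (v : Λ → ℂ) : H := ∑ k, v k • b k

omit [CompleteSpace H] in
theorem norm_spread_sq {Λ : Finset ι} (v : Λ → ℂ) : ‖spread b v‖ ^ 2 = ∑ k, ‖v k‖ ^ 2 := by
  have hb : Orthonormal ℂ (fun k : Λ => b k) :=
    b.orthonormal.comp _ Subtype.val_injective
  have h := hb.inner_sum v v Finset.univ
  rw [← @inner_self_eq_norm_sq ℂ, spread, h, map_sum]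
  refine Finset.sum_congr rfl fun k _ => ?_
  rw [mul_comm, RCLike.mul_conj]
  norm_cast

omit [CompleteSpace H] in
theorem compr_mulVec (A : H →L[ℂ] H) {Λ : Finset ι} (v : Λ → ℂ) (k : Λ) :
    (compr b A Λ *ᵥ v) k = inner ℂ (b k) (A (spread b v)) := by
  simp only [Matrix.mulVec, dotProduct, compr, Matrix.of_apply, spread, map_sum, map_smul,
    inner_sum, inner_smul_right]
  exact Finset.sum_congr rfl fun l _ => mul_comm _ _

omit [CompleteSpace H] in
theorem sum_norm_inner_le (Λ : Finset ι) (x : H) :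
    ∑ k : Λ, ‖(inner ℂ (b k) x : ℂ)‖ ^ 2 ≤ ‖x‖ ^ 2 := by
  have hb : Orthonormal ℂ (fun k : Λ => b k) := b.orthonormal.comp _ Subtype.val_injective
  exact hb.sum_inner_products_le x

theorem norm_compr_le [DecidableEq ι] (A : H →L[ℂ] H) (Λ : Finset ι) : ‖compr b A Λ‖ ≤ ‖A‖ := by
  rw [Matrix.l2_opNorm_def]
  refine ContinuousLinearMap.opNorm_le_bound _ (norm_nonneg _) fun v => ?_
  refine abs_le_of_sq_le_sq' ?_ (mul_nonneg (norm_nonneg _) (norm_nonneg _)) |>.2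
  rw [mul_pow, EuclideanSpace.norm_sq_eq, EuclideanSpace.norm_sq_eq]
  have h1 : ∀ k, (Matrix.toEuclideanCLM (𝕜 := ℂ) (compr b A Λ) v) k =
      inner ℂ (b k) (A (spread b v.ofLp)) := fun k => compr_mulVec b A v.ofLp k
  calc _ = ∑ k : Λ, ‖(inner ℂ (b k) (A (spread b v.ofLp)) : ℂ)‖ ^ 2 := by
        refine Finset.sum_congr rfl fun k _ => ?_
        rw [← h1]
        rfl
    _ ≤ ‖A (spread b v.ofLp)‖ ^ 2 := sum_norm_inner_le b Λ _
    _ ≤ (‖A‖ * ‖spread b v.ofLp‖) ^ 2 :=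
        pow_le_pow_left₀ (norm_nonneg _) (A.le_opNorm _) 2
    _ = ‖A‖ ^ 2 * ∑ k, ‖v.ofLp k‖ ^ 2 := by rw [mul_pow, norm_spread_sq]

/-- The defect of multiplicativity of compressions. -/
theorem hsNorm_compr_mul_sub_sq_le (A B : H →L[ℂ] H) (Λ : Finset ι) :
    hsNorm (compr b (A * B) Λ - compr b A Λ * compr b B Λ) ^ 2 ≤
      ‖A‖ ^ 2 * ∑ l : Λ, (‖B (b l)‖ ^ 2 - ∑ k : Λ, ‖(inner ℂ (b k) (B (b l)) : ℂ)‖ ^ 2) := by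
  rw [hsNorm_sq, Finset.mul_sum]
  refine Finset.sum_le_sum fun l _ => ?_
  set v : Λ → ℂ := fun k => inner ℂ (b k) (B (b l)) with hv
  -- Column l of the defect holds coefficients of A applied to the component of B b_l orthogonal to
  -- the span. Pythagoras measures this component, and Bessel bounds the column.
  have h1 : ∀ k, (compr b (A * B) Λ - compr b A Λ * compr b B Λ) k l =
      inner ℂ (b k) (A (B (b l) - spread b v)) := fun k => by
    rw [map_sub, inner_sub_right, ← compr_mulVec]
    rfl
  have h2 : inner ℂ (spread b v) (B (b l) - spread b v) = 0 := by
    rw [spread, sum_inner]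
    refine Finset.sum_eq_zero fun k _ => ?_
    have hb : Orthonormal ℂ (fun k : Λ => b k) := b.orthonormal.comp _ Subtype.val_injective
    rw [inner_smul_left, inner_sub_right, hb.inner_right_fintype v k, sub_self, mul_zero]
  have h3 : ‖B (b l)‖ ^ 2 = ‖spread b v‖ ^ 2 + ‖B (b l) - spread b v‖ ^ 2 := by
    have := norm_add_sq_eq_norm_sq_add_norm_sq_of_inner_eq_zero (𝕜 := ℂ) _ _ h2
    rw [add_sub_cancel] at this
    simpa [sq] using this
  rw [h3, norm_spread_sq, add_sub_cancel_left, ← mul_pow]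
  simp only [h1]
  exact (sum_norm_inner_le b Λ _).trans (pow_le_pow_left₀ (norm_nonneg _) (A.le_opNorm _) 2)

theorem star_dotProduct_compr (A : H →L[ℂ] H) {Λ : Finset ι} (v : Λ → ℂ) :
    star v ⬝ᵥ (compr b A Λ *ᵥ v) = inner ℂ (spread b v) (A (spread b v)) := by
  conv_rhs => rw [spread, sum_inner]
  refine Finset.sum_congr rfl fun k _ => ?_
  rw [compr_mulVec, inner_smul_left]
  rfl

end Compression

/-! ### Counting pairs of lattice points in a box by their difference. -/

section Boxes

variable {ν : ℕ}

theorem mem_box {n : ℕ} {k : IntLattice ν} :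
    k ∈ box ν n ↔ ∀ i, 0 ≤ ofLex k i ∧ ofLex k i < n := by
  simp only [box, Finset.mem_map, Fintype.mem_piFinset, Finset.mem_Ico]
  constructor
  · rintro ⟨x, hx, rfl⟩
    exact hx
  · exact fun h => ⟨ofLex k, h, rfl⟩

theorem card_box (n : ℕ) : (box ν n).card = n ^ ν := by
  simp [box, Fintype.card_piFinset]

/-- In each coordinate the box and its translate meet in an interval with at least n - |j_i| points.
-/
theorem le_card_box_inter_shift (n : ℕ) (j : IntLattice ν) (hj : ∀ i, |ofLex j i| ≤ n) :
    ∏ i, ((n : ℝ) - |(ofLex j i : ℝ)|) ≤ ((box ν n).filter fun l => j + l ∈ box ν n).card := by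
  have h1 : ((Fintype.piFinset fun i => Finset.Ico (max 0 (-ofLex j i))
      (min (n : ℤ) (n - ofLex j i))).map toLex.toEmbedding : Finset (IntLattice ν)) ⊆
      (box ν n).filter fun l => j + l ∈ box ν n := by
    intro l hl
    obtain ⟨x, hx, rfl⟩ := Finset.mem_map.mp hl
    rw [Fintype.mem_piFinset] at hx
    rw [Finset.mem_filter, mem_box, mem_box]
    have h2 : ∀ i, ofLex (toLex x) i = x i := fun i => rfl
    have h3 : ∀ i, ofLex (j + toLex x) i = ofLex j i + x i := fun i => rfl
    refine ⟨fun i => ?_, fun i => ?_⟩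
    · have := Finset.mem_Ico.mp (hx i)
      change 0 ≤ x i ∧ x i < n
      omega
    · have := Finset.mem_Ico.mp (hx i)
      change 0 ≤ ofLex j i + x i ∧ ofLex j i + x i < n
      omega
  refine le_trans ?_ (Nat.cast_le.mpr (Finset.card_le_card h1))
  rw [Finset.card_map, Fintype.card_piFinset, Nat.cast_prod]
  refine Finset.prod_le_prod (fun i _ => ?_) fun i _ => ?_
  · have := hj i
    have h4 : (|ofLex j i| : ℝ) ≤ n := by exact_mod_cast this
    linarith
  · rw [Int.card_Ico]
    have : (n : ℤ) - |ofLex j i| ≤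
        ((min (n : ℤ) (n - ofLex j i) - max 0 (-ofLex j i)).toNat : ℤ) := by
      rcases abs_cases (ofLex j i) with h | h <;> omega
    exact_mod_cast this

theorem sum_shift_le {w : IntLattice ν → ℝ} (hw : ∀ j, 0 ≤ w j) {W : ℝ} (hW : HasSum w W)
    (s : Finset (IntLattice ν)) (l : IntLattice ν) : ∑ k ∈ s, w (k - l) ≤ W := by
  have h : HasSum (fun k => w (k - l)) W := (Equiv.subRight l).hasSum_iff.mpr hW
  exact sum_le_hasSum s (fun k _ => hw _) h

theorem le_sum_box_shift {w : IntLattice ν → ℝ} (hw : ∀ j, 0 ≤ w j) (n : ℕ)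
    (J : Finset (IntLattice ν)) :
    ∑ j ∈ J, w j * ((box ν n).filter fun l => j + l ∈ box ν n).card ≤
      ∑ l ∈ box ν n, ∑ k ∈ box ν n, w (k - l) := by
  have h1 : ∀ j ∈ J, w j * ((box ν n).filter fun l => j + l ∈ box ν n).card =
      ∑ l ∈ box ν n, if j + l ∈ box ν n then w j else 0 := fun j _ => by
    rw [← Finset.sum_filter, Finset.sum_const, nsmul_eq_mul, mul_comm]
  rw [Finset.sum_congr rfl h1, Finset.sum_comm]
  refine Finset.sum_le_sum fun l _ => ?_
  rw [← Finset.sum_filter]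
  have h2 : ∑ j ∈ J.filter (fun j => j + l ∈ box ν n), w j =
      ∑ k ∈ (J.filter (fun j => j + l ∈ box ν n)).map (addRightEmbedding l), w (k - l) := by
    simp
  rw [h2]
  refine Finset.sum_le_sum_of_subset_of_nonneg ?_ fun k _ _ => hw _
  intro k hk
  obtain ⟨j, hj, rfl⟩ := Finset.mem_map.mp hk
  exact (Finset.mem_filter.mp hj).2

/-- A fixed difference j occurs for a fraction of the base points tending to 1, so any finite part
of the sum is recovered. Conversely, the sum over k for one fixed l never exceeds W. -/
theorem tendsto_sum_box_shift {w : IntLattice ν → ℝ} (hw : ∀ j, 0 ≤ w j) {W : ℝ}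
    (hW : HasSum w W) :
    Tendsto (fun n : ℕ => (∑ l ∈ box ν n, ∑ k ∈ box ν n, w (k - l)) / (n : ℝ) ^ ν)
      atTop (𝓝 W) := by
  refine tendsto_order.mpr ⟨fun a ha => ?_, fun a ha => ?_⟩
  · obtain ⟨J, hJ⟩ := ((tendsto_order.mp hW).1 a ha).exists
    have h1 : Tendsto (fun n : ℕ => ∑ j ∈ J, w j * ∏ i, (1 - |(ofLex j i : ℝ)| / n)) atTop
        (𝓝 (∑ j ∈ J, w j)) := by
      refine tendsto_finsetSum _ fun j _ => ?_
      have h2 : Tendsto (fun n : ℕ => ∏ i, (1 - |(ofLex j i : ℝ)| / n)) atTop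
          (𝓝 (∏ _i : Fin ν, (1 - 0))) :=
        tendsto_finsetProd _ fun i _ => tendsto_const_nhds.sub
          (tendsto_const_nhds.div_atTop tendsto_natCast_atTop_atTop)
      simpa using h2.const_mul (w j)
    have h3 : ∀ᶠ n : ℕ in atTop, ∀ j ∈ J, ∀ i, |ofLex j i| ≤ n := by
      refine (Finset.eventually_all J).mpr fun j _ => eventually_all.mpr fun i => ?_
      filter_upwards [eventually_ge_atTop (ofLex j i).natAbs] with n hn
      rw [Int.abs_eq_natAbs]
      exact_mod_cast hn
    filter_upwards [(tendsto_order.mp h1).1 a hJ, h3, eventually_gt_atTop 0] with n hn1 hn2 hn3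
    refine hn1.trans_le ?_
    have hn : (0 : ℝ) < n := Nat.cast_pos.mpr hn3
    rw [le_div_iff₀ (pow_pos hn ν), Finset.sum_mul]
    refine le_trans (Finset.sum_le_sum fun j hj => ?_) (le_sum_box_shift hw n J)
    rw [mul_assoc]
    refine mul_le_mul_of_nonneg_left (le_trans (le_of_eq ?_)
      (le_card_box_inter_shift n j (hn2 j hj))) (hw j)
    have h4 : (n : ℝ) ^ ν = ∏ _i : Fin ν, (n : ℝ) := by simp
    rw [h4, ← Finset.prod_mul_distrib]
    refine Finset.prod_congr rfl fun i _ => ?_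
    rw [sub_mul, one_mul, div_mul_cancel₀ _ hn.ne']
  · have hW0 : 0 ≤ W := hW.nonneg hw
    refine Eventually.of_forall fun n => lt_of_le_of_lt ?_ ha
    refine div_le_of_le_mul₀ (by positivity) hW0 ?_
    refine (Finset.sum_le_sum fun l _ => sum_shift_le hw hW (box ν n) l).trans (le_of_eq ?_)
    rw [Finset.sum_const, card_box, nsmul_eq_mul, mul_comm]
    push_cast
    rfl

end Boxes

/-! ### Asymptotic symbol calculus for matrices on boxes. -/

section Symbols

open scoped Matrix.Norms.L2Operator

variable {ν : ℕ}

/-- Continuity holds only on the interval, so f is first extended from it to a continuous function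
on the line; this changes the composition on a null set only. -/
theorem aemeasurable_comp_of_continuousOn {a : (Fin ν → ℝ) → ℝ}
    (ha : AEMeasurable a (cubeMeasure ν)) {x y : ℝ} (hxy : x ≤ y)
    (ha' : ∀ᵐ t ∂cubeMeasure ν, a t ∈ Set.Icc x y) {f : ℝ → ℝ}
    (hf : ContinuousOn f (Set.Icc x y)) : AEMeasurable (fun t => f (a t)) (cubeMeasure ν) := by
  have h1 : AEMeasurable (fun t => Set.IccExtend hxy ((Set.Icc x y).domRestrict f) (a t))
      (cubeMeasure ν) :=
    (continuousOn_iff_continuous_domRestrict.mp hf).Icc_extend'.measurable.comp_aemeasurable ha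
  refine h1.congr ?_
  filter_upwards [ha'] with t ht
  rw [Set.IccExtend_of_mem _ _ ht, Set.domRestrict_apply]

/-- The entries depend on l - k only: compressions of multiplication operators are Toeplitz. -/
theorem inner_wave_mulOp {a : (Fin ν → ℝ) → ℝ} {A : CubeL2 ν →L[ℂ] CubeL2 ν} (hA : IsMulOp a A)
    (k l : IntLattice ν) : inner ℂ (waveBasis ν k) (A (waveBasis ν l)) =
      (((2 * Real.pi) ^ ν)⁻¹ : ℝ) * ∫ t, planeWave (l - k) t * a t ∂cubeMeasure ν := by
  rw [waveBasis_apply, waveBasis_apply, inner_wave, ← waveNorm_mul_self, Complex.ofReal_mul,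
    mul_assoc]
  congr 1
  rw [← integral_const_mul]
  refine integral_congr_ae ?_
  filter_upwards [hA (wave l), coeFn_wave l] with t h1 h2
  rw [h1, h2, sub_eq_add_neg, planeWave_add]
  ring

theorem hasSum_norm_inner_sq {H ι : Type*} [NormedAddCommGroup H] [InnerProductSpace ℂ H]
    [CompleteSpace H] (b : HilbertBasis ι ℂ H) (x : H) :
    HasSum (fun k => ‖(inner ℂ (b k) x : ℂ)‖ ^ 2) (‖x‖ ^ 2) := by
  have h := Complex.hasSum_re (b.hasSum_inner_mul_inner x x)
  have h1 : (inner ℂ x x : ℂ).re = ‖x‖ ^ 2 := by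
    rw [inner_self_eq_norm_sq_to_K]; norm_cast
  have h2 : ∀ k, (inner ℂ x (b k) * inner ℂ (b k) x : ℂ).re = ‖(inner ℂ (b k) x : ℂ)‖ ^ 2 := by
    intro k
    rw [← inner_conj_symm x (b k), mul_comm, Complex.mul_conj, Complex.normSq_eq_norm_sq,
      Complex.ofReal_re]
  simpa only [h1, h2] using h

/-- The matrices `M n` on the boxes have bounded norm, and they are close to the compressions of
the operator of multiplication by `a`, in the normalized Hilbert–Schmidt norm. -/
def HasSymbol (M : ∀ n, Matrix (box ν n) (box ν n) ℂ) (a : (Fin ν → ℝ) → ℝ) : Prop :=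
  (∃ C, ∀ n, ‖M n‖ ≤ C) ∧ ∃ A, IsMulOp a A ∧
    Tendsto (fun n : ℕ => hsNorm (M n - compr (waveBasis ν) A (box ν n)) / √((n : ℝ) ^ ν))
      atTop (𝓝 0)

/-- The squared defect per site is at most ‖A‖² times the average over l of the mass of B b_l
outside the box. By translation invariance that mass has total W and is distributed by k - l, so the
average tends to zero by `tendsto_sum_box_shift`. Only B has to be a multiplication operator. -/
theorem tendsto_hsNorm_compr_mul {a : (Fin ν → ℝ) → ℝ} (A : CubeL2 ν →L[ℂ] CubeL2 ν)
    {B : CubeL2 ν →L[ℂ] CubeL2 ν} (hB : IsMulOp a B) :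
    Tendsto (fun n : ℕ => hsNorm (compr (waveBasis ν) (A * B) (box ν n) -
      compr (waveBasis ν) A (box ν n) * compr (waveBasis ν) B (box ν n)) / √((n : ℝ) ^ ν))
      atTop (𝓝 0) := by
  set b := waveBasis ν
  set w : IntLattice ν → ℝ := fun j => ‖(inner ℂ (b j) (B (b 0)) : ℂ)‖ ^ 2 with hwdef
  set W := ‖B (b 0)‖ ^ 2
  have hw : ∀ j, 0 ≤ w j := fun j => by positivity
  have hW : HasSum w W := hasSum_norm_inner_sq b _
  have hshift : ∀ k l, ‖(inner ℂ (b k) (B (b l)) : ℂ)‖ ^ 2 = w (k - l) := fun k l => by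
    rw [hwdef, inner_wave_mulOp hB]
    simp only [b]
    rw [inner_wave_mulOp hB, zero_sub, neg_sub]
  have hnorm : ∀ l, ‖B (b l)‖ ^ 2 = W := fun l => by
    refine (hasSum_norm_inner_sq b (B (b l))).unique ?_
    simp only [hshift]
    exact (Equiv.subRight l).hasSum_iff.mpr hW
  have hbound : ∀ᶠ n : ℕ in atTop, (hsNorm (compr b (A * B) (box ν n) -
      compr b A (box ν n) * compr b B (box ν n)) / √((n : ℝ) ^ ν)) ^ 2 ≤
      ‖A‖ ^ 2 * (W - (∑ l ∈ box ν n, ∑ k ∈ box ν n, w (k - l)) / (n : ℝ) ^ ν) := by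
    filter_upwards [eventually_gt_atTop 0] with n hn
    have hn' : (0 : ℝ) < (n : ℝ) ^ ν := pow_pos (Nat.cast_pos.mpr hn) ν
    rw [div_pow, Real.sq_sqrt hn'.le, div_le_iff₀ hn']
    refine (hsNorm_compr_mul_sub_sq_le b A B (box ν n)).trans (le_of_eq ?_)
    simp only [hnorm, hshift]
    have h1 : ∀ l : IntLattice ν, ∑ k : box ν n, w (k - l) = ∑ k ∈ box ν n, w (k - l) :=
      fun l => Finset.sum_coe_sort (box ν n) fun k => w (k - l)
    simp only [h1]
    rw [Finset.sum_coe_sort (box ν n) fun l => W - ∑ k ∈ box ν n, w (k - l),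
      Finset.sum_sub_distrib, Finset.sum_const, card_box, nsmul_eq_mul, mul_assoc, sub_mul,
      div_mul_cancel₀ _ hn'.ne']
    push_cast
    ring
  have hlim : Tendsto (fun n : ℕ => ‖A‖ ^ 2 *
      (W - (∑ l ∈ box ν n, ∑ k ∈ box ν n, w (k - l)) / (n : ℝ) ^ ν)) atTop (𝓝 0) := by
    have := ((tendsto_const_nhds (x := W)).sub (tendsto_sum_box_shift hw hW)).const_mul (‖A‖ ^ 2)
    simpa using this
  have hsq := squeeze_zero' (Eventually.of_forall fun n => by positivity) hbound hlim
  have := hsq.sqrt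
  rw [Real.sqrt_zero] at this
  refine this.congr fun n => ?_
  exact Real.sqrt_sq (div_nonneg (hsNorm_nonneg _) (Real.sqrt_nonneg _))

theorem IsMulOp.mul {a b : (Fin ν → ℝ) → ℝ} {A B : CubeL2 ν →L[ℂ] CubeL2 ν} (hA : IsMulOp a A)
    (hB : IsMulOp b B) : IsMulOp (fun t => a t * b t) (A * B) := fun x => by
  filter_upwards [hA (B x), hB x] with t h1 h2
  rw [mul_apply_eq_comp, h1, h2]
  push_cast
  ring

theorem IsMulOp.add {a b : (Fin ν → ℝ) → ℝ} {A B : CubeL2 ν →L[ℂ] CubeL2 ν} (hA : IsMulOp a A)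
    (hB : IsMulOp b B) : IsMulOp (fun t => a t + b t) (A + B) := fun x => by
  filter_upwards [hA x, hB x, Lp.coeFn_add (A x) (B x)] with t h1 h2 h3
  rw [add_apply, h3, Pi.add_apply, h1, h2]
  push_cast
  ring

theorem IsMulOp.sub {a b : (Fin ν → ℝ) → ℝ} {A B : CubeL2 ν →L[ℂ] CubeL2 ν} (hA : IsMulOp a A)
    (hB : IsMulOp b B) : IsMulOp (fun t => a t - b t) (A - B) := fun x => by
  filter_upwards [hA x, hB x, Lp.coeFn_sub (A x) (B x)] with t h1 h2 h3
  rw [sub_apply, h3, Pi.sub_apply, h1, h2]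
  push_cast
  ring

theorem isMulOp_const (z : ℝ) : IsMulOp (ν := ν) (fun _ => z) ((z : ℂ) • 1) := fun x => by
  filter_upwards [Lp.coeFn_smul (z : ℂ) x] with t h1
  rw [smul_apply, one_apply_eq_self, h1]
  rfl

theorem IsMulOp.norm_le {a : (Fin ν → ℝ) → ℝ} {A : CubeL2 ν →L[ℂ] CubeL2 ν} (hA : IsMulOp a A)
    {C : ℝ} (hC : 0 ≤ C) (haC : ∀ᵐ t ∂cubeMeasure ν, |a t| ≤ C) : ‖A‖ ≤ C := by
  refine ContinuousLinearMap.opNorm_le_bound _ hC fun x => Lp.norm_le_mul_norm_of_ae_le_mul ?_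
  filter_upwards [hA x, haC] with t h1 h2
  rw [h1, norm_mul, Complex.norm_real, Real.norm_eq_abs]
  exact mul_le_mul_of_nonneg_right h2 (norm_nonneg _)

theorem hasSymbol_compr {a : (Fin ν → ℝ) → ℝ} {A : CubeL2 ν →L[ℂ] CubeL2 ν} (hA : IsMulOp a A) :
    HasSymbol (fun n => compr (waveBasis ν) A (box ν n)) a :=
  ⟨⟨‖A‖, fun n => norm_compr_le _ A _⟩, A, hA, by simp [hsNorm_zero]⟩

theorem hasSymbol_const (z : ℝ) : HasSymbol (ν := ν) (fun _ => (z : ℂ) • 1) fun _ => z := by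
  have h := hasSymbol_compr (isMulOp_const (ν := ν) z)
  simpa only [compr_smul, compr_one] using h

namespace HasSymbol

variable {M N : ∀ n, Matrix (box ν n) (box ν n) ℂ} {a b : (Fin ν → ℝ) → ℝ}

theorem add (hM : HasSymbol M a) (hN : HasSymbol N b) :
    HasSymbol (fun n => M n + N n) fun t => a t + b t := by
  obtain ⟨⟨C, hC⟩, A, hA, hMA⟩ := hM
  obtain ⟨⟨D, hD⟩, B, hB, hNB⟩ := hN
  refine ⟨⟨C + D, fun n => (norm_add_le _ _).trans (add_le_add (hC n) (hD n))⟩, A + B,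
    hA.add hB, ?_⟩
  have h := hMA.add hNB
  rw [add_zero] at h
  refine squeeze_zero (fun n => div_nonneg (hsNorm_nonneg _) (Real.sqrt_nonneg _)) (fun n => ?_) h
  rw [← add_div, compr_add, add_sub_add_comm]
  exact div_le_div_of_nonneg_right (hsNorm_add_le _ _) (Real.sqrt_nonneg _)

theorem mul (hM : HasSymbol M a) (hN : HasSymbol N b) :
    HasSymbol (fun n => M n * N n) fun t => a t * b t := by
  obtain ⟨⟨C, hC⟩, A, hA, hMA⟩ := hM
  obtain ⟨⟨D, hD⟩, B, hB, hNB⟩ := hN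
  have hC0 : 0 ≤ C := (norm_nonneg _).trans (hC 0)
  refine ⟨⟨C * D, fun n => (norm_mul_le _ _).trans
    (mul_le_mul (hC n) (hD n) (norm_nonneg _) hC0)⟩, A * B, hA.mul hB, ?_⟩
  have h := ((hMA.mul_const D).add (hNB.const_mul ‖A‖)).add (tendsto_hsNorm_compr_mul A hB)
  simp only [zero_mul, mul_zero, add_zero] at h
  refine squeeze_zero (fun n => div_nonneg (hsNorm_nonneg _) (Real.sqrt_nonneg _)) (fun n => ?_) h
  rw [div_mul_eq_mul_div, ← mul_div_assoc, ← add_div, ← add_div]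
  refine div_le_div_of_nonneg_right ?_ (Real.sqrt_nonneg _)
  set cA := compr (waveBasis ν) A (box ν n)
  set cB := compr (waveBasis ν) B (box ν n)
  set cAB := compr (waveBasis ν) (A * B) (box ν n)
  -- Telescoping: one operator norm stays bounded in each of the first two terms, and the third is
  -- the defect of multiplicativity.
  have h1 : M n * N n - cAB = (M n - cA) * N n + cA * (N n - cB) + (-1 : ℂ) • (cAB - cA * cB) := by
    rw [Matrix.sub_mul, Matrix.mul_sub, neg_one_smul]
    abel
  rw [h1]
  refine (hsNorm_add_le _ _).trans (add_le_add ((hsNorm_add_le _ _).trans (add_le_add ?_ ?_)) ?_)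
  · exact (hsNorm_mul_le' _ _).trans (mul_le_mul_of_nonneg_left (hD n) (hsNorm_nonneg _))
  · exact (hsNorm_mul_le _ _).trans
      (mul_le_mul_of_nonneg_right (norm_compr_le _ A _) (hsNorm_nonneg _))
  · rw [hsNorm_smul]
    simp

theorem aeval (hM : HasSymbol M a) (p : Polynomial ℝ) :
    HasSymbol (fun n => Polynomial.aeval (M n) p) fun t => p.eval (a t) := by
  induction p using Polynomial.induction_on with
  | C z =>
    have h := hasSymbol_const (ν := ν) z
    simpa only [Polynomial.aeval_C, Polynomial.eval_C, Algebra.algebraMap_eq_smul_one,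
      Complex.coe_smul] using h
  | add p q hp hq => simpa only [map_add, Polynomial.eval_add] using hp.add hq
  | monomial n z ih =>
    have h := ih.mul hM
    simp only [pow_succ, ← mul_assoc, map_mul, Polynomial.aeval_X, Polynomial.eval_mul,
      Polynomial.eval_X] at h ⊢
    exact h

/-- The Toeplitz compression has constant diagonal equal to the mean of a, so its normalized trace
is exact. The remaining error is at most the normalized Hilbert–Schmidt distance. -/
theorem tendsto_trace (hM : HasSymbol M a) :
    Tendsto (fun n : ℕ => (M n).trace.re / (n : ℝ) ^ ν) atTop
      (𝓝 (1 / (2 * Real.pi) ^ ν * ∫ t, a t ∂cubeMeasure ν)) := by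
  obtain ⟨-, A, hA, hMA⟩ := hM
  set z : ℝ := 1 / (2 * Real.pi) ^ ν * ∫ t, a t ∂cubeMeasure ν with hz
  have h1 : ∀ n, (compr (waveBasis ν) A (box ν n)).trace = ((n : ℝ) ^ ν * z : ℝ) := fun n => by
    have h2 : ∀ k : box ν n, (compr (waveBasis ν) A (box ν n)).diag k = (z : ℂ) := fun k => by
      rw [Matrix.diag_apply, compr, Matrix.of_apply, inner_wave_mulOp hA, sub_self, hz,
        Complex.ofReal_mul, ← integral_complex_ofReal, one_div]
      congr 2
      ext t
      simp [planeWave, show ∀ i, ofLex (0 : IntLattice ν) i = 0 from fun _ => rfl,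
        -Pi.ofLex_apply]
    rw [Matrix.trace, Finset.sum_congr rfl fun k _ => h2 k, Finset.sum_const, Finset.card_univ,
      Fintype.card_coe, card_box]
    push_cast
    simp
  refine tendsto_iff_norm_sub_tendsto_zero.mpr
    (squeeze_zero' (Eventually.of_forall fun n => norm_nonneg _) ?_ hMA)
  filter_upwards [eventually_gt_atTop 0] with n hn
  have hn' : (0 : ℝ) < (n : ℝ) ^ ν := pow_pos (Nat.cast_pos.mpr hn) ν
  have h3 := norm_trace_le (M n - compr (waveBasis ν) A (box ν n))
  rw [Fintype.card_coe, card_box, Matrix.trace_sub, h1] at h3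
  have h4 : (M n).trace.re / (n : ℝ) ^ ν - z =
      ((M n).trace - ((n : ℝ) ^ ν * z : ℝ)).re / (n : ℝ) ^ ν := by
    rw [Complex.sub_re, Complex.ofReal_re]
    field_simp
  rw [h4, norm_div, Real.norm_of_nonneg hn'.le, div_le_div_iff₀ hn' (Real.sqrt_pos.mpr hn')]
  have h5 := (Complex.abs_re_le_norm _).trans h3
  push_cast at h5
  calc _ ≤ (√((n : ℝ) ^ ν) * hsNorm (M n - compr (waveBasis ν) A (box ν n))) * √((n : ℝ) ^ ν) :=
        mul_le_mul_of_nonneg_right (by rw [Real.norm_eq_abs]; push_cast; exact h5)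
          (Real.sqrt_nonneg _)
    _ = _ := by
        rw [mul_comm (√((n : ℝ) ^ ν)), mul_assoc, Real.mul_self_sqrt hn'.le]

end HasSymbol

/-- A Hermitian matrix with eigenvalues in `s`. -/
def HasEigenvaluesIn {m : Type*} [Fintype m] [DecidableEq m] (s : Set ℝ) (A : Matrix m m ℂ) :
    Prop :=
  ∃ (U : Matrix m m ℂ) (d : m → ℝ), Uᴴ * U = 1 ∧ (∀ k, d k ∈ s) ∧ A = conjDiag U d

namespace HasSymbol

variable {M : ∀ n, Matrix (box ν n) (box ν n) ℂ} {a : (Fin ν → ℝ) → ℝ}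

theorem cfc (hM : HasSymbol M a) {x y : ℝ} (hxy : x ≤ y)
    (hM' : ∀ n, HasEigenvaluesIn (Set.Icc x y) (M n)) (ha : AEMeasurable a (cubeMeasure ν))
    (ha' : ∀ᵐ t ∂cubeMeasure ν, a t ∈ Set.Icc x y) {f : ℝ → ℝ} (hf : ContinuousOn f (Set.Icc x y)) :
    HasSymbol (fun n => _root_.cfc f (M n)) fun t => f (a t) := by
  obtain ⟨C, hC⟩ := isCompact_Icc.exists_bound_of_continuousOn hf
  have hC0 : 0 ≤ C := (norm_nonneg _).trans (hC x ⟨le_rfl, hxy⟩)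
  have hfa : AEMeasurable (fun t => f (a t)) (cubeMeasure ν) :=
    aemeasurable_comp_of_continuousOn ha hxy ha' hf
  obtain ⟨F, hF, -⟩ := exists_isMulOp hfa hC0 (by filter_upwards [ha'] with t ht using hC _ ht)
  refine ⟨⟨C, fun n => ?_⟩, F, hF, ?_⟩
  · obtain ⟨U, d, hU, hd, hMn⟩ := hM' n
    simp only [hMn, cfc_conjDiag hU]
    exact norm_conjDiag_le hU hC0 fun k => hC _ (hd k)
  rw [Metric.tendsto_nhds]
  intro ε hε
  -- Three errors of size ε/4 occur: f against p on the matrices, p of the matrices against the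
  -- compression of its symbol, and p against f on the multiplication operators.
  obtain ⟨p, hp⟩ := exists_polynomial_near_of_continuousOn x y f hf (ε / 4) (by positivity)
  obtain ⟨-, A, hA, hMA⟩ := hM.aeval p
  have hFA : ‖A - F‖ ≤ ε / 4 := by
    refine (hA.sub hF).norm_le (by positivity) ?_
    filter_upwards [ha'] with t ht using (hp _ ht).le
  filter_upwards [(Metric.tendsto_nhds.mp hMA) (ε / 4) (by positivity), eventually_gt_atTop 0]
    with n hn hn0
  have hn' : (0 : ℝ) < (n : ℝ) ^ ν := pow_pos (Nat.cast_pos.mpr hn0) ν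
  have hs : 0 < √((n : ℝ) ^ ν) := Real.sqrt_pos.mpr hn'
  rw [Real.dist_eq, sub_zero, abs_of_nonneg (div_nonneg (hsNorm_nonneg _) hs.le),
    div_lt_iff₀ hs] at hn ⊢
  set cA := compr (waveBasis ν) A (box ν n)
  set cF := compr (waveBasis ν) F (box ν n)
  have hcard : (Fintype.card (box ν n) : ℝ) = (n : ℝ) ^ ν := by
    rw [Fintype.card_coe, card_box]; push_cast; rfl
  have h1 : hsNorm (_root_.cfc f (M n) - Polynomial.aeval (M n) p) ≤ ε / 4 * √((n : ℝ) ^ ν) := by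
    obtain ⟨U, d, hU, hd, hMn⟩ := hM' n
    have h2 : _root_.cfc f (M n) - Polynomial.aeval (M n) p =
        conjDiag U fun k => f (d k) - p.eval (d k) := by
      rw [hMn, cfc_conjDiag hU, aeval_conjDiag hU, sub_eq_iff_eq_add, ← conjDiag_add]
      congr 1
      ext k
      simp
    rw [h2, ← hcard]
    refine (hsNorm_le _).trans (mul_le_mul_of_nonneg_right ?_ (Real.sqrt_nonneg _))
    refine norm_conjDiag_le hU (by positivity) fun k => ?_
    rw [abs_sub_comm]
    exact (hp _ (hd k)).le
  have h3 : hsNorm (cA - cF) ≤ ε / 4 * √((n : ℝ) ^ ν) := by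
    have h4 : cA - cF = compr (waveBasis ν) (A - F) (box ν n) := by
      ext k l
      simp [cA, cF, compr]
    rw [h4, ← hcard]
    exact (hsNorm_le _).trans (mul_le_mul_of_nonneg_right
      ((norm_compr_le _ _ _).trans hFA) (Real.sqrt_nonneg _))
  have h5 : _root_.cfc f (M n) - cF = (_root_.cfc f (M n) - Polynomial.aeval (M n) p) +
      (Polynomial.aeval (M n) p - cA) + (cA - cF) := by abel
  rw [h5]
  have h6 := hsNorm_add_le (_root_.cfc f (M n) - Polynomial.aeval (M n) p +
      (Polynomial.aeval (M n) p - cA)) (cA - cF)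
  have h7 := hsNorm_add_le (_root_.cfc f (M n) - Polynomial.aeval (M n) p)
      (Polynomial.aeval (M n) p - cA)
  nlinarith

end HasSymbol

end Symbols

/-! ### Spectral bounds for compressions, and the passage between ℓ² and L². -/

section Spectra

variable {ν : ℕ}

theorem IsMulOp.inner_left {a : (Fin ν → ℝ) → ℝ} {A : CubeL2 ν →L[ℂ] CubeL2 ν} (hA : IsMulOp a A)
    (x y : CubeL2 ν) : inner ℂ (A x) y = inner ℂ x (A y) := by
  rw [L2.inner_def, L2.inner_def]
  refine integral_congr_ae ?_
  filter_upwards [hA x, hA y] with t h1 h2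
  rw [h1, h2, RCLike.inner_apply, RCLike.inner_apply, map_mul, Complex.conj_ofReal]
  ring

theorem IsMulOp.re_inner_nonneg {a : (Fin ν → ℝ) → ℝ} {A : CubeL2 ν →L[ℂ] CubeL2 ν}
    (hA : IsMulOp a A) (ha : ∀ᵐ t ∂cubeMeasure ν, 0 ≤ a t) (x : CubeL2 ν) :
    0 ≤ (inner ℂ x (A x) : ℂ).re := by
  rw [L2.inner_def]
  have h : ∫ t, inner ℂ (x t) (A x t) ∂cubeMeasure ν =
      ∫ t, ((a t * ‖x t‖ ^ 2 : ℝ) : ℂ) ∂cubeMeasure ν := by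
    refine integral_congr_ae ?_
    filter_upwards [hA x] with t h1
    rw [h1, RCLike.inner_apply, mul_assoc, RCLike.mul_conj]
    push_cast
    rfl
  rw [h, integral_complex_ofReal, Complex.ofReal_re]
  refine integral_nonneg_of_ae ?_
  filter_upwards [ha] with t ht
  positivity

/-- Each eigenvalue is a Rayleigh quotient of A at a unit vector, hence confined by the bounds on a.
-/
theorem IsMulOp.hasEigenvaluesIn {a : (Fin ν → ℝ) → ℝ} {A : CubeL2 ν →L[ℂ] CubeL2 ν}
    (hA : IsMulOp a A) {x y : ℝ} (ha : ∀ᵐ t ∂cubeMeasure ν, a t ∈ Set.Icc x y)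
    (Λ : Finset (IntLattice ν)) : HasEigenvaluesIn (Set.Icc x y) (compr (waveBasis ν) A Λ) := by
  have hH : (compr (waveBasis ν) A Λ).IsHermitian := by
    ext k l
    rw [Matrix.conjTranspose_apply, compr, Matrix.of_apply, Matrix.of_apply, ← hA.inner_left]
    exact inner_conj_symm _ _
  obtain ⟨U, hU, h⟩ := exists_conjDiag hH
  refine ⟨U, _, hU, fun i => ?_, h⟩
  set v : Λ → ℂ := (hH.eigenvectorBasis i).ofLp
  set z := spread (waveBasis ν) v
  have hz : ‖z‖ ^ 2 = 1 := by
    rw [norm_spread_sq, ← EuclideanSpace.norm_sq_eq, hH.eigenvectorBasis.orthonormal.1 i, one_pow]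
  have h1 : hH.eigenvalues i = (inner ℂ z (A z) : ℂ).re := by
    rw [hH.eigenvalues_eq, star_dotProduct_compr]
    rfl
  have hin : (inner ℂ z z : ℂ).re = 1 := by
    rw [inner_self_eq_norm_sq_to_K, ← hz]; norm_cast
  have hx : 0 ≤ (inner ℂ z ((A - (x : ℂ) • 1 : CubeL2 ν →L[ℂ] CubeL2 ν) z) : ℂ).re :=
    (hA.sub (isMulOp_const x)).re_inner_nonneg
      (by filter_upwards [ha] with t ht using sub_nonneg.mpr ht.1) z
  have hy : 0 ≤ (inner ℂ z (((y : ℂ) • 1 - A : CubeL2 ν →L[ℂ] CubeL2 ν) z) : ℂ).re :=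
    ((isMulOp_const y).sub hA).re_inner_nonneg
      (by filter_upwards [ha] with t ht using sub_nonneg.mpr ht.2) z
  rw [sub_apply, inner_sub_right, smul_apply, one_apply_eq_self, inner_smul_right, Complex.sub_re,
    Complex.re_ofReal_mul, hin, mul_one] at hx hy
  rw [h1]
  exact ⟨by linarith, by linarith⟩

theorem inner_lp_single {X : Type*} (inst : DecidableEq X) (k : X) (f : OneParticle X) :
    inner ℂ (lp.single 2 k (1 : ℂ) : OneParticle X) f = f k := by
  rw [lp.inner_single_left]
  simp

/-- Normalized, F becomes the isometry of the wave basis and carries Q to multiplication by q. The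
decidability instance is left free because `lp.single` depends on it. -/
theorem HasFourierSymbol.inner_single (inst : DecidableEq (IntLattice ν)) {q : (Fin ν → ℝ) → ℝ}
    {Q : OneParticle (IntLattice ν) →L[ℂ] OneParticle (IntLattice ν)} (hQ : HasFourierSymbol q Q)
    {A : CubeL2 ν →L[ℂ] CubeL2 ν} (hA : IsMulOp q A) (k l : IntLattice ν) :
    inner ℂ (lp.single 2 k (1 : ℂ) : OneParticle (IntLattice ν)) (Q (lp.single 2 l (1 : ℂ))) =
      inner ℂ (waveBasis ν k) (A (waveBasis ν l)) := by
  set e : OneParticle (IntLattice ν) := lp.single 2 l (1 : ℂ) with he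
  have h1 : A (fourierL2 e) = fourierL2 (Q e) := by
    refine Lp.ext ?_
    filter_upwards [hA (fourierL2 e), hQ e] with t h2 h3
    rw [h2, h3]
  have h4 : A (waveBasis ν l) = (waveBasis ν).repr.symm (Q e) := by
    rw [← fourierL2_eq, ← h1, ← map_smul, fourierL2_eq, he, HilbertBasis.repr_symm_single]
  rw [h4, ← HilbertBasis.repr_apply_apply, LinearIsometryEquiv.apply_symm_apply]
  exact inner_lp_single _ k (Q e)

theorem HasFourierSymbol.compress_eq {q : (Fin ν → ℝ) → ℝ}
    {Q : OneParticle (IntLattice ν) →L[ℂ] OneParticle (IntLattice ν)} (hQ : HasFourierSymbol q Q)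
    {A : CubeL2 ν →L[ℂ] CubeL2 ν} (hA : IsMulOp q A) (Λ : Finset (IntLattice ν)) :
    compress Q Λ = compr (waveBasis ν) A Λ := by
  ext k l
  exact hQ.inner_single _ hA k l

end Spectra

/-! ### Symbols of functions of sandwiched products. -/

section Sandwich

open scoped Matrix.Norms.L2Operator

variable {ν : ℕ}

theorem HasEigenvaluesIn.of_posSemidef {m : Type*} [Fintype m] [DecidableEq m] {A : Matrix m m ℂ}
    (hA : A.PosSemidef) {C : ℝ} (hC : ‖A‖ ≤ C) : HasEigenvaluesIn (Set.Icc 0 C) A := by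
  obtain ⟨U, hU, h⟩ := exists_conjDiag hA.isHermitian
  refine ⟨U, _, hU, fun i => ⟨hA.eigenvalues_nonneg i, ?_⟩, h⟩
  have h1 := Matrix.l2_opNorm_mulVec A (hA.isHermitian.eigenvectorBasis i)
  have h2 : (EuclideanSpace.equiv m ℂ).symm (A *ᵥ (hA.isHermitian.eigenvectorBasis i).ofLp) =
      (hA.isHermitian.eigenvalues i : ℂ) • hA.isHermitian.eigenvectorBasis i := by
    rw [hA.isHermitian.mulVec_eigenvectorBasis]
    ext j
    simp
  have h3 : ‖(EuclideanSpace.equiv m ℂ).symm (A *ᵥ (hA.isHermitian.eigenvectorBasis i).ofLp)‖ ≤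
      ‖A‖ * ‖hA.isHermitian.eigenvectorBasis i‖ := h1
  rw [h2, norm_smul, hA.isHermitian.eigenvectorBasis.orthonormal.1 i, mul_one, mul_one,
    Complex.norm_real] at h3
  exact (le_abs_self _).trans (h3.trans hC)

theorem HasEigenvaluesIn.posSemidef {m : Type*} [Fintype m] [DecidableEq m] {A : Matrix m m ℂ}
    (hA : HasEigenvaluesIn (Set.Ici 0) A) : A.PosSemidef := by
  obtain ⟨U, d, -, hd, rfl⟩ := hA
  exact (Matrix.PosSemidef.diagonal fun k => by
    have h : 0 ≤ d k := hd k
    exact Complex.zero_le_real.mpr h).mul_mul_conjTranspose_same U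

theorem HasEigenvaluesIn.cfc {m : Type*} [Fintype m] [DecidableEq m] {A : Matrix m m ℂ}
    {s t : Set ℝ} (hA : HasEigenvaluesIn s A) {f : ℝ → ℝ} (hf : Set.MapsTo f s t) :
    HasEigenvaluesIn t (_root_.cfc f A) := by
  obtain ⟨U, d, hU, hd, rfl⟩ := hA
  exact ⟨U, _, hU, fun k => hf (hd k), cfc_conjDiag hU d f⟩

theorem HasEigenvaluesIn.isHermitian {m : Type*} [Fintype m] [DecidableEq m] {A : Matrix m m ℂ}
    {s : Set ℝ} (hA : HasEigenvaluesIn s A) : A.IsHermitian := by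
  obtain ⟨U, d, hU, hd, rfl⟩ := hA
  exact conjDiag_isHermitian U d

namespace HasSymbol

variable {M N : ∀ n, Matrix (box ν n) (box ν n) ℂ} {a b : (Fin ν → ℝ) → ℝ}

theorem const_mul (hM : HasSymbol M a) (z : ℝ) :
    HasSymbol (fun n => (z : ℂ) • M n) fun t => z * a t := by
  simpa using (hasSymbol_const z).mul hM

/-- The product N M N is Hermitian and positive, unlike M N in general. Its spectrum lies in a fixed
compact interval of [0, ∞) by the uniform norm bound, so continuity of f on the half-line suffices.
-/
theorem sandwich (hM : HasSymbol M a) (hN : HasSymbol N b)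
    (hM' : ∀ n, HasEigenvaluesIn (Set.Ici 0) (M n)) (hN' : ∀ n, (N n).IsHermitian)
    (ha : AEMeasurable a (cubeMeasure ν)) (hb : AEMeasurable b (cubeMeasure ν)) {C D : ℝ}
    (ha' : ∀ᵐ t ∂cubeMeasure ν, a t ∈ Set.Icc 0 C) (hb' : ∀ᵐ t ∂cubeMeasure ν, b t ∈ Set.Icc 0 D)
    {f : ℝ → ℝ} (hf : ContinuousOn f (Set.Ici 0)) :
    HasSymbol (fun n => _root_.cfc f (N n * M n * N n)) fun t => f (b t * a t * b t) := by
  have h := (hN.mul hM).mul hN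
  obtain ⟨E, hE⟩ := h.1
  have hE0 : 0 ≤ E := (norm_nonneg _).trans (hE 0)
  -- The interval must contain both the spectra, bounded by E, and the values of the symbol, bounded
  -- by D * C * D.
  refine h.cfc (x := 0) (y := max E (D * C * D)) (hE0.trans (le_max_left _ _)) (fun n => ?_)
    ((hb.mul ha).mul hb) ?_ (hf.mono Set.Icc_subset_Ici_self)
  · refine HasEigenvaluesIn.of_posSemidef ?_ ((hE n).trans (le_max_left _ _))
    have := (hM' n).posSemidef.mul_mul_conjTranspose_same (N n)
    rwa [(hN' n).eq] at this
  · filter_upwards [ha', hb'] with t h1 h2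
    refine ⟨mul_nonneg (mul_nonneg h2.1 h1.1) h2.1, le_trans ?_ (le_max_right _ _)⟩
    have hD := h2.1.trans h2.2
    have hC := h1.1.trans h1.2
    exact mul_le_mul (mul_le_mul h2.2 h1.2 h1.1 hD) h2.2 h2.1 (mul_nonneg hD hC)

end HasSymbol

theorem continuousOn_oddsPow {c : ℝ} (hc : 0 < c) (s : ℝ) :
    ContinuousOn (oddsPow s) (Set.Icc c (1 - c)) := by
  unfold oddsPow
  refine ContinuousOn.rpow_const (continuousOn_id.div (continuousOn_const.sub continuousOn_id) ?_) ?_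
  · intro x hx
    have := hx.2
    change 1 - x ≠ 0
    linarith
  · intro x hx
    exact Or.inl (div_pos (hc.trans_le hx.1) (by have := hx.2; change 0 < 1 - x; linarith)).ne'

end Sandwich

/-! ### Limits per site of the Rényi quantities and the relative entropy. -/

section Limits

variable {ν : ℕ}

theorem HasEigenvaluesIn.isStrictSymbol {X : Type*} [LinearOrder X] [Fintype X]
    {inst : DecidableEq X} {c : ℝ} (hc : 0 < c) {A : Matrix X X ℂ}
    (hA : HasEigenvaluesIn (Set.Icc c (1 - c)) A) : IsStrictSymbol A := by
  obtain rfl : inst = LinearOrder.toDecidableEq := Subsingleton.elim _ _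
  obtain ⟨U, d, hU, hd, h⟩ := hA
  exact ⟨U, d, hU, fun k => ⟨hc.trans_le (hd k).1, (hd k).2.trans_lt (by linarith)⟩, h⟩

theorem mem_Ioo_of_mem_Icc {c x : ℝ} (hc : 0 < c) (hx : x ∈ Set.Icc c (1 - c)) :
    x ∈ Set.Ioo (0 : ℝ) 1 :=
  ⟨hc.trans_le hx.1, hx.2.trans_lt (by linarith)⟩

theorem exists_oddsPow_bound {c : ℝ} (hc : 0 < c) (s : ℝ) :
    ∃ C, Set.MapsTo (oddsPow s) (Set.Icc c (1 - c)) (Set.Icc 0 C) := by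
  obtain ⟨C, hC⟩ := isCompact_Icc.exists_bound_of_continuousOn (continuousOn_oddsPow hc s)
  refine ⟨C, fun x hx => ⟨?_, (le_abs_self _).trans (hC x hx)⟩⟩
  exact (oddsPow_pos (mem_Ioo_of_mem_Icc hc hx)).le

theorem continuousOn_log_one_sub {c : ℝ} (hc : 0 < c) :
    ContinuousOn (fun x : ℝ => Real.log (1 - x)) (Set.Icc c (1 - c)) := by
  refine (continuousOn_const.sub continuousOn_id).log fun x hx => ?_
  have := hx.2
  change 1 - x ≠ 0
  linarith

theorem continuousOn_log_odds {c : ℝ} (hc : 0 < c) :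
    ContinuousOn (fun x : ℝ => Real.log (x / (1 - x))) (Set.Icc c (1 - c)) := by
  have h : ∀ x ∈ Set.Icc c (1 - c), 0 < 1 - x := fun x hx => by
    have := hx.2
    linarith
  refine (continuousOn_id.div (continuousOn_const.sub continuousOn_id) fun x hx =>
    (h x hx).ne').log fun x hx => (div_pos (hc.trans_le hx.1) (h x hx)).ne'

/-- Scalar counterpart of the determinant formulas: extracting the vacuum weight (1-x)^α (1-y)^(1-α)
from the two-term sum leaves 1 plus the product of odds. -/
theorem logIntegrand_eq {α x y p : ℝ} (hx : x ∈ Set.Ioo (0 : ℝ) 1) (hy : y ∈ Set.Ioo (0 : ℝ) 1)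
    (hp : p = (x / (1 - x)) ^ α * (y / (1 - y)) ^ (1 - α)) :
    α * Real.log (1 - x) + (1 - α) * Real.log (1 - y) + Real.log (1 + p) =
      logIntegrand α x y := by
  have hx' : 0 < 1 - x := sub_pos.mpr hx.2
  have hy' : 0 < 1 - y := sub_pos.mpr hy.2
  have h1 : 0 < (1 - x) ^ α := Real.rpow_pos_of_pos hx' _
  have h2 : 0 < (1 - y) ^ (1 - α) := Real.rpow_pos_of_pos hy' _
  have hp0 : 0 < p := by
    rw [hp]
    exact mul_pos (Real.rpow_pos_of_pos (div_pos hx.1 hx') _)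
      (Real.rpow_pos_of_pos (div_pos hy.1 hy') _)
  rw [logIntegrand, ← Real.log_rpow hx', ← Real.log_rpow hy', ← Real.log_mul h1.ne' h2.ne',
    ← Real.log_mul (mul_pos h1 h2).ne' (by positivity)]
  congr 1
  rw [hp, Real.div_rpow hx.1.le hx'.le, Real.div_rpow hy.1.le hy'.le]
  field_simp
  ring

variable {q r : (Fin ν → ℝ) → ℝ} {c : ℝ} {M N : ∀ n, Matrix (box ν n) (box ν n) ℂ}
  {ρ σ : ∀ n, Matrix (Finset (box ν n)) (Finset (box ν n)) ℂ}

theorem tendsto_psiPetz (hq : AEMeasurable q (cubeMeasure ν)) (hr : AEMeasurable r (cubeMeasure ν))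
    (hc : 0 < c) (hc' : c ≤ 1 - c) (hqc : ∀ᵐ t ∂cubeMeasure ν, q t ∈ Set.Icc c (1 - c))
    (hrc : ∀ᵐ t ∂cubeMeasure ν, r t ∈ Set.Icc c (1 - c)) (hM : HasSymbol M q) (hN : HasSymbol N r)
    (hM' : ∀ n, HasEigenvaluesIn (Set.Icc c (1 - c)) (M n))
    (hN' : ∀ n, HasEigenvaluesIn (Set.Icc c (1 - c)) (N n))
    (hρ : ∀ n, IsQuasiFreeDensity (M n) (ρ n)) (hσ : ∀ n, IsQuasiFreeDensity (N n) (σ n)) (α : ℝ) :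
    Tendsto (fun n : ℕ => psiPetz α (ρ n) (σ n) / (n : ℝ) ^ ν) atTop
      (𝓝 (1 / (2 * Real.pi) ^ ν * ∫ t, logIntegrand α (q t) (r t) ∂cubeMeasure ν)) := by
  obtain ⟨C, hC⟩ := exists_oddsPow_bound hc α
  obtain ⟨D, hD⟩ := exists_oddsPow_bound hc ((1 - α) / 2)
  have h1 := hM.cfc hc' hM' hq hqc (continuousOn_log_one_sub hc)
  have h2 := hN.cfc hc' hN' hr hrc (continuousOn_log_one_sub hc)
  have h3 := (hM.cfc hc' hM' hq hqc (continuousOn_oddsPow hc α)).sandwich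
    (hN.cfc hc' hN' hr hrc (continuousOn_oddsPow hc ((1 - α) / 2)))
    (fun n => (hM' n).cfc fun x hx => (hC hx).1)
    (fun n => ((hN' n).cfc hD).isHermitian)
    (aemeasurable_comp_of_continuousOn hq hc' hqc (continuousOn_oddsPow hc _))
    (aemeasurable_comp_of_continuousOn hr hc' hrc (continuousOn_oddsPow hc _))
    (hqc.mono fun t ht => hC ht) (hrc.mono fun t ht => hD ht)
    (f := fun x => Real.log (1 + x))
    ((continuousOn_const.add continuousOn_id).log fun x hx =>
      (add_pos_of_pos_of_nonneg one_pos hx).ne')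
  have h4 := (((h1.const_mul α).add (h2.const_mul (1 - α))).add h3).tendsto_trace
  have h5 : ∀ n, psiPetz α (ρ n) (σ n) =
      α * (cfc (fun x : ℝ => Real.log (1 - x)) (M n)).trace.re +
      (1 - α) * (cfc (fun x : ℝ => Real.log (1 - x)) (N n)).trace.re +
      (cfc (fun x : ℝ => Real.log (1 + x)) (cfc (oddsPow ((1 - α) / 2)) (N n) *
        cfc (oddsPow α) (M n) * cfc (oddsPow ((1 - α) / 2)) (N n))).trace.re := fun n => by
    have h := psiPetz_eq ((hM' n).isStrictSymbol hc) ((hN' n).isStrictSymbol hc) (hρ n) (hσ n) α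
    unfold logVacuum at h
    convert h
  simp only [Matrix.trace_add, Matrix.trace_smul, Complex.add_re, smul_eq_mul,
    Complex.re_ofReal_mul, ← h5] at h4
  have h6 : ∫ t, logIntegrand α (q t) (r t) ∂cubeMeasure ν = ∫ t, (α * Real.log (1 - q t) +
      (1 - α) * Real.log (1 - r t) + Real.log (1 + oddsPow ((1 - α) / 2) (r t) * oddsPow α (q t) *
        oddsPow ((1 - α) / 2) (r t))) ∂cubeMeasure ν := by
    refine integral_congr_ae ?_
    filter_upwards [hqc, hrc] with t hqt hrt
    have hq1 := mem_Ioo_of_mem_Icc hc hqt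
    have hr1 := mem_Ioo_of_mem_Icc hc hrt
    refine (logIntegrand_eq hq1 hr1 ?_).symm
    have hy := div_pos hr1.1 (sub_pos.mpr hr1.2)
    rw [oddsPow, oddsPow, mul_comm, ← mul_assoc, ← Real.rpow_add hy, add_halves, mul_comm]
  rw [h6]
  exact h4

theorem tendsto_psiSandwiched (hq : AEMeasurable q (cubeMeasure ν))
    (hr : AEMeasurable r (cubeMeasure ν)) (hc : 0 < c) (hc' : c ≤ 1 - c)
    (hqc : ∀ᵐ t ∂cubeMeasure ν, q t ∈ Set.Icc c (1 - c))
    (hrc : ∀ᵐ t ∂cubeMeasure ν, r t ∈ Set.Icc c (1 - c)) (hM : HasSymbol M q) (hN : HasSymbol N r)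
    (hM' : ∀ n, HasEigenvaluesIn (Set.Icc c (1 - c)) (M n))
    (hN' : ∀ n, HasEigenvaluesIn (Set.Icc c (1 - c)) (N n))
    (hρ : ∀ n, IsQuasiFreeDensity (M n) (ρ n)) (hσ : ∀ n, IsQuasiFreeDensity (N n) (σ n)) {α : ℝ}
    (hα : 0 < α) :
    Tendsto (fun n : ℕ => psiSandwiched α (ρ n) (σ n) / (n : ℝ) ^ ν) atTop
      (𝓝 (1 / (2 * Real.pi) ^ ν * ∫ t, logIntegrand α (q t) (r t) ∂cubeMeasure ν)) := by
  obtain ⟨C, hC⟩ := exists_oddsPow_bound hc ((1 - α) / α)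
  obtain ⟨D, hD⟩ := exists_oddsPow_bound hc (1 / 2)
  have h1 := hM.cfc hc' hM' hq hqc (continuousOn_log_one_sub hc)
  have h2 := hN.cfc hc' hN' hr hrc (continuousOn_log_one_sub hc)
  have h3 := (hN.cfc hc' hN' hr hrc (continuousOn_oddsPow hc ((1 - α) / α))).sandwich
    (hM.cfc hc' hM' hq hqc (continuousOn_oddsPow hc (1 / 2)))
    (fun n => (hN' n).cfc fun x hx => (hC hx).1)
    (fun n => ((hM' n).cfc hD).isHermitian)
    (aemeasurable_comp_of_continuousOn hr hc' hrc (continuousOn_oddsPow hc _))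
    (aemeasurable_comp_of_continuousOn hq hc' hqc (continuousOn_oddsPow hc _))
    (hrc.mono fun t ht => hC ht) (hqc.mono fun t ht => hD ht)
    (f := fun x => Real.log (1 + x ^ α))
    -- Positivity of α enters here: x ^ α must be continuous up to 0, where the interval of the
    -- functional calculus begins.
    ((continuousOn_const.add (continuousOn_id.rpow_const fun x _ => Or.inr hα.le)).log fun x hx =>
      (add_pos_of_pos_of_nonneg one_pos (Real.rpow_nonneg hx α)).ne')
  have h4 := (((h1.const_mul α).add (h2.const_mul (1 - α))).add h3).tendsto_trace
  have h5 : ∀ n, psiSandwiched α (ρ n) (σ n) =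
      α * (cfc (fun x : ℝ => Real.log (1 - x)) (M n)).trace.re +
      (1 - α) * (cfc (fun x : ℝ => Real.log (1 - x)) (N n)).trace.re +
      (cfc (fun x : ℝ => Real.log (1 + x ^ α)) (cfc (oddsPow (1 / 2)) (M n) *
        cfc (oddsPow ((1 - α) / α)) (N n) * cfc (oddsPow (1 / 2)) (M n))).trace.re := fun n => by
    have h := psiSandwiched_eq ((hM' n).isStrictSymbol hc) ((hN' n).isStrictSymbol hc) (hρ n)
      (hσ n) hα
    unfold logVacuum at h
    convert h
  simp only [Matrix.trace_add, Matrix.trace_smul, Complex.add_re, smul_eq_mul,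
    Complex.re_ofReal_mul, ← h5] at h4
  have h6 : ∫ t, logIntegrand α (q t) (r t) ∂cubeMeasure ν = ∫ t, (α * Real.log (1 - q t) +
      (1 - α) * Real.log (1 - r t) + Real.log (1 + (oddsPow (1 / 2) (q t) *
        oddsPow ((1 - α) / α) (r t) * oddsPow (1 / 2) (q t)) ^ α)) ∂cubeMeasure ν := by
    refine integral_congr_ae ?_
    filter_upwards [hqc, hrc] with t hqt hrt
    have hq1 := mem_Ioo_of_mem_Icc hc hqt
    have hr1 := mem_Ioo_of_mem_Icc hc hrt
    refine (logIntegrand_eq hq1 hr1 ?_).symm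
    have hx := div_pos hq1.1 (sub_pos.mpr hq1.2)
    have hy := div_pos hr1.1 (sub_pos.mpr hr1.2)
    rw [oddsPow, oddsPow, mul_comm, ← mul_assoc, ← Real.rpow_add hx, add_halves, Real.rpow_one,
      Real.mul_rpow hx.le (Real.rpow_nonneg hy.le _), ← Real.rpow_mul hy.le,
      div_mul_cancel₀ _ hα.ne']
  rw [h6]
  exact h4

theorem entropyIntegrand_eq {x y : ℝ} (hx : x ∈ Set.Ioo (0 : ℝ) 1) (hy : y ∈ Set.Ioo (0 : ℝ) 1) :
    Real.log (1 - x) + x * Real.log (x / (1 - x)) +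
      (-1 * Real.log (1 - y) + -1 * (x * Real.log (y / (1 - y)))) = entropyIntegrand x y := by
  have hx' : 1 - x ≠ 0 := (sub_pos.mpr hx.2).ne'
  have hy' : 1 - y ≠ 0 := (sub_pos.mpr hy.2).ne'
  rw [entropyIntegrand, Real.log_div hx.1.ne' hx', Real.log_div hy.1.ne' hy',
    Real.log_div hx.1.ne' hy.1.ne', Real.log_div hx' hy']
  ring

theorem tendsto_relEntropy (hq : AEMeasurable q (cubeMeasure ν))
    (hr : AEMeasurable r (cubeMeasure ν)) (hc : 0 < c) (hc' : c ≤ 1 - c)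
    (hqc : ∀ᵐ t ∂cubeMeasure ν, q t ∈ Set.Icc c (1 - c))
    (hrc : ∀ᵐ t ∂cubeMeasure ν, r t ∈ Set.Icc c (1 - c)) (hM : HasSymbol M q) (hN : HasSymbol N r)
    (hM' : ∀ n, HasEigenvaluesIn (Set.Icc c (1 - c)) (M n))
    (hN' : ∀ n, HasEigenvaluesIn (Set.Icc c (1 - c)) (N n))
    (hρ : ∀ n, IsQuasiFreeDensity (M n) (ρ n)) (hσ : ∀ n, IsQuasiFreeDensity (N n) (σ n)) :
    Tendsto (fun n : ℕ => relEntropy (ρ n) (σ n) / (((n : ℝ) ^ ν : ℝ) : EReal)) atTop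
      (𝓝 ((1 / (2 * Real.pi) ^ ν *
        ∫ t, entropyIntegrand (q t) (r t) ∂cubeMeasure ν : ℝ) : EReal)) := by
  have h1 := hM.cfc hc' hM' hq hqc (continuousOn_log_one_sub hc)
  have h2 := hN.cfc hc' hN' hr hrc (continuousOn_log_one_sub hc)
  have h3 := hM.mul (hM.cfc hc' hM' hq hqc (continuousOn_log_odds hc))
  have h4 := hM.mul (hN.cfc hc' hN' hr hrc (continuousOn_log_odds hc))
  have h5 := ((h1.add h3).add ((h2.const_mul (-1)).add (h4.const_mul (-1)))).tendsto_trace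
  have h6 : ∀ n, relEntropy (ρ n) (σ n) =
      (((cfc (fun x : ℝ => Real.log (1 - x)) (M n)).trace.re +
        (M n * cfc (fun x : ℝ => Real.log (x / (1 - x))) (M n)).trace.re -
        ((cfc (fun x : ℝ => Real.log (1 - x)) (N n)).trace.re +
        (M n * cfc (fun x : ℝ => Real.log (x / (1 - x))) (N n)).trace.re) : ℝ) : EReal) :=
    fun n => by
      have h := relEntropy_eq ((hM' n).isStrictSymbol hc) ((hN' n).isStrictSymbol hc) (hρ n) (hσ n)
      unfold logVacuum at h
      convert h
  have h7 : ∫ t, entropyIntegrand (q t) (r t) ∂cubeMeasure ν = ∫ t, (Real.log (1 - q t) +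
      q t * Real.log (q t / (1 - q t)) + (-1 * Real.log (1 - r t) +
        -1 * (q t * Real.log (r t / (1 - r t))))) ∂cubeMeasure ν := by
    refine integral_congr_ae ?_
    filter_upwards [hqc, hrc] with t hqt hrt
    exact (entropyIntegrand_eq (mem_Ioo_of_mem_Icc hc hqt) (mem_Ioo_of_mem_Icc hc hrt)).symm
  -- All entropies are finite, so convergence can be proved in the reals and pushed through the
  -- continuous coercion.
  simp only [h6, ← EReal.coe_div]
  refine (continuous_coe_real_ereal.tendsto _).comp ?_
  rw [h7]
  refine h5.congr fun n => ?_
  congr 1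
  simp only [Matrix.trace_add, Matrix.trace_smul, Complex.add_re, smul_eq_mul,
    Complex.re_ofReal_mul]
  ring

end Limits

/-! ### Differentiation in α under the integral. -/

section Derivative

theorem exists_log_div_bound {c : ℝ} (hc : 0 < c) : ∃ K, ∀ x ∈ Set.Icc c (1 - c),
    ∀ y ∈ Set.Icc c (1 - c), |Real.log (x / y)| ≤ K := by
  have h : ContinuousOn (fun p : ℝ × ℝ => Real.log (p.1 / p.2))
      (Set.Icc c (1 - c) ×ˢ Set.Icc c (1 - c)) :=
    (continuousOn_fst.div continuousOn_snd fun p hp => (hc.trans_le hp.2.1).ne').log fun p hp =>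
      (div_pos (hc.trans_le hp.1.1) (hc.trans_le hp.2.1)).ne'
  obtain ⟨K, hK⟩ := (isCompact_Icc.prod isCompact_Icc).exists_bound_of_continuousOn h
  exact ⟨K, fun x hx y hy => hK (x, y) ⟨hx, hy⟩⟩

theorem exists_logIntegrand_bound {c : ℝ} (hc : 0 < c) (α : ℝ) : ∃ K, ∀ x ∈ Set.Icc c (1 - c),
    ∀ y ∈ Set.Icc c (1 - c), ‖logIntegrand α x y‖ ≤ K := by
  have h1 : ∀ x ∈ Set.Icc c (1 - c), 0 < x := fun x hx => hc.trans_le hx.1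
  have h2 : ∀ x ∈ Set.Icc c (1 - c), 0 < 1 - x := fun x hx => by have := hx.2; linarith
  have h : ContinuousOn (fun p : ℝ × ℝ => logIntegrand α p.1 p.2)
      (Set.Icc c (1 - c) ×ˢ Set.Icc c (1 - c)) := by
    refine ContinuousOn.log (ContinuousOn.add (ContinuousOn.mul
      (continuousOn_fst.rpow_const fun p hp => Or.inl (h1 _ hp.1).ne')
      (continuousOn_snd.rpow_const fun p hp => Or.inl (h1 _ hp.2).ne')) (ContinuousOn.mul
      ((continuousOn_const.sub continuousOn_fst).rpow_const fun p hp => Or.inl (h2 _ hp.1).ne')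
      ((continuousOn_const.sub continuousOn_snd).rpow_const fun p hp => Or.inl (h2 _ hp.2).ne')))
      fun p hp => ?_
    have a1 := Real.rpow_pos_of_pos (h1 _ hp.1) α
    have a2 := Real.rpow_pos_of_pos (h1 _ hp.2) (1 - α)
    have a3 := Real.rpow_pos_of_pos (h2 _ hp.1) α
    have a4 := Real.rpow_pos_of_pos (h2 _ hp.2) (1 - α)
    positivity
  obtain ⟨K, hK⟩ := (isCompact_Icc.prod isCompact_Icc).exists_bound_of_continuousOn h
  exact ⟨K, fun x hx y hy => hK (x, y) ⟨hx, hy⟩⟩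

/-- The derivative of `logIntegrand` in its first argument. -/
def logIntegrandDeriv (α q r : ℝ) : ℝ :=
  (q ^ α * r ^ (1 - α) * Real.log (q / r) +
    (1 - q) ^ α * (1 - r) ^ (1 - α) * Real.log ((1 - q) / (1 - r))) /
    (q ^ α * r ^ (1 - α) + (1 - q) ^ α * (1 - r) ^ (1 - α))

theorem hasDerivAt_rpow_mul_rpow {x y : ℝ} (hx : 0 < x) (hy : 0 < y) (α : ℝ) :
    HasDerivAt (fun α => x ^ α * y ^ (1 - α)) (x ^ α * y ^ (1 - α) * Real.log (x / y)) α := by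
  have h1 := (Real.hasStrictDerivAt_const_rpow hx α).hasDerivAt
  have h2 := (Real.hasStrictDerivAt_const_rpow hy (1 - α)).hasDerivAt.comp α
    ((hasDerivAt_id α).const_sub 1)
  refine (h1.mul h2).congr_deriv ?_
  rw [Real.log_div hx.ne' hy.ne']
  simp only [Function.comp_apply]
  ring

theorem hasDerivAt_logIntegrand {x y : ℝ} (hx : x ∈ Set.Ioo (0 : ℝ) 1)
    (hy : y ∈ Set.Ioo (0 : ℝ) 1) (α : ℝ) :
    HasDerivAt (fun α => logIntegrand α x y) (logIntegrandDeriv α x y) α := by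
  have hx' : 0 < 1 - x := sub_pos.mpr hx.2
  have hy' : 0 < 1 - y := sub_pos.mpr hy.2
  have a1 := mul_pos (Real.rpow_pos_of_pos hx.1 α) (Real.rpow_pos_of_pos hy.1 (1 - α))
  have a2 := mul_pos (Real.rpow_pos_of_pos hx' α) (Real.rpow_pos_of_pos hy' (1 - α))
  exact ((hasDerivAt_rpow_mul_rpow hx.1 hy.1 α).add (hasDerivAt_rpow_mul_rpow hx' hy' α)).log
    (add_pos a1 a2).ne'

/-- The derivative is a weighted average of log(x/y) and log((1-x)/(1-y)) with positive weights, so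
the bound does not depend on α. -/
theorem abs_logIntegrandDeriv_le {x y K : ℝ} (hx : x ∈ Set.Ioo (0 : ℝ) 1)
    (hy : y ∈ Set.Ioo (0 : ℝ) 1) (h1 : |Real.log (x / y)| ≤ K)
    (h2 : |Real.log ((1 - x) / (1 - y))| ≤ K) (α : ℝ) : |logIntegrandDeriv α x y| ≤ K := by
  have hx' : 0 < 1 - x := sub_pos.mpr hx.2
  have hy' : 0 < 1 - y := sub_pos.mpr hy.2
  have a1 := mul_pos (Real.rpow_pos_of_pos hx.1 α) (Real.rpow_pos_of_pos hy.1 (1 - α))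
  have a2 := mul_pos (Real.rpow_pos_of_pos hx' α) (Real.rpow_pos_of_pos hy' (1 - α))
  rw [logIntegrandDeriv, abs_div, abs_of_pos (add_pos a1 a2), div_le_iff₀ (add_pos a1 a2)]
  refine (abs_add_le _ _).trans ?_
  rw [abs_mul (_ * _), abs_mul (_ * _) (Real.log ((1 - x) / _)), abs_of_pos a1, abs_of_pos a2]
  have b1 := mul_le_mul_of_nonneg_left h1 a1.le
  have b2 := mul_le_mul_of_nonneg_left h2 a2.le
  linarith

theorem logIntegrandDeriv_one (x y : ℝ) : logIntegrandDeriv 1 x y = entropyIntegrand x y := by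
  simp [logIntegrandDeriv, entropyIntegrand]

variable {ν : ℕ} {q r : (Fin ν → ℝ) → ℝ} {c : ℝ}

theorem aemeasurable_logIntegrand (hq : AEMeasurable q (cubeMeasure ν))
    (hr : AEMeasurable r (cubeMeasure ν)) (α : ℝ) :
    AEMeasurable (fun t => logIntegrand α (q t) (r t)) (cubeMeasure ν) := by
  unfold logIntegrand
  fun_prop

theorem aemeasurable_logIntegrandDeriv (hq : AEMeasurable q (cubeMeasure ν))
    (hr : AEMeasurable r (cubeMeasure ν)) (α : ℝ) :
    AEMeasurable (fun t => logIntegrandDeriv α (q t) (r t)) (cubeMeasure ν) := by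
  unfold logIntegrandDeriv
  fun_prop

theorem integrable_logIntegrand (hq : AEMeasurable q (cubeMeasure ν))
    (hr : AEMeasurable r (cubeMeasure ν)) (hc : 0 < c)
    (hqc : ∀ᵐ t ∂cubeMeasure ν, q t ∈ Set.Icc c (1 - c))
    (hrc : ∀ᵐ t ∂cubeMeasure ν, r t ∈ Set.Icc c (1 - c)) (α : ℝ) :
    Integrable (fun t => logIntegrand α (q t) (r t)) (cubeMeasure ν) := by
  obtain ⟨K, hK⟩ := exists_logIntegrand_bound hc α
  refine Integrable.of_bound (aemeasurable_logIntegrand hq hr α).aestronglyMeasurable K ?_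
  filter_upwards [hqc, hrc] with t h1 h2 using hK _ h1 _ h2

theorem hasDerivAt_integral_logIntegrand (hq : AEMeasurable q (cubeMeasure ν))
    (hr : AEMeasurable r (cubeMeasure ν)) (hc : 0 < c)
    (hqc : ∀ᵐ t ∂cubeMeasure ν, q t ∈ Set.Icc c (1 - c))
    (hrc : ∀ᵐ t ∂cubeMeasure ν, r t ∈ Set.Icc c (1 - c)) (α : ℝ) :
    Integrable (fun t => logIntegrandDeriv α (q t) (r t)) (cubeMeasure ν) ∧
      HasDerivAt (fun α => ∫ t, logIntegrand α (q t) (r t) ∂cubeMeasure ν)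
        (∫ t, logIntegrandDeriv α (q t) (r t) ∂cubeMeasure ν) α := by
  obtain ⟨K, hK⟩ := exists_log_div_bound hc
  have hsub : ∀ x ∈ Set.Icc c (1 - c), 1 - x ∈ Set.Icc c (1 - c) := fun x hx =>
    ⟨by linarith [hx.2], by linarith [hx.1]⟩
  -- A constant dominates for every α, so the whole line serves as the neighbourhood; it is
  -- integrable because the cube has finite measure.
  refine hasDerivAt_integral_of_dominated_loc_of_deriv_le (bound := fun _ => K)
    (F' := fun β t => logIntegrandDeriv β (q t) (r t)) univ_mem
    (Eventually.of_forall fun β => (aemeasurable_logIntegrand hq hr β).aestronglyMeasurable)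
    (integrable_logIntegrand hq hr hc hqc hrc α)
    (aemeasurable_logIntegrandDeriv hq hr α).aestronglyMeasurable ?_ (integrable_const K) ?_
  · filter_upwards [hqc, hrc] with t h1 h2 β _
    exact abs_logIntegrandDeriv_le (mem_Ioo_of_mem_Icc hc h1) (mem_Ioo_of_mem_Icc hc h2)
      (hK _ h1 _ h2) (hK _ (hsub _ h1) _ (hsub _ h2)) β
  · filter_upwards [hqc, hrc] with t h1 h2 β _
    exact hasDerivAt_logIntegrand (mem_Ioo_of_mem_Icc hc h1) (mem_Ioo_of_mem_Icc hc h2) β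

end Derivative
end Fermion
end

/-! ### Assembly of the theorem. -/

open Fermion in
theorem mainTheorem7 (ν : ℕ) (q r : (Fin ν → ℝ) → ℝ)
    (hq : AEMeasurable q (cubeMeasure ν)) (hr : AEMeasurable r (cubeMeasure ν))
    (c : ℝ) (hc : c ∈ Set.Ioo (0 : ℝ) (1 / 2))
    (hqc : ∀ᵐ t ∂cubeMeasure ν, q t ∈ Set.Icc c (1 - c))
    (hrc : ∀ᵐ t ∂cubeMeasure ν, r t ∈ Set.Icc c (1 - c))
    (Q R : OneParticle (IntLattice ν) →L[ℂ] OneParticle (IntLattice ν))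
    (hQ : HasFourierSymbol q Q) (hR : HasFourierSymbol r R)
    (ωQ ωR : CAR (IntLattice ν) →ₗ[ℂ] ℂ)
    (hωQ : IsQuasiFreeState Q ωQ) (hωR : IsQuasiFreeState R ωR)
    (ρ σ : ∀ n : ℕ, Matrix (Finset (box ν n)) (Finset (box ν n)) ℂ)
    (hρ : ∀ n, IsReducedDensity ωQ (box ν n) (ρ n))
    (hσ : ∀ n, IsReducedDensity ωR (box ν n) (σ n)) :
    (∀ n, IsQuasiFreeDensity (compress Q (box ν n)) (ρ n) ∧
      IsQuasiFreeDensity (compress R (box ν n)) (σ n)) ∧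
    (∀ α : ℝ, 0 < α →
      Tendsto (fun n : ℕ => psiPetz α (ρ n) (σ n) / (n : ℝ) ^ ν) atTop (𝓝 (psiBar ρ σ α)) ∧
      Tendsto (fun n : ℕ => psiSandwiched α (ρ n) (σ n) / (n : ℝ) ^ ν) atTop
        (𝓝 (psiBar ρ σ α)) ∧
      Integrable (fun t => logIntegrand α (q t) (r t)) (cubeMeasure ν) ∧
      psiBar ρ σ α =
        1 / (2 * Real.pi) ^ ν * ∫ t, logIntegrand α (q t) (r t) ∂cubeMeasure ν) ∧
    DifferentiableOn ℝ (psiBar ρ σ) (Set.Ioi 0) ∧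
    Integrable (fun t => entropyIntegrand (q t) (r t)) (cubeMeasure ν) ∧
    HasDerivAt (psiBar ρ σ)
      (1 / (2 * Real.pi) ^ ν * ∫ t, entropyIntegrand (q t) (r t) ∂cubeMeasure ν) 1 ∧
    Tendsto (fun n : ℕ => relEntropy (ρ n) (σ n) / (((n : ℝ) ^ ν : ℝ) : EReal)) atTop
      (𝓝 ((1 / (2 * Real.pi) ^ ν *
        ∫ t, entropyIntegrand (q t) (r t) ∂cubeMeasure ν : ℝ) : EReal)) := by
  have hc0 : 0 < c := hc.1
  have hc1 : c ≤ 1 - c := by linarith [hc.2]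
  have habs : ∀ x ∈ Set.Icc c (1 - c), |x| ≤ 1 := fun x hx => by
    rw [abs_of_pos (hc0.trans_le hx.1)]
    linarith [hx.2]
  obtain ⟨A, hA, -⟩ := exists_isMulOp hq zero_le_one (hqc.mono fun t ht => habs _ ht)
  obtain ⟨B, hB, -⟩ := exists_isMulOp hr zero_le_one (hrc.mono fun t ht => habs _ ht)
  have hQF : ∀ n, IsQuasiFreeDensity (compress Q (box ν n)) (ρ n) := fun n =>
    (hρ n).isQuasiFreeDensity hωQ
  have hRF : ∀ n, IsQuasiFreeDensity (compress R (box ν n)) (σ n) := fun n =>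
    (hσ n).isQuasiFreeDensity hωR
  have hQA : ∀ n, compress Q (box ν n) = compr (waveBasis ν) A (box ν n) := fun n =>
    hQ.compress_eq hA _
  have hRB : ∀ n, compress R (box ν n) = compr (waveBasis ν) B (box ν n) := fun n =>
    hR.compress_eq hB _
  have hQF' := hQF
  have hRF' := hRF
  simp only [hQA] at hQF'
  simp only [hRB] at hRF'
  have hSA := hasSymbol_compr hA
  have hSB := hasSymbol_compr hB
  have hEA := fun n => hA.hasEigenvaluesIn hqc (box ν n)
  have hEB := fun n => hB.hasEigenvaluesIn hrc (box ν n)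
  have hbar : ∀ α, 0 < α → psiBar ρ σ α =
      1 / (2 * Real.pi) ^ ν * ∫ t, logIntegrand α (q t) (r t) ∂cubeMeasure ν := fun α hα =>
    -- Convergence of the sequence makes its real-valued `limsup` equal to the limit.
    (tendsto_psiSandwiched hq hr hc0 hc1 hqc hrc hSA hSB hEA hEB hQF' hRF' hα).limsup_eq
  have hderiv : ∀ α, 0 < α → HasDerivAt (psiBar ρ σ) (1 / (2 * Real.pi) ^ ν *
      ∫ t, logIntegrandDeriv α (q t) (r t) ∂cubeMeasure ν) α := fun α hα => by
    refine ((hasDerivAt_integral_logIntegrand hq hr hc0 hqc hrc α).2.const_mul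
      (1 / (2 * Real.pi) ^ ν)).congr_of_eventuallyEq ?_
    -- The formula for `psiBar` is available for positive arguments only, which is enough near α.
    filter_upwards [Ioi_mem_nhds hα] with β hβ using hbar β hβ
  have hone : ∀ t, logIntegrandDeriv 1 (q t) (r t) = entropyIntegrand (q t) (r t) := fun t =>
    logIntegrandDeriv_one _ _
  refine ⟨fun n => ⟨hQF n, hRF n⟩, fun α hα => ⟨?_, ?_, ?_, hbar α hα⟩, fun α hα =>
    (hderiv α hα).differentiableAt.differentiableWithinAt, ?_, ?_, ?_⟩
  · rw [hbar α hα]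
    exact tendsto_psiPetz hq hr hc0 hc1 hqc hrc hSA hSB hEA hEB hQF' hRF' α
  · rw [hbar α hα]
    exact tendsto_psiSandwiched hq hr hc0 hc1 hqc hrc hSA hSB hEA hEB hQF' hRF' hα
  · exact integrable_logIntegrand hq hr hc0 hqc hrc α
  · simpa only [hone] using (hasDerivAt_integral_logIntegrand hq hr hc0 hqc hrc 1).1
  · simpa only [hone] using hderiv 1 one_pos
  · exact tendsto_relEntropy hq hr hc0 hc1 hqc hrc hSA hSB hEA hEB hQF' hRF'
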